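/- A system of \emph{linear equations with min and max operators} (LEMM) with rational data consists of integers $n_1,n_2\ge 0$ and $n\ge n_1+n_2$, non-empty sets $\mathcal J(i)\subseteq\{1,\dots,n\}$ for $1\le i\le n_1+n_2$, and vectors $q_k\in\mathbb Q^n$ and numbers $b_k\in\mathbb Q$ for $n_1+n_2<k\le n$. A vector $x\in\mathbb R^n$ is \emph{feasible} if $x_i=\min_{l\in\mathcal J(i)}x_l$ for $1\le i\le n_1$, $x_j=\max_{l\in\mathcal J(j)}x_l$ for $n_1<j\le n_1+n_2$, and $x_k=q_k^{\top}x+b_k$ for $n_1+n_2<k\le n$. The \emph{LEMM decision problem} is: given an LEMM, an index $i\in\{1,\dots,n\}$ and a threshold $\beta\in\mathbb Q$, is there a feasible $x$ with $x_i<\beta$? Let $\mathcal Q$ be the set of all $n\times n$ matrices whose $j$-th row is $e_{\ell(j)}^{\top}$ with $\ell(j)\in\mathcal J(j)$ for $j\le n_1+n_2$, and whose $k$-th row is $q_k^{\top}$ for $k>n_1+n_2$. Consider the conditions (C1) $\lim_{p\to\infty}Q^p=0$ for every $Q$ in the convex hull of $\mathcal Q$ (halting); (C3) $q_k^{\top}\mathbf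 1+b_k\le 1$ for all $n_1+n_2<k\le n$; (C4) $n_1=0$ or $n_2=0$. The LEMM decision problem \emph{under} a set of conditions is its restriction (as a promise problem) to the LEMMs that satisfy these conditions. A polynomial-time reduction between such problems is a map on instances, computable in polynomial time on a Turing machine (rational numbers are written in binary), that sends every instance satisfying the promise of the first problem to an instance satisfying the promise of the second, with the same answer. A \emph{simple stochastic game} (SSG) is a finite directed graph with two absorbing sinks (the $0$-sink and the $1$-sink), a start vertex, and all other vertices of kind max, min or average, each with two outgoing edges. Positional strategies $\sigma$ and $\tau$ of the players max and min choose one outgoing edge at each max, respectively min, vertex; at average vertices each outgoing edge is taken with probability $1/2$. The value of the game is $\max_\sigma\min_\tau$ of the probability of reaching the $1$-sink from the start vertex, and the SSG problem asks whether the value is greater than $1/2$. A problem is \emph{SSG-hard} if there is a polynomial-time reduction from the SSG problem to it. \textbf{Theorem.} The LEMM decision problems under $\{C1,C3,C4\}$, $\{C1,C3\}$, $\{C1,C4\}$ and $\{C1\}$ are polynomial-time equivalent (each of them is polynomial-time reducible to each other one), and each of them is SSG-hard. Moreover, there is a polynomial-time reduction from the LEMM decision problem under $\{C1\}$ to the LEMM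 decision problem restricted to LEMMs that satisfy C1 and C3 and are min-only ($n_2=0$). -/

import Mathlib

open Filter Topology Computability

/-! ### Linear equations with min and max operators -/

/-- The `n = n₁ + n₂ + m` variables: `n₁` min variables, then `n₂` max variables, then `m` affine
variables. -/
abbrev LEMMVar (n₁ n₂ m : ℕ) : Type := Fin n₁ ⊕ (Fin n₂ ⊕ Fin m)

/-- Linear equations with min and max operators, with rational data. -/
structure LEMM where
  /-- number of min variables -/
  n₁ : ℕ
  /-- number of max variables -/
  n₂ : ℕ
  /-- number of affine variables -/
  m : ℕ
  /-- the variables over which the minimum is taken -/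
  Jmin : Fin n₁ → Finset (LEMMVar n₁ n₂ m)
  /-- the variables over which the maximum is taken -/
  Jmax : Fin n₂ → Finset (LEMMVar n₁ n₂ m)
  Jmin_nonempty : ∀ i, (Jmin i).Nonempty
  Jmax_nonempty : ∀ j, (Jmax j).Nonempty
  /-- the coefficients of the affine equations -/
  q : Fin m → LEMMVar n₁ n₂ m → ℚ
  /-- the constants of the affine equations -/
  b : Fin m → ℚ

namespace LEMM

/-- The variables of an LEMM. -/
abbrev Var (L : LEMM) : Type := LEMMVar L.n₁ L.n₂ L.m

/-- A real vector is feasible if it solves all min, max and affine equations. -/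
def Feasible (L : LEMM) (x : L.Var → ℝ) : Prop :=
  (∀ i, x (.inl i) = (L.Jmin i).inf' (L.Jmin_nonempty i) x) ∧
  (∀ j, x (.inr (.inl j)) = (L.Jmax j).sup' (L.Jmax_nonempty j) x) ∧
  (∀ k, x (.inr (.inr k)) = (∑ v, (L.q k v : ℝ) * x v) + (L.b k : ℝ))

/-- The matrix obtained by replacing every min equation by `x_i = x_{s i}` and every max equation
by `x_j = x_{t j}`. -/
def choiceMatrix (L : LEMM) (s : Fin L.n₁ → L.Var) (t : Fin L.n₂ → L.Var) :
    Matrix L.Var L.Var ℝ :=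
  Matrix.of fun u v =>
    match u with
    | .inl i => if v = s i then 1 else 0
    | .inr (.inl j) => if v = t j then 1 else 0
    | .inr (.inr k) => (L.q k v : ℝ)

/-- The finite set of all matrices arising from admissible choices. -/
def choiceMatrices (L : LEMM) : Set (Matrix L.Var L.Var ℝ) :=
  {Q | ∃ s t, (∀ i, s i ∈ L.Jmin i) ∧ (∀ j, t j ∈ L.Jmax j) ∧ Q = L.choiceMatrix s t}

/-- C1: every matrix in the convex hull of the choice matrices has powers tending to `0`. -/
def Halting (L : LEMM) : Prop :=
  ∀ Q ∈ convexHull ℝ L.choiceMatrices, Tendsto (fun p : ℕ => Q ^ p) atTop (𝓝 0)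

/-- C2: non-negative coefficients. -/
def NonnegCoeff (L : LEMM) : Prop :=
  ∀ k, (∀ v, 0 ≤ L.q k v) ∧ 0 ≤ L.b k

/-- C3: the sum of every affine equation is at most `1`. -/
def SumLeOne (L : LEMM) : Prop :=
  ∀ k, (∑ v, L.q k v) + L.b k ≤ 1

/-- C4: max-only or min-only. -/
def OneType (L : LEMM) : Prop :=
  L.n₁ = 0 ∨ L.n₂ = 0

/-- Names of the four conditions. -/
inductive Condition
  | C1 | C2 | C3 | C4

/-- An LEMM satisfies a condition. -/
def Satisfies (L : LEMM) : Condition → Prop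
  | .C1 => L.Halting
  | .C2 => L.NonnegCoeff
  | .C3 => L.SumLeOne
  | .C4 => L.OneType

end LEMM

/-- An instance of the LEMM decision problem: an LEMM, an index and a threshold. -/
structure LEMMInstance where
  /-- the equations -/
  L : LEMM
  /-- the index of the queried variable -/
  i : L.Var
  /-- the threshold -/
  β : ℚ

/-- Is there a feasible `x` with `x_i < β`? -/
def LEMMInstance.Yes (I : LEMMInstance) : Prop :=
  ∃ x : I.L.Var → ℝ, I.L.Feasible x ∧ x I.i < (I.β : ℝ)

/-! ### Simple stochastic games -/

/-- The three kinds of inner vertices. -/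
inductive SSGKind
  | max | min | avg
  deriving DecidableEq

/-- A simple stochastic game: `N` inner vertices, each of kind max, min or average and each with
two outgoing edges, a 0-sink `.inr false`, a 1-sink `.inr true`, and a start vertex. -/
structure SSG where
  /-- number of inner vertices -/
  N : ℕ
  /-- kind of an inner vertex -/
  kind : Fin N → SSGKind
  /-- the two outgoing edges of an inner vertex -/
  succ : Fin N → Bool → Fin N ⊕ Bool
  /-- the start vertex -/
  start : Fin N ⊕ Bool

namespace SSG

/-- The vertices of a game. -/
abbrev Vertex (G : SSG) : Type := Fin G.N ⊕ Bool

/-- A (pure positional) strategy of the player who owns the vertices of kind `k`. -/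
abbrev Strategy (G : SSG) (k : SSGKind) : Type := {v : Fin G.N // G.kind v = k} → Bool

/-- Transition matrix of the Markov chain induced by a pair of strategies; at an average vertex
each outgoing edge is taken with probability `1/2`, and the sinks are absorbing. -/
noncomputable def transition (G : SSG) (σ : G.Strategy .max) (τ : G.Strategy .min) :
    Matrix G.Vertex G.Vertex ℝ :=
  Matrix.of fun u w =>
    match u with
    | .inl v =>
      if hmax : G.kind v = .max then
        if w = G.succ v (σ ⟨v, hmax⟩) then 1 else 0
      else if hmin : G.kind v = .min then
        if w = G.succ v (τ ⟨v, hmin⟩) then 1 else 0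
      else
        (if w = G.succ v false then 1 / 2 else 0) + (if w = G.succ v true then 1 / 2 else 0)
    | .inr s => if w = .inr s then 1 else 0

/-- The probability that the 1-sink is reached from the start vertex: the supremum over `t` of the
probability of being in the (absorbing) 1-sink after `t` steps. -/
noncomputable def reachProb (G : SSG) (σ : G.Strategy .max) (τ : G.Strategy .min) : ℝ :=
  ⨆ t : ℕ, (G.transition σ τ ^ t) G.start (.inr true)

/-- The value of the game. -/
noncomputable def value (G : SSG) : ℝ :=
  ⨆ σ : G.Strategy .max, ⨅ τ : G.Strategy .min, G.reachProb σ τ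

end SSG

/-! ### Encodings as strings over a finite alphabet

An encoder is prefix-free if its input and the rest of the string can be recovered from the
encoding followed by an arbitrary string. -/

/-- The encoder `e` is injective and its range is a prefix code. -/
def PrefixFree {α : Type} (e : α → List Γ') : Prop :=
  ∀ x y s t, e x ++ s = e y ++ t → x = y ∧ s = t

/-- Unary notation, ended by a comma. -/
def encUnary (k : ℕ) : List Γ' := List.replicate k (.bit true) ++ [.comma]

/-- Binary notation, least significant bit first, ended by a comma. -/
def encBinary (k : ℕ) : List Γ' := (encodeNat k).map .bit ++ [.comma]

/-- A rational number in lowest terms: sign bit, numerator and denominator in binary. -/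
def encRat (r : ℚ) : List Γ' :=
  .bit (decide (r.num < 0)) :: (encBinary r.num.natAbs ++ encBinary r.den)

/-- All variables in order. -/
def LEMMVar.list (n₁ n₂ m : ℕ) : List (LEMMVar n₁ n₂ m) :=
  (List.finRange n₁).map .inl ++
    ((List.finRange n₂).map (fun j => .inr (.inl j)) ++
      (List.finRange m).map (fun k => .inr (.inr k)))

/-- The position of a variable in the list of all variables, counted from `0`. -/
def LEMMVar.pos {n₁ n₂ m : ℕ} : LEMMVar n₁ n₂ m → ℕ
  | .inl i => i
  | .inr (.inl j) => n₁ + j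
  | .inr (.inr k) => n₁ + (n₂ + k)

/-- A set of variables as its characteristic bit vector. -/
def encMask {n₁ n₂ m : ℕ} (J : Finset (LEMMVar n₁ n₂ m)) : List Γ' :=
  (LEMMVar.list n₁ n₂ m).flatMap fun v => [.bit (decide (v ∈ J))]

/-- The three numbers of variables in unary, the index sets as bit vectors, the affine equations
row by row, the index in unary, the threshold. -/
def LEMMInstance.encode (I : LEMMInstance) : List Γ' :=
  encUnary I.L.n₁ ++ (encUnary I.L.n₂ ++ (encUnary I.L.m ++
    ((List.finRange I.L.n₁).flatMap (fun i => encMask (I.L.Jmin i)) ++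
      ((List.finRange I.L.n₂).flatMap (fun j => encMask (I.L.Jmax j)) ++
        ((List.finRange I.L.m).flatMap (fun k =>
            (LEMMVar.list I.L.n₁ I.L.n₂ I.L.m).flatMap (fun v => encRat (I.L.q k v)) ++
              encRat (I.L.b k)) ++
          (encUnary I.i.pos ++ encRat I.β))))))

/-- Two bits for the kind of a vertex. -/
def encKind : SSGKind → List Γ'
  | .max => [.bit true, .bit true]
  | .min => [.bit true, .bit false]
  | .avg => [.bit false, .bit false]

/-- A vertex in unary, where the 0-sink is `0`, the 1-sink is `1`, and inner vertex `v` is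
`v + 2`. -/
def encVertex {N : ℕ} : Fin N ⊕ Bool → List Γ'
  | .inr false => encUnary 0
  | .inr true => encUnary 1
  | .inl v => encUnary (v + 2)

/-- The number of inner vertices in unary, then the kind and the two successors of every inner
vertex, then the start vertex. -/
def SSG.encode (G : SSG) : List Γ' :=
  encUnary G.N ++
    ((List.finRange G.N).flatMap (fun v =>
        encKind (G.kind v) ++ (encVertex (G.succ v false) ++ encVertex (G.succ v true))) ++
      encVertex G.start)

theorem prefixFree_encUnary : PrefixFree encUnary := by
  intro x
  induction x with
  | zero =>
    intro y s t h
    cases y with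
    | zero => simpa [encUnary] using h
    | succ y => simp [encUnary, List.replicate_succ] at h
  | succ x ih =>
    intro y s t h
    cases y with
    | zero => simp [encUnary, List.replicate_succ] at h
    | succ y =>
      have := ih y s t (by simpa [encUnary, List.replicate_succ] using h)
      exact ⟨by rw [this.1], this.2⟩

theorem prefixFree_map_bit :
    PrefixFree (fun l : List Bool => l.map Γ'.bit ++ [Γ'.comma]) := by
  intro x
  induction x with
  | nil =>
    intro y s t h
    cases y with
    | nil => simpa using h
    | cons b y => simp at h
  | cons a x ih =>
    intro y s t h
    cases y with
    | nil => simp at h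
    | cons b y =>
      simp only [List.map_cons, List.cons_append, List.cons.injEq, Γ'.bit.injEq] at h
      have := ih y s t h.2
      exact ⟨by rw [h.1, this.1], this.2⟩

theorem prefixFree_encBinary : PrefixFree encBinary := by
  intro x y s t h
  have := prefixFree_map_bit _ _ s t h
  exact ⟨encodingNatBool.encode_injective this.1, this.2⟩

theorem prefixFree_encRat : PrefixFree encRat := by
  intro x y s t h
  simp only [encRat, List.cons_append, List.append_assoc, List.cons.injEq, Γ'.bit.injEq,
    decide_eq_decide] at h
  obtain ⟨h1, h2⟩ := h
  obtain ⟨h3, h4⟩ := prefixFree_encBinary _ _ _ _ h2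
  obtain ⟨h5, h6⟩ := prefixFree_encBinary _ _ _ _ h4
  exact ⟨Rat.ext (by omega) h5, h6⟩

theorem flatMap_prefix {α : Type} (f g : α → List Γ') (l : List α)
    (hfg : ∀ a ∈ l, ∀ s t, f a ++ s = g a ++ t → f a = g a ∧ s = t) (s t : List Γ')
    (h : l.flatMap f ++ s = l.flatMap g ++ t) : (∀ a ∈ l, f a = g a) ∧ s = t := by
  induction l with
  | nil => simpa using h
  | cons a l ih =>
    simp only [List.flatMap_cons, List.append_assoc] at h
    obtain ⟨h1, h2⟩ := hfg a (by simp) _ _ h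
    obtain ⟨h3, h4⟩ := ih (fun b hb => hfg b (by simp [hb])) h2
    exact ⟨by simpa [h1] using h3, h4⟩

theorem PrefixFree.flatMap {α β : Type} {e : α → List Γ'} (he : PrefixFree e) (l : List β)
    (f g : β → α) (s t : List Γ')
    (h : l.flatMap (fun b => e (f b)) ++ s = l.flatMap (fun b => e (g b)) ++ t) :
    (∀ b ∈ l, f b = g b) ∧ s = t := by
  obtain ⟨h1, h2⟩ := flatMap_prefix _ _ l
    (fun b _ s t h => ⟨by rw [(he _ _ _ _ h).1], (he _ _ _ _ h).2⟩) s t h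
  exact ⟨fun b hb => (he _ _ [] [] (by rw [h1 b hb])).1, h2⟩

theorem LEMMVar.mem_list {n₁ n₂ m : ℕ} (v : LEMMVar n₁ n₂ m) : v ∈ LEMMVar.list n₁ n₂ m := by
  rcases v with i | j | k <;> simp [LEMMVar.list]

theorem LEMMVar.pos_injective {n₁ n₂ m : ℕ} :
    Function.Injective (LEMMVar.pos (n₁ := n₁) (n₂ := n₂) (m := m)) := by
  rintro (i | j | k) (i' | j' | k') h <;> simp only [LEMMVar.pos] at h
  · rw [Fin.ext h]
  · omega
  · omega
  · omega
  · rw [Fin.ext (by omega : (j : ℕ) = j')]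
  · omega
  · omega
  · omega
  · rw [Fin.ext (by omega : (k : ℕ) = k')]

theorem prefixFree_encMask {n₁ n₂ m : ℕ} :
    PrefixFree (encMask (n₁ := n₁) (n₂ := n₂) (m := m)) := by
  intro x y s t h
  have hb : PrefixFree (fun b : Bool => [Γ'.bit b]) := by
    intro a b s t h
    simpa using h
  obtain ⟨h1, h2⟩ := hb.flatMap _ (fun v => decide (v ∈ x)) (fun v => decide (v ∈ y)) s t h
  refine ⟨?_, h2⟩
  ext v
  simpa using h1 v (LEMMVar.mem_list v)

theorem LEMMInstance.encode_injective : Function.Injective LEMMInstance.encode := by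
  rintro ⟨⟨n₁, n₂, m, Jm, JM, h₁, h₂, q, b⟩, i, β⟩
    ⟨⟨n₁', n₂', m', Jm', JM', h₁', h₂', q', b'⟩, i', β'⟩ h
  simp only [LEMMInstance.encode] at h
  obtain ⟨rfl, h⟩ := prefixFree_encUnary _ _ _ _ h
  obtain ⟨rfl, h⟩ := prefixFree_encUnary _ _ _ _ h
  obtain ⟨rfl, h⟩ := prefixFree_encUnary _ _ _ _ h
  obtain ⟨e1, h⟩ := prefixFree_encMask.flatMap _ Jm Jm' _ _ h
  obtain ⟨e2, h⟩ := prefixFree_encMask.flatMap _ JM JM' _ _ h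
  have hrow : PrefixFree (fun r : (LEMMVar n₁ n₂ m → ℚ) × ℚ =>
      (LEMMVar.list n₁ n₂ m).flatMap (fun v => encRat (r.1 v)) ++ encRat r.2) := by
    intro x y s t h
    simp only [List.append_assoc] at h
    obtain ⟨g1, h⟩ := prefixFree_encRat.flatMap _ x.1 y.1 _ _ h
    obtain ⟨g2, h⟩ := prefixFree_encRat _ _ _ _ h
    exact ⟨Prod.ext (funext fun v => g1 v (LEMMVar.mem_list v)) g2, h⟩
  obtain ⟨e3, h⟩ := hrow.flatMap _ (fun k => (q k, b k)) (fun k => (q' k, b' k)) _ _ h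
  obtain ⟨e4, h⟩ := prefixFree_encUnary _ _ _ _ h
  obtain ⟨rfl, -⟩ := prefixFree_encRat β β' [] [] (by rw [h])
  obtain rfl := LEMMVar.pos_injective e4
  obtain rfl : Jm = Jm' := funext fun k => e1 k (List.mem_finRange k)
  obtain rfl : JM = JM' := funext fun k => e2 k (List.mem_finRange k)
  obtain rfl : q = q' := funext fun k => congrArg Prod.fst (e3 k (List.mem_finRange k))
  obtain rfl : b = b' := funext fun k => congrArg Prod.snd (e3 k (List.mem_finRange k))
  rfl

theorem prefixFree_encKind : PrefixFree encKind := by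
  intro x y s t h
  cases x <;> cases y <;> simp_all [encKind]

theorem prefixFree_encVertex {N : ℕ} : PrefixFree (encVertex (N := N)) := by
  intro x y s t h
  rcases x with v | (_ | _) <;> rcases y with w | (_ | _) <;>
    obtain ⟨h1, h2⟩ := prefixFree_encUnary _ _ _ _ h <;> refine ⟨?_, h2⟩ <;> first
      | rfl
      | (exfalso; omega)
      | rw [Fin.ext (by omega : (v : ℕ) = w)]

theorem SSG.encode_injective : Function.Injective SSG.encode := by
  rintro ⟨N, kind, succ, start⟩ ⟨N', kind', succ', start'⟩ h
  simp only [SSG.encode] at h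
  obtain ⟨rfl, h⟩ := prefixFree_encUnary _ _ _ _ h
  have hrow : PrefixFree (fun r : SSGKind × (Fin N ⊕ Bool) × (Fin N ⊕ Bool) =>
      encKind r.1 ++ (encVertex r.2.1 ++ encVertex r.2.2)) := by
    intro x y s t h
    simp only [List.append_assoc] at h
    obtain ⟨g1, h⟩ := prefixFree_encKind _ _ _ _ h
    obtain ⟨g2, h⟩ := prefixFree_encVertex _ _ _ _ h
    obtain ⟨g3, h⟩ := prefixFree_encVertex _ _ _ _ h
    exact ⟨Prod.ext g1 (Prod.ext g2 g3), h⟩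
  obtain ⟨e, h⟩ := hrow.flatMap _ (fun v => (kind v, succ v false, succ v true))
    (fun v => (kind' v, succ' v false, succ' v true)) _ _ h
  obtain ⟨rfl, -⟩ := prefixFree_encVertex start start' [] [] (by rw [h])
  have e' := fun v => e v (List.mem_finRange v)
  simp only [Prod.mk.injEq] at e'
  obtain rfl : kind = kind' := funext fun v => (e' v).1
  obtain rfl : succ = succ' := by
    funext v c
    cases c
    · exact (e' v).2.1
    · exact (e' v).2.2
  rfl

/-! ### Promise problems and polynomial-time many-one reductions -/

/-- A decision problem restricted to the instances that satisfy a promise. -/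
structure PromiseProblem where
  /-- the instances -/
  Inst : Type
  /-- the encoding of instances as strings -/
  encode : Inst → List Γ'
  encode_injective : Function.Injective encode
  /-- the instances under consideration -/
  Promise : Inst → Prop
  /-- the instances with answer Yes -/
  Yes : Inst → Prop

/-- Polynomial-time many-one reducibility: a map computed by a Turing machine in polynomial time
that sends every promised instance to a promised instance with the same answer. -/
def PolyTimeReducible (P Q : PromiseProblem) : Prop :=
  ∃ f : P.Inst → Q.Inst,
    Nonempty (Turing.TM2ComputableInPolyTime P.encode Q.encode f) ∧
    ∀ x, P.Promise x → Q.Promise (f x) ∧ (P.Yes x ↔ Q.Yes (f x))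

/-- The LEMM decision problem restricted to a class of LEMMs. -/
def lemmProblemOn (C : LEMM → Prop) : PromiseProblem where
  Inst := LEMMInstance
  encode := LEMMInstance.encode
  encode_injective := LEMMInstance.encode_injective
  Promise I := C I.L
  Yes := LEMMInstance.Yes

/-- The LEMM decision problem under a set of conditions. -/
def lemmProblem (X : Set LEMM.Condition) : PromiseProblem :=
  lemmProblemOn fun L => ∀ c ∈ X, L.Satisfies c

/-- The SSG value problem: is the value of the game greater than `1/2`? -/
def ssgProblem : PromiseProblem where
  Inst := SSG
  encode := SSG.encode
  encode_injective := SSG.encode_injective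
  Promise _ := True
  Yes G := 1 / 2 < G.value

/-- A problem is SSG-hard if the SSG value problem reduces to it. -/
def SSGHard (P : PromiseProblem) : Prop := PolyTimeReducible ssgProblem P

/-- The condition sets {C1,C3,C4}, {C1,C3}, {C1,C4} and {C1}. -/
def haltingFamilies : Set (Set LEMM.Condition) :=
  {{.C1, .C3, .C4}, {.C1, .C3}, {.C1, .C4}, {.C1}}

/-! Everything rests on two explicit constructions of halting min-only systems whose affine rows
have sum at most 1. Such a system satisfies C1, C3 and C4 at once. Hence a single reduction out of
C1 gives all the equivalences and the min-only statement, and a single reduction from games gives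
hardness under all four condition sets.

From a halting LEMM (`LEMM.signed`): as max x = -min(-x), a max variable is stored with the opposite
sign. Every variable v gets two copies, with values x_v and -x_v. A term r x_v is written as
min(r,0) x_v + min(-r,0) (-x_v), and a constant is treated in the same way as the coefficient of a
new variable with value 1. The translated affine rows then have only non-positive coefficients and
no constant, which gives C3. Solutions correspond in both directions (`LEMM.signed_sol_of_feasible`,
`LEMM.feasible_of_signed_sol`). For halting (`LEMM.signed_halting`), two steps of the new system,
conjugated by the signs, act like a matrix from the convex hull of the old choice matrices, extended
by a zero row and a column of constants.

From a game (`SSG.minInstance`): with the discount factor γ = 1 - 2^(-5(N+2)) the optimality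
equations are a contraction and have a solution w. The discounted value never exceeds the value
(`SSG.le_value`). Conversely, reachability probabilities under fixed positional strategies are
rationals with denominator at most 4^(N+2) (`SSG.exists_int_reach`), so one that exceeds 1/2 does so
by a definite gap. By a maximum principle (`SSG.le_of_le_next`), discounting costs less than this
gap (`SSG.half_lt_of_half_lt_value`). The equations are written for -w, so that w > 1/2 becomes x <
-1/2; copies with suitable factors express max, min and average vertices through min alone.

Both maps write strings made of regular rows, so finitely many counters suffice to compute them.
They are programs of a small loop language that compiles to multi-stack Turing machines
(`Transducer.Exec.reach`); a polynomial bound on the iterations of each loop gives polynomial time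
(`Transducer.Cmd.computable`). -/

/-! ### A small imperative language for transducers with counters

A program reads a string from left to right, writes a string from left to right, and uses finitely
many counters. Programs compile to Turing machines with one stack for the input, one for the
(reversed) output, and one per counter. -/

namespace Transducer

/-- Tests: on the next input symbol, or on a counter being positive. -/
inductive Test (K : Type)
  | top (p : Γ' → Bool)
  | pos (k : K)

/-- Programs. -/
inductive Cmd (K : Type)
  | skip
  | emit (c : Γ')
  | read
  | inc (k : K)
  | dec (k : K)
  | seq (p q : Cmd K)
  | ite (t : Test K) (p q : Cmd K)
  | loop (t : Test K) (p : Cmd K)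

/-- A state of a computation: the remaining input, the counters, and the reversed output. -/
structure Conf (K : Type) where
  /-- remaining input -/
  inp : List Γ'
  /-- counters -/
  reg : K → ℕ
  /-- output written so far, last symbol first -/
  out : List Γ'

variable {K : Type}

/-- Truth value of a test. -/
def Test.holds : Test K → Conf K → Bool
  | .top p, s => s.inp.head?.elim false p
  | .pos k, s => decide (s.reg k ≠ 0)

/-- `n`-fold composition of a relation. -/
def IterRel {α : Type} (R : α → α → Prop) : ℕ → α → α → Prop
  | 0, s, t => s = t
  | n + 1, s, t => ∃ u, R s u ∧ IterRel R n u t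

variable [DecidableEq K]

/-- `Exec B p s t`: the program `p` leads from `s` to `t`, and no loop is iterated more than `B`
times. -/
def Exec (B : ℕ) : Cmd K → Conf K → Conf K → Prop
  | .skip, s, t => t = s
  | .emit c, s, t => t = { s with out := c :: s.out }
  | .read, s, t => t = { s with inp := s.inp.tail }
  | .inc k, s, t => t = { s with reg := Function.update s.reg k (s.reg k + 1) }
  | .dec k, s, t => t = { s with reg := Function.update s.reg k (s.reg k - 1) }
  | .seq p q, s, t => ∃ u, Exec B p s u ∧ Exec B q u t
  | .ite c p q, s, t => (c.holds s = true ∧ Exec B p s t) ∨ (c.holds s = false ∧ Exec B q s t)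
  | .loop c p, s, t =>
    ∃ n ≤ B, IterRel (fun u v => c.holds u = true ∧ Exec B p u v) n s t ∧ c.holds t = false

/-- A bound on the running time in terms of the number of iterations of the loops. -/
noncomputable def Cmd.time : Cmd K → Polynomial ℕ
  | .seq p q => p.time + q.time
  | .ite _ p q => 1 + p.time + q.time
  | .loop _ p => 1 + Polynomial.X * (1 + p.time)
  | _ => 1

/-! #### Compilation -/

/-- Labels of the compiled program. -/
def Cmd.Lab : Cmd K → Type
  | .seq p q => p.Lab ⊕ q.Lab
  | .ite _ p q => Option (p.Lab ⊕ q.Lab)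
  | .loop _ p => Option p.Lab
  | _ => Unit

noncomputable instance Cmd.fintypeLab : (p : Cmd K) → Fintype p.Lab
  | .seq p q => by
    have := fintypeLab p; have := fintypeLab q
    exact inferInstanceAs (Fintype (p.Lab ⊕ q.Lab))
  | .ite _ p q => by
    have := fintypeLab p; have := fintypeLab q
    exact inferInstanceAs (Fintype (Option (p.Lab ⊕ q.Lab)))
  | .loop _ p => by
    have := fintypeLab p
    exact inferInstanceAs (Fintype (Option p.Lab))
  | .skip => inferInstanceAs (Fintype Unit)
  | .emit _ => inferInstanceAs (Fintype Unit)
  | .read => inferInstanceAs (Fintype Unit)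
  | .inc _ => inferInstanceAs (Fintype Unit)
  | .dec _ => inferInstanceAs (Fintype Unit)

/-- The label at which a program starts. -/
def Cmd.entry : (p : Cmd K) → p.Lab
  | .seq p _ => Sum.inl p.entry
  | .ite _ _ _ => none
  | .loop _ _ => none
  | .skip => ()
  | .emit _ => ()
  | .read => ()
  | .inc _ => ()
  | .dec _ => ()

/-- The stacks of the compiled machine. -/
inductive Stack (K : Type)
  | inp
  | out
  | reg (k : K)
  deriving DecidableEq, Fintype

/-- The stack inspected by a test. -/
def Test.stack : Test K → Stack K
  | .top _ => .inp
  | .pos k => .reg k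

/-- The outcome of a test in terms of the top symbol of the inspected stack. -/
def Test.eval : Test K → Option Γ' → Bool
  | .top p, o => o.elim false p
  | .pos _, o => o.isSome

/-- Statements of the compiled machines; the internal state is the last inspected symbol. -/
abbrev MStmt (K Λ : Type) : Type := Turing.TM2.Stmt (fun _ : Stack K => Γ') Λ (Option Γ')

/-- Configurations of the compiled machines. -/
abbrev MCfg (K Λ : Type) : Type := Turing.TM2.Cfg (fun _ : Stack K => Γ') Λ (Option Γ')

open Turing.TM2.Stmt in
/-- Jump according to a test. -/
def Test.code {Λ : Type} (t : Test K) (a b : Λ) : MStmt K Λ :=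
  peek t.stack (fun _ o => o) (goto fun o => if t.eval o then a else b)

open Turing.TM2.Stmt in
/-- The compiled program, with its labels embedded by `ι`, that jumps to `e` at the end. -/
def Cmd.code {Λ : Type} : (p : Cmd K) → (p.Lab → Λ) → Λ → p.Lab → MStmt K Λ
  | .skip, _, e, _ => goto fun _ => e
  | .emit c, _, e, _ => push .out (fun _ => c) (goto fun _ => e)
  | .read, _, e, _ => pop .inp (fun s _ => s) (goto fun _ => e)
  | .inc k, _, e, _ => push (.reg k) (fun _ => .blank) (goto fun _ => e)
  | .dec k, _, e, _ => pop (.reg k) (fun s _ => s) (goto fun _ => e)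
  | .seq p q, ι, e, l =>
    match l with
    | Sum.inl l => p.code (fun x => ι (Sum.inl x)) (ι (Sum.inr q.entry)) l
    | Sum.inr l => q.code (fun x => ι (Sum.inr x)) e l
  | .ite t p q, ι, e, l =>
    match l with
    | none => t.code (ι (some (Sum.inl p.entry))) (ι (some (Sum.inr q.entry)))
    | some (Sum.inl l) => p.code (fun x => ι (some (Sum.inl x))) e l
    | some (Sum.inr l) => q.code (fun x => ι (some (Sum.inr x))) e l
  | .loop t p, ι, e, l =>
    match l with
    | none => t.code (ι (some p.entry)) e
    | some l => p.code (fun x => ι (some x)) (ι none) l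

/-- The contents of the stacks of the compiled machine. -/
def Conf.stk (s : Conf K) : Stack K → List Γ'
  | .inp => s.inp
  | .out => s.out
  | .reg k => List.replicate (s.reg k) .blank

/-- Reachability within a number of steps. -/
def Reach {Λ : Type} (M : Λ → MStmt K Λ) (n : ℕ) (a b : MCfg K Λ) : Prop :=
  ∃ k ≤ n, (flip Bind.bind (Turing.TM2.step M))^[k] (some a) = some b

theorem Reach.mono {Λ : Type} {M : Λ → MStmt K Λ} {m n : ℕ} {a b : MCfg K Λ} (h : Reach M m a b)
    (hmn : m ≤ n) : Reach M n a b :=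
  ⟨h.choose, h.choose_spec.1.trans hmn, h.choose_spec.2⟩

theorem Reach.trans {Λ : Type} {M : Λ → MStmt K Λ} {m n : ℕ} {a b c : MCfg K Λ}
    (h : Reach M m a b) (h' : Reach M n b c) : Reach M (m + n) a c := by
  obtain ⟨k, hk, h⟩ := h
  obtain ⟨l, hl, h'⟩ := h'
  exact ⟨l + k, by omega, by rw [Function.iterate_add_apply, h, h']⟩

theorem Reach.step {Λ : Type} {M : Λ → MStmt K Λ} {l : Λ} {v : Option Γ'}
    {S : Stack K → List Γ'} {b : MCfg K Λ} (h : Turing.TM2.stepAux (M l) v S = b) :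
    Reach M 1 ⟨some l, v, S⟩ b :=
  ⟨1, le_rfl, by simp [flip, h]⟩

theorem Conf.stk_emit (s : Conf K) (c : Γ') :
    Function.update s.stk .out (c :: s.stk .out) = { s with out := c :: s.out }.stk := by
  funext k; cases k <;> simp [Conf.stk]

theorem Conf.stk_read (s : Conf K) :
    Function.update s.stk .inp (s.stk .inp).tail = { s with inp := s.inp.tail }.stk := by
  funext k; cases k <;> simp [Conf.stk]

theorem Conf.stk_inc (s : Conf K) (k : K) :
    Function.update s.stk (.reg k) (.blank :: s.stk (.reg k)) =
      { s with reg := Function.update s.reg k (s.reg k + 1) }.stk := by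
  funext j
  rcases j with _ | _ | j <;> simp [Conf.stk, Function.update_apply]
  by_cases h : j = k <;> simp [h, List.replicate_succ]

theorem Conf.stk_dec (s : Conf K) (k : K) :
    Function.update s.stk (.reg k) (s.stk (.reg k)).tail =
      { s with reg := Function.update s.reg k (s.reg k - 1) }.stk := by
  funext j
  rcases j with _ | _ | j <;> simp [Conf.stk, Function.update_apply]
  by_cases h : j = k <;> simp [h]

/-- A counter is a stack of blanks of the same height, so it is positive exactly if the stack has a
top symbol. Peeking overwrites the internal state only, which is why the final state is existential.
-/
theorem Test.reach_code {Λ : Type} {M : Λ → MStmt K Λ} (t : Test K) {l a b : Λ}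
    (h : M l = t.code a b) (s : Conf K) (v : Option Γ') :
    ∃ v', Reach M 1 ⟨some l, v, s.stk⟩ ⟨some (if t.holds s then a else b), v', s.stk⟩ := by
  refine ⟨(s.stk t.stack).head?, Reach.step ?_⟩
  have : t.eval (s.stk t.stack).head? = t.holds s := by
    rcases t with p | k
    · rfl
    · simp only [Test.eval, Test.stack, Conf.stk, Test.holds]
      cases s.reg k <;> simp [List.replicate_succ]
  simp [h, Test.code, this]

/-- The compiled program simulates the execution of the program. -/
theorem Exec.reach {B : ℕ} {Λ : Type} {M : Λ → MStmt K Λ} (p : Cmd K) :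
    ∀ (ι : p.Lab → Λ) (e : Λ), (∀ l, M (ι l) = p.code ι e l) → ∀ (s t : Conf K), Exec B p s t →
      ∀ v, ∃ v', Reach M (p.time.eval B) ⟨some (ι p.entry), v, s.stk⟩ ⟨some e, v', t.stk⟩ := by
  induction p with
  | skip =>
    rintro ι e hM s t rfl v
    refine ⟨v, (Reach.step ?_).mono (by simp [Cmd.time])⟩
    rw [hM]; rfl
  | emit c =>
    rintro ι e hM s t rfl v
    refine ⟨v, (Reach.step ?_).mono (by simp [Cmd.time])⟩
    rw [hM, ← Conf.stk_emit]; rfl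
  | read =>
    rintro ι e hM s t rfl v
    refine ⟨v, (Reach.step ?_).mono (by simp [Cmd.time])⟩
    rw [hM, ← Conf.stk_read]; rfl
  | inc k =>
    rintro ι e hM s t rfl v
    refine ⟨v, (Reach.step ?_).mono (by simp [Cmd.time])⟩
    rw [hM, ← Conf.stk_inc]; rfl
  | dec k =>
    rintro ι e hM s t rfl v
    refine ⟨v, (Reach.step ?_).mono (by simp [Cmd.time])⟩
    rw [hM, ← Conf.stk_dec]; rfl
  | seq p q ihp ihq =>
    rintro ι e hM s t ⟨u, h1, h2⟩ v
    obtain ⟨v', r1⟩ := ihp (fun x => ι (Sum.inl x)) _ (fun l => hM (Sum.inl l)) s u h1 v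
    obtain ⟨v'', r2⟩ := ihq (fun x => ι (Sum.inr x)) e (fun l => hM (Sum.inr l)) u t h2 v'
    exact ⟨v'', (r1.trans r2).mono (by simp [Cmd.time])⟩
  | ite c p q ihp ihq =>
    intro ι e hM s t h v
    obtain ⟨v', r1⟩ := c.reach_code (hM none) s v
    rcases h with ⟨hc, h⟩ | ⟨hc, h⟩
    · obtain ⟨v'', r2⟩ := ihp (fun x => ι (some (Sum.inl x))) e
        (fun l => hM (some (Sum.inl l))) s t h v'
      simp only [hc, if_true] at r1
      exact ⟨v'', (r1.trans r2).mono (by simp [Cmd.time])⟩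
    · obtain ⟨v'', r2⟩ := ihq (fun x => ι (some (Sum.inr x))) e
        (fun l => hM (some (Sum.inr l))) s t h v'
      simp only [hc] at r1
      exact ⟨v'', (r1.trans r2).mono (by simp [Cmd.time])⟩
  | loop c p ihp =>
    rintro ι e hM s t ⟨n, hn, hit, hc⟩ v
    -- Each iteration costs one successful test and the body; the leading 1 pays for the test that
    -- fails.
    have key : ∀ n (s : Conf K) v,
        IterRel (fun u v => c.holds u = true ∧ Exec B p u v) n s t → ∃ v',
          Reach M (1 + n * (1 + p.time.eval B)) ⟨some (ι none), v, s.stk⟩ ⟨some e, v', t.stk⟩ := by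
      intro n
      induction n with
      | zero =>
        rintro s v rfl
        obtain ⟨v', r⟩ := c.reach_code (hM none) s v
        simp only [hc] at r
        exact ⟨v', by simpa using r⟩
      | succ n ih =>
        rintro s v ⟨u, ⟨h1, h2⟩, h3⟩
        obtain ⟨v', r1⟩ := c.reach_code (hM none) s v
        simp only [h1, if_true] at r1
        obtain ⟨v'', r2⟩ := ihp (fun x => ι (some x)) _ (fun l => hM (some l)) s u h2 v'
        obtain ⟨v''', r3⟩ := ih u v'' h3
        exact ⟨v''', ((r1.trans r2).trans r3).mono (by ring_nf; omega)⟩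
    obtain ⟨v', r⟩ := key n s v hit
    refine ⟨v', r.mono ?_⟩
    simp only [Cmd.time, Polynomial.eval_add, Polynomial.eval_mul, Polynomial.eval_X,
      Polynomial.eval_one]
    gcongr

/-- The length of the output is bounded by the running time. -/
theorem Exec.length_out {B : ℕ} (p : Cmd K) :
    ∀ s t : Conf K, Exec B p s t → t.out.length ≤ s.out.length + p.time.eval B := by
  induction p with
  | skip => rintro s t rfl; simp
  | emit c => rintro s t rfl; simp [Cmd.time]
  | read => rintro s t rfl; simp
  | inc k => rintro s t rfl; simp
  | dec k => rintro s t rfl; simp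
  | seq p q ihp ihq =>
    rintro s t ⟨u, h1, h2⟩
    have := ihp _ _ h1
    have := ihq _ _ h2
    simp only [Cmd.time, Polynomial.eval_add]
    omega
  | ite c p q ihp ihq =>
    rintro s t (⟨_, h⟩ | ⟨_, h⟩)
    · have := ihp _ _ h
      simp only [Cmd.time, Polynomial.eval_add]
      omega
    · have := ihq _ _ h
      simp only [Cmd.time, Polynomial.eval_add]
      omega
  | loop c p ihp =>
    rintro s t ⟨n, hn, hit, -⟩
    have key : ∀ n (s : Conf K), IterRel (fun u v => c.holds u = true ∧ Exec B p u v) n s t →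
        t.out.length ≤ s.out.length + n * p.time.eval B := by
      intro n
      induction n with
      | zero => rintro s rfl; simp
      | succ n ih =>
        rintro s ⟨u, ⟨_, h2⟩, h3⟩
        have h4 := ihp _ _ h2
        have h5 := ih _ h3
        rw [add_mul]
        omega
    refine (key n s hit).trans ?_
    simp only [Cmd.time, Polynomial.eval_add, Polynomial.eval_mul, Polynomial.eval_X,
      Polynomial.eval_one]
    have : n * p.time.eval B ≤ B * (1 + p.time.eval B) := by
      refine Nat.mul_le_mul hn (by omega)
    omega

/-! #### The machine of a program -/

open Turing.TM2.Stmt in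
/-- The statements of the machine of a program; the label `none` is for the final phase that moves
the output to the input stack. -/
def Cmd.stmts (p : Cmd K) : Option p.Lab → MStmt K (Option p.Lab)
  | none => pop .out (fun _ o => o) (branch Option.isSome
      (push .inp (fun o => o.getD .blank) (goto fun _ => none)) halt)
  | some l => p.code some none l

/-- The Turing machine of a program. -/
noncomputable def Cmd.machine [Fintype K] (p : Cmd K) : Turing.FinTM2 where
  K := Stack K
  k₀ := .inp
  k₁ := .inp
  Γ _ := Γ'
  Λ := Option p.Lab
  main := some p.entry
  σ := Option Γ'
  initialState := none
  m := p.stmts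

/-- In the halting configuration of a `FinTM2` all stacks but the output one are empty, so the
counters have to be zero and the output stack is emptied onto the input stack. This also undoes the
reversal. The part `x` that is already moved is arbitrary for the sake of the induction. -/
theorem Cmd.reach_reverse (p : Cmd K) (o x : List Γ') (v : Option Γ') :
    Reach p.stmts (o.length + 1) ⟨some none, v, (⟨x, fun _ => 0, o⟩ : Conf K).stk⟩
      ⟨none, none, (⟨o.reverse ++ x, fun _ => 0, []⟩ : Conf K).stk⟩ := by
  induction o generalizing x v with
  | nil =>
    refine (Reach.step ?_).mono (by simp)
    simp only [Cmd.stmts, Turing.TM2.stepAux, Conf.stk, List.head?_nil, Option.isSome_none,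
      cond_false, List.tail_nil, List.reverse_nil, List.nil_append]
    congr 1
    funext k; cases k <;> simp [Conf.stk]
  | cons c o ih =>
    have r := ih (c :: x) (some c)
    rw [List.reverse_cons, List.append_assoc, List.singleton_append]
    refine (Reach.trans (m := 1) (Reach.step ?_) r).mono (by simp; omega)
    simp only [Cmd.stmts, Turing.TM2.stepAux, Conf.stk, List.head?_cons, Option.isSome_some,
      cond_true, List.tail_cons, Option.getD_some]
    congr 1
    funext k; cases k <;> simp [Conf.stk]

/-- A function computed by a program whose loops are iterated at most polynomially often is
computable in polynomial time. -/
theorem Cmd.computable [Fintype K] {α β : Type} {ea : α → List Γ'} {eb : β → List Γ'} {f : α → β}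
    (p : Cmd K) (P : Polynomial ℕ)
    (h : ∀ a, Exec (P.eval (ea a).length) p ⟨ea a, fun _ => 0, []⟩
      ⟨[], fun _ => 0, (eb (f a)).reverse⟩) :
    Nonempty (Turing.TM2ComputableInPolyTime ea eb f) := by
  -- The output is not longer than the running time of the program, so moving it at most doubles the
  -- time; the last step is the halt.
  have main : ∀ a, Reach p.stmts ((2 * p.time.comp P + 1).eval (ea a).length)
      ⟨some (some p.entry), none, (⟨ea a, fun _ => 0, []⟩ : Conf K).stk⟩
      ⟨none, none, (⟨eb (f a), fun _ => 0, []⟩ : Conf K).stk⟩ := by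
    intro a
    obtain ⟨v, r⟩ := Exec.reach (M := p.stmts) p some none (fun l => rfl) _ _ (h a) none
    have r' := p.reach_reverse (eb (f a)).reverse [] v
    have hl := Exec.length_out p _ _ (h a)
    simp only [List.length_nil, zero_add] at hl
    rw [List.reverse_reverse, List.append_nil] at r'
    refine (r.trans r').mono ?_
    simp only [Polynomial.eval_add, Polynomial.eval_mul, Polynomial.eval_comp, Polynomial.eval_one,
      Polynomial.eval_ofNat]
    omega
  have hinit : ∀ x : List Γ', Turing.initList p.machine x =
      ⟨some (some p.entry), none, (⟨x, fun _ => 0, []⟩ : Conf K).stk⟩ := by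
    intro x
    refine congrArg (Turing.TM2.Cfg.mk _ _) ?_
    funext k; cases k <;> rfl
  have hhalt : ∀ x : List Γ', Turing.haltList p.machine x =
      ⟨none, none, (⟨x, fun _ => 0, []⟩ : Conf K).stk⟩ := by
    intro x
    refine congrArg (Turing.TM2.Cfg.mk _ _) ?_
    funext k; cases k <;> rfl
  have e : ∀ l : List Γ', List.map (Equiv.refl Γ').invFun l = l := fun l => List.map_id l
  refine ⟨⟨⟨p.machine, Equiv.refl _, Equiv.refl _⟩, 2 * p.time.comp P + 1, fun a => ?_⟩⟩
  refine ⟨⟨(main a).choose, ?_⟩, (main a).choose_spec.1⟩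
  refine Eq.trans ?_ ((main a).choose_spec.2.trans ?_)
  · exact congrArg (fun c => (flip Bind.bind (Turing.TM2.step p.stmts))^[_] (some c))
      ((congrArg (Turing.initList p.machine) (e _)).trans (hinit _))
  · exact congrArg some ((congrArg (Turing.haltList p.machine) (e _)).trans (hhalt _)).symm

end Transducer

/-! #### Specifications of programs -/

namespace Transducer

variable {K : Type} [DecidableEq K]

/-- `Trans B p ρ ρ' x y`: the program `p` consumes the string `x`, writes the string `y` and changes
the counters from `ρ` to `ρ'`. -/
def Trans (B : ℕ) (p : Cmd K) (ρ ρ' : K → ℕ) (x y : List Γ') : Prop :=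
  ∀ r o, Exec B p ⟨x ++ r, ρ, o⟩ ⟨r, ρ', y.reverse ++ o⟩

variable {B : ℕ} {p q : Cmd K} {ρ ρ' ρ'' : K → ℕ} {x x' y y' : List Γ'}

theorem Trans.skip : Trans B .skip ρ ρ [] [] := fun _ _ => rfl

theorem Trans.emit (c : Γ') : Trans B (.emit c) ρ ρ [] [c] := fun _ _ => rfl

theorem Trans.read (c : Γ') : Trans B .read ρ ρ [c] [] := fun _ _ => rfl

theorem Trans.inc (k : K) : Trans B (.inc k) ρ (Function.update ρ k (ρ k + 1)) [] [] :=
  fun _ _ => rfl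

theorem Trans.dec (k : K) : Trans B (.dec k) ρ (Function.update ρ k (ρ k - 1)) [] [] :=
  fun _ _ => rfl

theorem Trans.seq (hp : Trans B p ρ ρ' x y) (hq : Trans B q ρ' ρ'' x' y') :
    Trans B (.seq p q) ρ ρ'' (x ++ x') (y ++ y') := by
  intro r o
  refine ⟨⟨x' ++ r, ρ', y.reverse ++ o⟩, ?_, ?_⟩
  · rw [List.append_assoc]; exact hp _ _
  · rw [List.reverse_append, List.append_assoc]; exact hq _ _

theorem Trans.congr {z w : List Γ'} {κ : K → ℕ} (hp : Trans B p ρ ρ' x y) (hx : x = z) (hy : y = w)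
    (hρ : ρ' = κ) : Trans B p ρ κ z w := by
  subst hx hy hρ; exact hp

theorem Trans.ite_true {t : Γ' → Bool} {c : Γ'} (hc : t c = true)
    (hp : Trans B p ρ ρ' (c :: x) y) : Trans B (.ite (.top t) p q) ρ ρ' (c :: x) y :=
  fun r o => Or.inl ⟨by simpa [Test.holds] using hc, hp r o⟩

theorem Trans.ite_false {t : Γ' → Bool} {c : Γ'} (hc : t c = false)
    (hq : Trans B q ρ ρ' (c :: x) y) : Trans B (.ite (.top t) p q) ρ ρ' (c :: x) y :=
  fun r o => Or.inr ⟨by simpa [Test.holds] using hc, hq r o⟩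

/-- A loop over a counter, where the `i`-th iteration consumes the code of the `i`-th element of
a list. -/
theorem Trans.loop_pos {α : Type} (k : K) (l : List α) (e e' : α → List Γ') (ρ : ℕ → K → ℕ)
    (hB : l.length ≤ B) (hpos : ∀ i < l.length, ρ i k ≠ 0) (hend : ρ l.length k = 0)
    (hp : ∀ (i : ℕ) (h : i < l.length), Trans B p (ρ i) (ρ (i + 1)) (e l[i]) (e' l[i])) :
    Trans B (.loop (.pos k) p) (ρ 0) (ρ l.length) (l.flatMap e) (l.flatMap e') := by
  intro r o
  refine ⟨l.length, hB, ?_, by simpa [Test.holds] using hend⟩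
  clear hB hend
  induction l generalizing ρ o with
  | nil => simp [IterRel]
  | cons a l ih =>
    refine ⟨⟨l.flatMap e ++ r, ρ 1, (e' a).reverse ++ o⟩, ⟨?_, ?_⟩, ?_⟩
    · simpa [Test.holds] using hpos 0 (by simp)
    · have := hp 0 (by simp) (l.flatMap e ++ r) o
      simpa using this
    · have := ih (fun i => ρ (i + 1)) (fun i hi => hpos (i + 1) (by simpa using hi))
        (fun i hi => hp (i + 1) (by simpa using hi)) ((e' a).reverse ++ o)
      simpa using this

/-- A loop that processes the symbols of the input up to a delimiter. -/
theorem Trans.scan {t : Γ' → Bool} (l : List Γ') (c : Γ') (e : Γ' → List Γ') (ρ : ℕ → K → ℕ)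
    (hB : l.length ≤ B) (hl : ∀ a ∈ l, t a = true) (hc : t c = false)
    (hp : ∀ (i : ℕ) (h : i < l.length), Trans B p (ρ i) (ρ (i + 1)) [l[i]] (e l[i])) :
    Trans B (.seq (.loop (.top t) p) .read) (ρ 0) (ρ l.length) (l ++ [c]) (l.flatMap e) := by
  intro r o
  refine ⟨⟨c :: r, ρ l.length, (l.flatMap e).reverse ++ o⟩, ⟨l.length, hB, ?_, ?_⟩, rfl⟩
  · clear hB
    induction l generalizing ρ o with
    | nil => simp [IterRel]
    | cons a l ih =>
      refine ⟨⟨l ++ [c] ++ r, ρ 1, (e a).reverse ++ o⟩, ⟨?_, ?_⟩, ?_⟩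
      · simpa [Test.holds] using hl a (by simp)
      · have := hp 0 (by simp) (l ++ [c] ++ r) o
        simpa using this
      · have := ih (fun i => ρ (i + 1)) (fun i hi => hl i (by simp [hi]))
          (fun i hi => hp (i + 1) (by simpa using hi)) ((e a).reverse ++ o)
        simpa using this
  · simpa [Test.holds] using hc

/-- Write a string. -/
def emits : List Γ' → Cmd K
  | [] => .skip
  | c :: l => .seq (.emit c) (emits l)

theorem Trans.emits (w : List Γ') : Trans B (emits w) ρ ρ [] w := by
  induction w with
  | nil => exact Trans.skip
  | cons c w ih => exact (Trans.emit c).seq ih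

theorem flatMap_nil_fun {α : Type} (l : List α) : l.flatMap (fun _ => ([] : List Γ')) = [] := by
  simp

/-- Move the contents of the counter `a` to the counter `k`. -/
def moveC (a k : K) : Cmd K := .loop (.pos a) (.seq (.dec a) (.inc k))

/-- After `i` rounds `k` has gained `i` and `a` has lost `i`. The list `List.range (ρ a)` serves
only to count the rounds. -/
theorem Trans.moveC {a k : K} (hak : a ≠ k) (hB : ρ a ≤ B) :
    Trans B (moveC a k) ρ (Function.update (Function.update ρ k (ρ k + ρ a)) a 0) [] [] := by
  have h := Trans.loop_pos (B := B) (p := .seq (.dec a) (.inc k)) a (List.range (ρ a))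
    (fun _ => []) (fun _ => [])
    (fun i => Function.update (Function.update ρ k (ρ k + i)) a (ρ a - i)) (by simpa using hB)
    (fun i hi => by simp at hi ⊢; omega) (by simp)
    (fun i hi => by
      refine ((Trans.dec a).seq (Trans.inc k)).congr rfl rfl ?_
      funext j
      by_cases h1 : j = a
      · subst h1; simp [hak]; omega
      · by_cases h2 : j = k
        · subst h2; simp [h1]; omega
        · simp [h1, h2])
  simpa [Transducer.moveC, flatMap_nil_fun] using h

/-- Clear a counter. -/
def clearC (a : K) : Cmd K := .loop (.pos a) (.dec a)

theorem Trans.clearC {a : K} (hB : ρ a ≤ B) :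
    Trans B (clearC a) ρ (Function.update ρ a 0) [] [] := by
  have h := Trans.loop_pos (B := B) (p := .dec a) a (List.range (ρ a))
    (fun _ => []) (fun _ => []) (fun i => Function.update ρ a (ρ a - i)) (by simpa using hB)
    (fun i hi => by simp at hi ⊢; omega) (by simp)
    (fun i hi => by
      refine (Trans.dec a).congr rfl rfl ?_
      funext j
      by_cases h1 : j = a
      · subst h1; simp; omega
      · simp [h1])
  simpa [Transducer.clearC, flatMap_nil_fun] using h

/-- Run `p` as often as the counter `k` says, clearing this counter. -/
def forC (k : K) (p : Cmd K) : Cmd K := .loop (.pos k) (.seq (.dec k) p)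

/-- The controlling counter takes all values on its way down, so the body has to work for every
value `j` and leave it unchanged. -/
theorem Trans.forC {α : Type} {k : K} (l : List α) {e e' : α → List Γ'} (hk : ρ k = l.length)
    (hB : l.length ≤ B)
    (hp : ∀ a ∈ l, ∀ j, Trans B p (Function.update ρ k j) (Function.update ρ k j) (e a) (e' a)) :
    Trans B (forC k p) ρ (Function.update ρ k 0) (l.flatMap e) (l.flatMap e') := by
  have h := Trans.loop_pos (B := B) (p := .seq (.dec k) p) k l e e'
    (fun i => Function.update ρ k (l.length - i)) hB
    (fun i hi => by simp; omega) (by simp)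
    (fun i hi => by
      refine ((Trans.dec k).seq (ρ'' := Function.update ρ k (l.length - i - 1)) ?_).congr
        (List.nil_append _) (List.nil_append _) (by rw [Nat.sub_sub])
      have := hp l[i] (List.getElem_mem _) (l.length - i - 1)
      simpa using this)
  simpa [Transducer.forC, ← hk] using h

/-- Run `p` as often as the counter `k` says, with the help of the auxiliary counter `a`. -/
def forR (k a : K) (p : Cmd K) : Cmd K :=
  .seq (.loop (.pos k) (.seq (.dec k) (.seq (.inc a) p))) (moveC a k)

/-- The count migrates from `k` to `a` and is moved back at the end, so the loop can be repeated any
number of times. The body runs while both counters vary, hence the demand that it preserve arbitrary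
`ρ'`. -/
theorem Trans.forR {α : Type} {k a : K} (l : List α) {e e' : α → List Γ'} (hka : k ≠ a)
    (ha : ρ a = 0) (hk : ρ k = l.length) (hB : l.length ≤ B)
    (hp : ∀ a ∈ l, ∀ ρ', Trans B p ρ' ρ' (e a) (e' a)) :
    Trans B (forR k a p) ρ ρ (l.flatMap e) (l.flatMap e') := by
  have h := Trans.loop_pos (B := B) (p := .seq (.dec k) (.seq (.inc a) p)) k l e e'
    (fun i => Function.update (Function.update ρ a i) k (l.length - i)) hB
    (fun i hi => by simp; omega) (by simp)
    (fun i hi => by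
      refine ((Trans.dec k).seq ((Trans.inc a).seq (hp l[i] (List.getElem_mem _) _))).congr
        (by simp) (by simp) ?_
      funext j
      by_cases h1 : j = a
      · subst h1; simp [Ne.symm hka]
      · by_cases h2 : j = k
        · subst h2; simp [h1]; omega
        · simp [h1, h2])
  have e0 : Function.update (Function.update ρ a 0) k (l.length - 0) = ρ := by
    rw [Nat.sub_zero, ← hk, ← ha]; simp [Function.update_eq_self]
  rw [e0] at h
  refine (h.seq (Trans.moveC (Ne.symm hka) (by simpa [Ne.symm hka] using hB))).congr
    (by simp) (by simp) ?_
  funext j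
  by_cases h1 : j = a
  · subst h1; simp [ha]
  · by_cases h2 : j = k
    · subst h2; simp [h1, hk, Ne.symm hka]
    · simp [h1, h2]

/-- Write a string as often as the counter `k` says. -/
theorem Trans.forR_emits {α : Type} {k a : K} (l : List α) (w : List Γ') (hka : k ≠ a)
    (ha : ρ a = 0) (hk : ρ k = l.length) (hB : l.length ≤ B) :
    Trans B (Transducer.forR k a (Transducer.emits w)) ρ ρ [] (l.flatMap fun _ => w) :=
  (Trans.forR l (e := fun _ => []) hka ha hk hB fun _ _ _ => Trans.emits w).congr (by simp) rfl rfl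

/-- Run several programs one after the other. -/
def seqs : List (Cmd K) → Cmd K
  | [] => .skip
  | p :: l => .seq p (seqs l)

/-- A function that is computed by a program. -/
theorem computable_of_trans [Fintype K] {α β : Type} {ea : α → List Γ'} {eb : β → List Γ'}
    {f : α → β} (p : Cmd K) (P : Polynomial ℕ)
    (h : ∀ a, Trans (P.eval (ea a).length) p (fun _ => 0) (fun _ => 0) (ea a) (eb (f a))) :
    Nonempty (Turing.TM2ComputableInPolyTime ea eb f) :=
  p.computable P fun a => by simpa using h a [] []

end Transducer

/-! ### Min-only systems over an arbitrary finite set of variables -/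

/-- A min-only system whose variables are listed in a chosen order, min variables first. -/
structure MinSystem (W : Type) where
  /-- the min variables -/
  mins : List W
  /-- the affine variables -/
  affs : List W
  nodup : (mins ++ affs).Nodup
  complete : ∀ w, w ∈ mins ++ affs
  /-- the variables over which the minimum is taken -/
  J : W → Finset W
  J_nonempty : ∀ w, (J w).Nonempty
  /-- coefficients -/
  q : W → W → ℚ
  /-- constants -/
  b : W → ℚ

namespace MinSystem

variable {W : Type} (S : MinSystem W)

/-- The variable at a position. -/
def var : LEMMVar S.mins.length 0 S.affs.length → W
  | .inl i => S.mins[i]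
  | .inr (.inl j) => j.elim0
  | .inr (.inr k) => S.affs[k]

/-- Positions and strings depend on the numbering only through the list `mins ++ affs`; with this
lemma the `Fin` indices can be eliminated from them. -/
theorem map_var_list :
    (LEMMVar.list S.mins.length 0 S.affs.length).map S.var = S.mins ++ S.affs := by
  simp only [LEMMVar.list, List.map_append, List.map_map, List.finRange_zero, List.map_nil,
    List.nil_append]
  congr 1
  · exact List.map_getElem_finRange S.mins
  · exact List.map_getElem_finRange S.affs

theorem var_eq (v : LEMMVar S.mins.length 0 S.affs.length) :
    (S.mins ++ S.affs)[v.pos]? = some (S.var v) := by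
  rcases v with i | j | k
  · simp only [LEMMVar.pos, var]
    rw [List.getElem?_append_left i.2]
    simp
  · exact j.elim0
  · simp only [LEMMVar.pos, var]
    rw [List.getElem?_append_right (by omega)]
    simp

theorem var_bijective : Function.Bijective S.var := by
  constructor
  · intro u v h
    have hu := S.var_eq u
    have hv := S.var_eq v
    rw [h] at hu
    refine LEMMVar.pos_injective ?_
    have hlt : u.pos < (S.mins ++ S.affs).length := by
      by_contra hc
      rw [List.getElem?_eq_none (by omega)] at hu
      simp at hu
    exact (List.getElem?_inj hlt S.nodup).1 (hu.trans hv.symm)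
  · intro w
    have := S.complete w
    rw [← map_var_list] at this
    obtain ⟨v, -, hv⟩ := List.mem_map.1 this
    exact ⟨v, hv⟩

/-- The variables and their positions. -/
noncomputable def equiv : LEMMVar S.mins.length 0 S.affs.length ≃ W :=
  Equiv.ofBijective _ S.var_bijective

theorem equiv_apply (v) : S.equiv v = S.var v := rfl

/-- The system with numbered variables. -/
noncomputable abbrev toLEMM : LEMM where
  n₁ := S.mins.length
  n₂ := 0
  m := S.affs.length
  Jmin i := (S.J S.mins[i]).map S.equiv.symm.toEmbedding
  Jmax j := j.elim0
  Jmin_nonempty i := (S.J_nonempty _).map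
  Jmax_nonempty j := j.elim0
  q k v := S.q S.affs[k] (S.var v)
  b k := S.b S.affs[k]

/-- Solutions of the system. -/
def Sol [Fintype W] (y : W → ℝ) : Prop :=
  (∀ w ∈ S.mins, y w = (S.J w).inf' (S.J_nonempty w) y) ∧
    ∀ w ∈ S.affs, y w = (∑ u, (S.q w u : ℝ) * y u) + (S.b w : ℝ)

theorem feasible_iff [Fintype W] (x : S.toLEMM.Var → ℝ) :
    S.toLEMM.Feasible x ↔ S.Sol (fun w => x (S.equiv.symm w)) := by
  have hx : ∀ v : LEMMVar S.mins.length 0 S.affs.length, x (S.equiv.symm (S.var v)) = x v :=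
    fun v => congrArg x (S.equiv.symm_apply_apply v)
  have h1 : ∀ i : Fin S.mins.length, x (.inl i) = x (S.equiv.symm S.mins[i]) :=
    fun i => (hx (.inl i)).symm
  have h2 : ∀ i : Fin S.affs.length, x (.inr (.inr i)) = x (S.equiv.symm S.affs[i]) :=
    fun i => (hx (.inr (.inr i))).symm
  have h3 : ∀ w : W, ∑ v : LEMMVar S.mins.length 0 S.affs.length, (S.q w (S.var v) : ℝ) * x v
      = ∑ u, (S.q w u : ℝ) * x (S.equiv.symm u) := by
    intro w
    rw [← S.equiv.sum_comp]
    exact Finset.sum_congr rfl fun v _ => by rw [equiv_apply, hx]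
  constructor
  · rintro ⟨f1, -, f3⟩
    constructor
    · intro w hw
      obtain ⟨i, hi, rfl⟩ := List.getElem_of_mem hw
      have := f1 ⟨i, hi⟩
      simp only [toLEMM, Finset.inf'_map] at this
      exact (h1 ⟨i, hi⟩).symm.trans this
    · intro w hw
      obtain ⟨i, hi, rfl⟩ := List.getElem_of_mem hw
      have := f3 ⟨i, hi⟩
      refine (h2 ⟨i, hi⟩).symm.trans (this.trans ?_)
      exact congrArg (· + (S.b S.affs[i] : ℝ)) (h3 _)
  · rintro ⟨f1, f3⟩
    refine ⟨fun i => ?_, fun j => j.elim0, fun k => ?_⟩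
    · refine (h1 i).trans ((f1 _ (List.getElem_mem _)).trans ?_)
      simp only [toLEMM, Finset.inf'_map]
      rfl
    · refine (h2 k).trans ((f3 _ (List.getElem_mem _)).trans ?_)
      exact congrArg (· + (S.b S.affs[k] : ℝ)) (h3 _).symm

/-- An instance of the decision problem. -/
noncomputable def inst (w : W) (β : ℚ) : LEMMInstance := ⟨S.toLEMM, S.equiv.symm w, β⟩

theorem inst_yes [Fintype W] (w : W) (β : ℚ) :
    (S.inst w β).Yes ↔ ∃ y, S.Sol y ∧ y w < (β : ℝ) := by
  constructor
  · rintro ⟨x, hx, h⟩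
    exact ⟨_, (S.feasible_iff x).1 hx, h⟩
  · rintro ⟨y, hy, h⟩
    refine ⟨fun v => y (S.equiv v), (S.feasible_iff _).2 ?_, ?_⟩
    · simpa using hy
    · simpa [inst] using h

theorem toLEMM_sumLeOne [Fintype W] (h : ∀ w ∈ S.affs, ∑ u, S.q w u + S.b w ≤ 1) :
    S.toLEMM.SumLeOne := by
  intro k
  refine le_trans (le_of_eq ?_) (h S.affs[k] (List.getElem_mem _))
  exact congrArg (· + S.b S.affs[k]) (S.equiv.sum_comp (fun u => S.q S.affs[k] u))

/-- The matrices whose min rows are probability vectors supported on the allowed choices. -/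
def IsMixed [Fintype W] (Q : Matrix W W ℝ) : Prop :=
  (∀ w ∈ S.mins, (∀ u, 0 ≤ Q w u) ∧ ∑ u, Q w u = 1 ∧ ∀ u, u ∉ S.J w → Q w u = 0) ∧
    ∀ w ∈ S.affs, ∀ u, Q w u = (S.q w u : ℝ)

/-- The mixed matrices form a convex set that contains the choice matrices, hence also their convex
hull. Renaming indices is an algebra isomorphism, so it commutes with powers. -/
theorem toLEMM_halting [Fintype W] [DecidableEq W]
    (h : ∀ Q, S.IsMixed Q → Tendsto (fun p : ℕ => Q ^ p) atTop (𝓝 0)) : S.toLEMM.Halting := by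
  intro Q hQ
  let C : Set (Matrix S.toLEMM.Var S.toLEMM.Var ℝ) :=
    {Q | S.IsMixed (Matrix.reindexAlgEquiv ℝ ℝ S.equiv Q)}
  have hC : Convex ℝ C := by
    intro Q hQ R hR a c ha hc hac
    refine ⟨fun w hw => ⟨fun u => ?_, ?_, fun u hu => ?_⟩, fun w hw u => ?_⟩
    · have := (hQ.1 w hw).1 u
      have := (hR.1 w hw).1 u
      simp only [Matrix.coe_reindexAlgEquiv, Matrix.reindex_apply, Matrix.submatrix_apply,
        Matrix.add_apply, Matrix.smul_apply, smul_eq_mul] at *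
      positivity
    · have h1 := (hQ.1 w hw).2.1
      have h2 := (hR.1 w hw).2.1
      simp only [Matrix.coe_reindexAlgEquiv, Matrix.reindex_apply, Matrix.submatrix_apply,
        Matrix.add_apply, Matrix.smul_apply, smul_eq_mul, Finset.sum_add_distrib,
        ← Finset.mul_sum] at *
      rw [h1, h2]; linarith
    · have h1 := (hQ.1 w hw).2.2 u hu
      have h2 := (hR.1 w hw).2.2 u hu
      simp only [Matrix.coe_reindexAlgEquiv, Matrix.reindex_apply, Matrix.submatrix_apply,
        Matrix.add_apply, Matrix.smul_apply, smul_eq_mul] at *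
      rw [h1, h2]; ring
    · have h1 := hQ.2 w hw u
      have h2 := hR.2 w hw u
      simp only [Matrix.coe_reindexAlgEquiv, Matrix.reindex_apply, Matrix.submatrix_apply,
        Matrix.add_apply, Matrix.smul_apply, smul_eq_mul] at *
      rw [h1, h2, ← add_mul, hac, one_mul]
  have hsub : S.toLEMM.choiceMatrices ⊆ C := by
    rintro _ ⟨s, t, hs, -, rfl⟩
    have hrow : ∀ (i : Fin S.mins.length) (u : W),
        (Matrix.reindexAlgEquiv ℝ ℝ S.equiv) (S.toLEMM.choiceMatrix s t) S.mins[i] u =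
          if u = S.equiv (s i) then 1 else 0 := by
      intro i u
      have hi : S.equiv.symm S.mins[i] = .inl i := S.equiv.symm_apply_apply (.inl i)
      simp only [Matrix.coe_reindexAlgEquiv, Matrix.reindex_apply, Matrix.submatrix_apply, hi,
        LEMM.choiceMatrix, Matrix.of_apply, Equiv.symm_apply_eq]
    refine ⟨fun w hw => ?_, fun w hw u => ?_⟩
    · obtain ⟨i, hi, rfl⟩ := List.getElem_of_mem hw
      have hrow := hrow ⟨i, hi⟩
      have hs := hs ⟨i, hi⟩
      simp only [Fin.getElem_fin] at hrow
      refine ⟨fun u => ?_, ?_, fun u hu => ?_⟩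
      · rw [hrow]; split_ifs <;> norm_num
      · simp only [hrow]; simp
      · rw [hrow, if_neg]
        rintro rfl
        simp only [toLEMM, Finset.mem_map_equiv, Equiv.symm_symm] at hs
        exact hu hs
    · obtain ⟨i, hi, rfl⟩ := List.getElem_of_mem hw
      have hi' : S.equiv.symm S.affs[i] = .inr (.inr ⟨i, hi⟩) :=
        S.equiv.symm_apply_apply (.inr (.inr ⟨i, hi⟩))
      simp only [Matrix.coe_reindexAlgEquiv, Matrix.reindex_apply, Matrix.submatrix_apply, hi',
        LEMM.choiceMatrix, Matrix.of_apply]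
      have : S.var (S.equiv.symm u) = u := S.equiv.apply_symm_apply u
      simp [this]
  have hmix : S.IsMixed (Matrix.reindexAlgEquiv ℝ ℝ S.equiv Q) := convexHull_min hsub hC hQ
  have := h _ hmix
  refine tendsto_pi_nhds.2 fun u => tendsto_pi_nhds.2 fun v => ?_
  have := tendsto_pi_nhds.1 (tendsto_pi_nhds.1 this (S.equiv u)) (S.equiv v)
  simp only [← map_pow] at this
  simpa using this

theorem list_flatMap_var (F : W → List Γ') :
    (LEMMVar.list S.mins.length 0 S.affs.length).flatMap (fun v => F (S.var v)) =
      (S.mins ++ S.affs).flatMap F := by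
  rw [← S.map_var_list, List.flatMap_map]

theorem encode_inst [DecidableEq W] {w : W} {n : ℕ} (hn : (S.mins ++ S.affs)[n]? = some w)
    (β : ℚ) :
    (S.inst w β).encode = encUnary S.mins.length ++ (encUnary 0 ++ (encUnary S.affs.length ++
      (S.mins.flatMap (fun w => (S.mins ++ S.affs).flatMap fun u => [.bit (decide (u ∈ S.J w))]) ++
        (S.affs.flatMap (fun w => (S.mins ++ S.affs).flatMap (fun u => encRat (S.q w u)) ++
          encRat (S.b w)) ++ (encUnary n ++ encRat β))))) := by
  have hpos : (S.equiv.symm w).pos = n := by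
    have h := S.var_eq (S.equiv.symm w)
    rw [← equiv_apply, Equiv.apply_symm_apply] at h
    refine (List.getElem?_inj ?_ S.nodup).1 (h.trans hn.symm)
    by_contra hc
    rw [List.getElem?_eq_none (by omega)] at h
    simp at h
  have hmask : ∀ i : Fin S.mins.length, encMask (S.toLEMM.Jmin i) =
      (S.mins ++ S.affs).flatMap fun u => [.bit (decide (u ∈ S.J S.mins[i]))] := by
    intro i
    rw [← list_flatMap_var]
    refine List.flatMap_congr fun v _ => ?_
    have : v ∈ S.toLEMM.Jmin i ↔ S.var v ∈ S.J S.mins[i] := by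
      simp only [toLEMM, Finset.mem_map_equiv, Equiv.symm_symm]
      rfl
    simp only [this]
  have h1 : (List.finRange S.mins.length).flatMap (fun i => encMask (S.toLEMM.Jmin i)) =
      S.mins.flatMap
        (fun w => (S.mins ++ S.affs).flatMap fun u => [.bit (decide (u ∈ S.J w))]) := by
    conv_rhs => rw [← List.map_getElem_finRange S.mins, List.flatMap_map]
    simp only [List.map_getElem_finRange]
    exact List.flatMap_congr fun i _ => hmask i
  have h2 : (List.finRange S.affs.length).flatMap (fun k =>
      (LEMMVar.list S.mins.length 0 S.affs.length).flatMap
        (fun v => encRat (S.q S.affs[k] (S.var v))) ++ encRat (S.b S.affs[k])) =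
      S.affs.flatMap (fun w => (S.mins ++ S.affs).flatMap (fun u => encRat (S.q w u)) ++
          encRat (S.b w)) := by
    conv_rhs => rw [← List.map_getElem_finRange S.affs, List.flatMap_map]
    simp only [List.map_getElem_finRange]
    refine List.flatMap_congr fun i _ => ?_
    rw [list_flatMap_var S (fun u => encRat (S.q S.affs[i] u))]
    rfl
  rw [← h1, ← h2, ← hpos]
  rfl

end MinSystem

/-! ### Powers of matrices tending to zero -/

/-- Replaces matrix powers by orbits of vectors, which can be followed coordinate by coordinate. -/
theorem tendsto_pow_zero_iff_mulVec {ι : Type} [Fintype ι] [DecidableEq ι] {Q : Matrix ι ι ℝ} :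
    Tendsto (fun p : ℕ => Q ^ p) atTop (𝓝 0) ↔
      ∀ w v, Tendsto (fun p : ℕ => ((Q ^ p).mulVec w) v) atTop (𝓝 0) := by
  constructor
  · intro h w v
    have h1 : ∀ u, Tendsto (fun p : ℕ => (Q ^ p) v u * w u) atTop (𝓝 (0 * w u)) := fun u =>
      (tendsto_pi_nhds.1 (tendsto_pi_nhds.1 h v) u).mul_const _
    have := tendsto_finsetSum (Finset.univ : Finset ι) fun u _ => h1 u
    simpa [Matrix.mulVec, dotProduct] using this
  · intro h
    refine tendsto_pi_nhds.2 fun v => tendsto_pi_nhds.2 fun u => ?_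
    simpa using h (Pi.single u 1) v

/-- Choices at different variables are independent: a product of row sets lies inside the set of
choice matrices, and the convex hull of a product is the product of the convex hulls
(`convexHull_pi`). In each min or max row, a probability vector supported on the allowed set is a
convex combination of unit vectors. -/
theorem LEMM.mem_convexHull_choiceMatrices (L : LEMM) (R : Matrix L.Var L.Var ℝ)
    (h1 : ∀ i, (∀ u, 0 ≤ R (.inl i) u) ∧ ∑ u, R (.inl i) u = 1 ∧
      ∀ u, u ∉ L.Jmin i → R (.inl i) u = 0)
    (h2 : ∀ j, (∀ u, 0 ≤ R (.inr (.inl j)) u) ∧ ∑ u, R (.inr (.inl j)) u = 1 ∧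
      ∀ u, u ∉ L.Jmax j → R (.inr (.inl j)) u = 0)
    (h3 : ∀ k u, R (.inr (.inr k)) u = (L.q k u : ℝ)) :
    R ∈ convexHull ℝ L.choiceMatrices := by
  let T : L.Var → Set (L.Var → ℝ) := fun v => match v with
    | .inl i => (fun u => Pi.single u 1) '' (L.Jmin i : Set L.Var)
    | .inr (.inl j) => (fun u => Pi.single u 1) '' (L.Jmax j : Set L.Var)
    | .inr (.inr k) => {fun u => (L.q k u : ℝ)}
  have hT : Set.pi Set.univ T ⊆ (L.choiceMatrices : Set (L.Var → L.Var → ℝ)) := by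
    intro Q hQ
    have hmin : ∀ i, ∃ u ∈ L.Jmin i, Pi.single u 1 = Q (.inl i) := fun i => hQ (.inl i) trivial
    have hmax : ∀ j, ∃ u ∈ L.Jmax j, Pi.single u 1 = Q (.inr (.inl j)) :=
      fun j => hQ (.inr (.inl j)) trivial
    have haff : ∀ k, Q (.inr (.inr k)) = fun u => (L.q k u : ℝ) :=
      fun k => hQ (.inr (.inr k)) trivial
    choose s hs hs' using hmin
    choose t ht ht' using hmax
    refine ⟨s, t, hs, ht, ?_⟩
    funext u v
    rcases u with i | j | k
    · rw [← hs']; simp [LEMM.choiceMatrix, Pi.single_apply]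
    · rw [← ht']; simp [LEMM.choiceMatrix, Pi.single_apply]
    · rw [haff]; simp [LEMM.choiceMatrix]
  have hprob : ∀ (J : Finset L.Var) (r : L.Var → ℝ), (∀ u, 0 ≤ r u) → ∑ u, r u = 1 →
      (∀ u, u ∉ J → r u = 0) →
      r ∈ convexHull ℝ ((fun u => Pi.single u (1 : ℝ)) '' (J : Set L.Var)) := by
    intro J r hr hs hJ
    have hsum : ∑ u ∈ J, r u = 1 := by
      rw [← hs]
      exact Finset.sum_subset (Finset.subset_univ J) fun u _ hu => hJ u hu
    have hmem := (convex_convexHull ℝ ((fun u => Pi.single u (1 : ℝ)) '' (J : Set L.Var))).sum_mem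
      (fun u (_ : u ∈ J) => hr u) hsum
      (fun u hu => subset_convexHull ℝ _ ⟨u, hu, rfl⟩)
    convert hmem using 1
    funext v
    simp only [Finset.sum_apply, Pi.smul_apply, Pi.single_apply, smul_eq_mul, mul_ite, mul_one,
      mul_zero]
    rw [Finset.sum_ite_eq]
    split_ifs with hv
    · rfl
    · exact hJ v hv
  refine convexHull_mono hT ?_
  have hpi := convexHull_pi (𝕜 := ℝ) Set.univ T
  refine hpi.symm ▸ ?_
  rintro (i | j | k) -
  · exact hprob _ _ (h1 i).1 (h1 i).2.1 (h1 i).2.2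
  · exact hprob _ _ (h2 j).1 (h2 j).2.1 (h2 j).2.2
  · have : R (.inr (.inr k)) = fun u => (L.q k u : ℝ) := funext (h3 k)
    exact subset_convexHull ℝ _ this

/-! ### From general to min-only systems

The constants are turned into coefficients of an additional variable `none` with value `1`. For
every variable `v` there is a variable `inl v` with the value `± x_v`, and there are
variables `inr (v, true)` and `inr (v, false)` with the values `x_v` and `- x_v`. -/

namespace LEMM

variable (L : LEMM)

/-- The variables of the min-only system. -/
abbrev Signed : Type := Option L.Var ⊕ (Option L.Var × Bool)

instance decidableEqSigned : DecidableEq L.Signed := inferInstance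

instance fintypeSigned : Fintype L.Signed := inferInstance

/-- The sign with which a variable is represented. -/
def sgn : Option L.Var → ℚ
  | some (.inr (.inl _)) => -1
  | _ => 1

/-- The coefficient of the variable with value `x_v` or `- x_v` in the place of `r * x_v`. -/
def part (r : ℚ) : Bool → ℚ
  | true => min r 0
  | false => min (-r) 0

/-- The two copies carry x_v and -x_v, so this difference is the effective coefficient of x_v. -/
theorem part_sub (r : ℚ) : part r true - part r false = r := by
  simp only [part]
  rcases le_total r 0 with h | h
  · rw [min_eq_left h, min_eq_right (by linarith)]; ring
  · rw [min_eq_right h, min_eq_left (by linarith)]; ring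

theorem part_nonpos (r : ℚ) (s : Bool) : part r s ≤ 0 := by
  cases s <;> exact min_le_right _ _

/-- Coefficients and constant of an affine equation. -/
def coeff (k : Fin L.m) : Option L.Var → ℚ
  | some v => L.q k v
  | none => L.b k

/-- All variables in order, and the additional one. -/
def optList : List (Option L.Var) := (LEMMVar.list L.n₁ L.n₂ L.m).map some ++ [none]

/-- The coefficients of the min-only system. -/
def signedCoeff : L.Signed → L.Signed → ℚ
  | .inl (some (.inr (.inr k))), .inr (v, s) => part (L.coeff k v) s
  | .inr (v, s), .inl u => if u = v then (if s then L.sgn v else - L.sgn v) else 0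
  | _, _ => 0

/-- The variables with values `x_v`, or `- x_v`. -/
def signedCopy (s : Bool) : L.Var ↪ L.Signed where
  toFun v := .inr (some v, s)
  inj' u v h := by simpa using h

theorem signedCopy_apply (s : Bool) (v : L.Var) : L.signedCopy s v = .inr (some v, s) := rfl

/-- The sets of variables over which the minimum is taken. -/
def signedJ : L.Signed → Finset L.Signed
  | .inl (some (.inl i)) => (L.Jmin i).map (L.signedCopy true)
  | .inl (some (.inr (.inl j))) => (L.Jmax j).map (L.signedCopy false)
  | _ => {.inl none}

theorem mem_optList (v : Option L.Var) : v ∈ L.optList := by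
  rcases v with _ | v
  · simp [optList]
  · simpa [optList] using LEMMVar.mem_list v

theorem nodup_list (n₁ n₂ m : ℕ) : (LEMMVar.list n₁ n₂ m).Nodup := by
  have h1 := List.nodup_finRange n₁
  have h2 := List.nodup_finRange n₂
  have h3 := List.nodup_finRange m
  simp only [LEMMVar.list]
  refine List.Nodup.append (h1.map Sum.inl_injective) (List.Nodup.append (h2.map ?_)
    (h3.map ?_) ?_) ?_
  · intro a b h; simpa using h
  · intro a b h; simpa using h
  · intro a h1 h2
    obtain ⟨x, -, rfl⟩ := List.mem_map.1 h1
    simp at h2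
  · intro a h1 h2
    obtain ⟨x, -, rfl⟩ := List.mem_map.1 h1
    simp at h2

theorem nodup_optList : L.optList.Nodup := by
  refine List.Nodup.append ((nodup_list _ _ _).map (Option.some_injective _)) (by simp) ?_
  intro a h1 h2
  obtain rfl := List.mem_singleton.1 h2
  simp at h1

/-- The min variables. -/
def signedMins : List L.Signed :=
  (List.finRange L.n₁).map (fun i => .inl (some (.inl i))) ++
    (List.finRange L.n₂).map (fun j => .inl (some (.inr (.inl j))))

/-- The affine variables. -/
def signedAffs : List L.Signed :=
  (List.finRange L.m).map (fun k => .inl (some (.inr (.inr k)))) ++ ([.inl none] ++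
    L.optList.flatMap fun v => [.inr (v, true), .inr (v, false)])

/-- The min and max variables precede the affine ones in the numbering of `L`, and `none` comes
last. So the base variables appear in the order of `optList`, followed by the copies in pairs. This
regularity is what allows the rows to be written with counters. -/
theorem signed_all : L.signedMins ++ L.signedAffs =
    L.optList.map .inl ++ L.optList.flatMap fun v => [.inr (v, true), .inr (v, false)] := by
  simp [signedMins, signedAffs, optList, LEMMVar.list, Function.comp_def]

/-- The min-only system. -/
def signed : MinSystem L.Signed where
  mins := L.signedMins
  affs := L.signedAffs
  nodup := by
    rw [signed_all]
    refine List.Nodup.append (L.nodup_optList.map Sum.inl_injective) ?_ ?_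
    · refine List.nodup_flatMap.2 ⟨by simp, L.nodup_optList.imp ?_⟩
      intro u v huv x hx hy
      simp only [List.mem_cons, List.not_mem_nil, or_false] at hx hy
      rcases hx with rfl | rfl <;> rcases hy with h | h <;> simp at h <;> exact huv h
    · intro x hx hy
      simp only [List.mem_map, List.mem_flatMap] at hx hy
      obtain ⟨_, -, rfl⟩ := hx
      obtain ⟨_, -, h⟩ := hy
      simp at h
  complete w := by
    rw [signed_all]
    rcases w with v | ⟨v, _ | _⟩ <;> simp [mem_optList]
  J := L.signedJ
  J_nonempty w := by
    rcases w with (_ | i | j | k) | _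
    · exact ⟨_, Finset.mem_singleton_self _⟩
    · exact (L.Jmin_nonempty i).map
    · exact (L.Jmax_nonempty j).map
    · exact ⟨_, Finset.mem_singleton_self _⟩
    · exact ⟨_, Finset.mem_singleton_self _⟩
  q := L.signedCoeff
  b w := if w = .inl none then 1 else 0

/-- A translated affine row has only non-positive coefficients and constant 0; a copy has the single
coefficient 1 or -1; the row of the constant variable has sum exactly 1. -/
theorem signed_sumLeOne : L.signed.toLEMM.SumLeOne := by
  refine L.signed.toLEMM_sumLeOne fun w _ => ?_
  have hq : ∀ v, L.signed.q v = L.signedCoeff v := fun _ => rfl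
  have hb : ∀ v, L.signed.b v = if v = .inl none then 1 else 0 := fun _ => rfl
  rw [hq, hb, Fintype.sum_sum_type]
  rcases w with (_ | i | j | k) | ⟨v, s⟩
  · simp [signedCoeff]
  · simp [signedCoeff]
  · simp [signedCoeff]
  · simp only [signedCoeff, Finset.sum_const_zero, zero_add]
    have : ∑ x : Option L.Var × Bool, part (L.coeff k x.1) x.2 ≤ 0 :=
      Finset.sum_nonpos fun x _ => part_nonpos _ _
    simp only [Sum.inl.injEq, reduceCtorEq, if_false]
    linarith
  · simp only [signedCoeff, Finset.sum_ite_eq', Finset.mem_univ, if_true, Finset.sum_const_zero,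
      reduceCtorEq, if_false]
    rcases v with _ | i | j | k <;> cases s <;> norm_num [sgn]

end LEMM

/-! ### Solutions and halting of the signed system. -/

namespace LEMM

variable (L : LEMM)

theorem sgn_mul_self (v : Option L.Var) : ((L.sgn v : ℚ) : ℝ) * (L.sgn v : ℝ) = 1 := by
  rcases v with _ | i | j | k <;> norm_num [sgn]

theorem mem_signedMins_iff (w : L.Signed) : w ∈ L.signed.mins ↔
    (∃ i, w = .inl (some (.inl i))) ∨ ∃ j, w = .inl (some (.inr (.inl j))) := by
  simp [signed, signedMins, eq_comm]

theorem mem_signedAffs_iff (w : L.Signed) : w ∈ L.signed.affs ↔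
    (∃ k, w = .inl (some (.inr (.inr k)))) ∨ w = .inl none ∨ ∃ v s, w = .inr (v, s) := by
  rcases w with v | ⟨v, _ | _⟩
  · simp [signed, signedAffs, eq_comm]
  · simp [signed, signedAffs, mem_optList]
  · simp [signed, signedAffs, mem_optList]

theorem sum_signedCoeff_affine (k : Fin L.m) (y : L.Signed → ℝ)
    (hy : ∀ v, y (.inr (v, false)) = - y (.inr (v, true))) :
    ∑ u, (L.signedCoeff (.inl (some (.inr (.inr k)))) u : ℝ) * y u =
      ∑ v, (L.coeff k v : ℝ) * y (.inr (v, true)) := by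
  simp only [Fintype.sum_sum_type, signedCoeff, Rat.cast_zero, zero_mul, Finset.sum_const_zero,
    zero_add, Fintype.sum_prod_type, Fintype.sum_bool, hy]
  refine Finset.sum_congr rfl fun v _ => ?_
  have : ((part (L.coeff k v) true - part (L.coeff k v) false : ℚ) : ℝ) = (L.coeff k v : ℝ) :=
    congrArg _ (part_sub _)
  push_cast at this
  rw [← this]; ring

theorem sum_signedCoeff_copy (v : Option L.Var) (s : Bool) (y : L.Signed → ℝ) :
    ∑ u, (L.signedCoeff (.inr (v, s)) u : ℝ) * y u =
      (if s then (L.sgn v : ℝ) else - (L.sgn v : ℝ)) * y (.inl v) := by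
  simp only [Fintype.sum_sum_type, signedCoeff, Rat.cast_zero, zero_mul, Finset.sum_const_zero,
    add_zero]
  rw [Finset.sum_eq_single v]
  · cases s <;> simp
  · intro u _ hu; simp [hu]
  · simp

/-- The values of the variables of the min-only system. -/
def signedVal (x : L.Var → ℝ) : L.Signed → ℝ
  | .inl v => (L.sgn v : ℝ) * v.elim 1 x
  | .inr (v, s) => (if s then 1 else -1) * v.elim 1 x

theorem signed_sol_of_feasible {x : L.Var → ℝ} (hx : L.Feasible x) :
    L.signed.Sol (L.signedVal x) := by
  obtain ⟨h1, h2, h3⟩ := hx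
  refine ⟨fun w hw => ?_, fun w hw => ?_⟩
  · rcases (L.mem_signedMins_iff w).1 hw with ⟨i, rfl⟩ | ⟨j, rfl⟩
    · have : L.signedVal x (.inl (some (.inl i))) = x (.inl i) := by simp [signedVal, sgn]
      rw [this, h1]
      refine Eq.trans ?_ (Finset.inf'_map _ _).symm
      refine Finset.inf'_congr _ rfl fun v _ => ?_
      simp [signedVal, signedCopy_apply]
    · have : L.signedVal x (.inl (some (.inr (.inl j)))) = - x (.inr (.inl j)) := by
        simp [signedVal, sgn]
      rw [this, h2]
      refine Eq.trans ?_ (Finset.inf'_map _ _).symm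
      have : ∀ v : L.Var, (L.signedVal x ∘ L.signedCopy false) v =
          - x v := by intro v; simp [signedVal, signedCopy_apply]
      refine le_antisymm ?_ ?_
      · refine Finset.le_inf' _ _ fun v hv => ?_
        rw [this]
        exact neg_le_neg (Finset.le_sup' x hv)
      · obtain ⟨v, hv, h⟩ := Finset.exists_mem_eq_sup' (L.Jmax_nonempty j) x
        rw [h, ← this]
        exact Finset.inf'_le _ hv
  · change _ = (∑ u, (L.signedCoeff w u : ℝ) * L.signedVal x u) +
      ((if w = .inl none then 1 else 0 : ℚ) : ℝ)
    rcases (L.mem_signedAffs_iff w).1 hw with ⟨k, rfl⟩ | rfl | ⟨v, s, rfl⟩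
    · rw [sum_signedCoeff_affine _ _ _ (fun v => by simp [signedVal])]
      simp only [Fintype.sum_option, signedVal, coeff, sgn, Option.elim]
      rw [h3]
      simp
      ring
    · simp [signedVal, sgn, signedCoeff]
    · rw [sum_signedCoeff_copy]
      have := L.sgn_mul_self v
      cases s <;> simp [signedVal, ← mul_assoc, this]

/-- The equations of the copies force opposite values on each pair, and the equation of `none`
forces the value 1. Substituting these values gives back the affine equations, and negating the
minimum at a max variable gives back the maximum. -/
theorem feasible_of_signed_sol {y : L.Signed → ℝ} (hy : L.signed.Sol y) :
    L.Feasible fun v => y (.inr (some v, true)) := by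
  obtain ⟨h1, h2⟩ := hy
  replace h2 : ∀ w ∈ L.signed.affs, y w = (∑ u, (L.signedCoeff w u : ℝ) * y u) +
      ((if w = .inl none then 1 else 0 : ℚ) : ℝ) := h2
  have hc : ∀ v s, y (.inr (v, s)) = (if s then (L.sgn v : ℝ) else - (L.sgn v : ℝ)) * y (.inl v) := by
    intro v s
    have := h2 (.inr (v, s)) ((L.mem_signedAffs_iff _).2 (Or.inr (Or.inr ⟨v, s, rfl⟩)))
    rw [sum_signedCoeff_copy] at this
    simpa using this
  have hneg : ∀ v, y (.inr (v, false)) = - y (.inr (v, true)) := by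
    intro v; simp [hc]
  have hone : y (.inr (none, true)) = 1 := by
    have := h2 (.inl none) ((L.mem_signedAffs_iff _).2 (Or.inr (Or.inl rfl)))
    simp only [signedCoeff, Rat.cast_zero, zero_mul, Finset.sum_const_zero, zero_add, if_true,
      Rat.cast_one] at this
    rw [hc, this]; simp [sgn]
  refine ⟨fun i => ?_, fun j => ?_, fun k => ?_⟩ <;> beta_reduce
  · rw [hc]
    have := h1 (.inl (some (.inl i))) ((L.mem_signedMins_iff _).2 (Or.inl ⟨i, rfl⟩))
    simp only [sgn, Rat.cast_one, if_true, one_mul]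
    rw [this]
    exact Finset.inf'_map _ _
  · rw [hc]
    have := h1 (.inl (some (.inr (.inl j)))) ((L.mem_signedMins_iff _).2 (Or.inr ⟨j, rfl⟩))
    simp only [sgn, Rat.cast_neg, Rat.cast_one, if_true, neg_one_mul]
    rw [this]
    refine (congrArg Neg.neg (Finset.inf'_map _ _)).trans ?_
    refine le_antisymm ?_ ?_
    · obtain ⟨v, hv, h⟩ := Finset.exists_mem_eq_inf' (L.Jmax_nonempty j)
        (fun v : L.Var => y (.inr (some v, false)))
      have h' : -((L.Jmax j).inf' (L.Jmax_nonempty j) fun v : L.Var => y (.inr (some v, false))) ≤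
          (L.Jmax j).sup' (L.Jmax_nonempty j) fun v => y (.inr (some v, true)) := by
        rw [h, hneg, neg_neg]
        exact Finset.le_sup' (fun v : L.Var => y (.inr (some v, true))) hv
      exact h'
    · refine Finset.sup'_le _ _ fun v hv => ?_
      have := Finset.inf'_le (fun v : L.Var => y (.inr (some v, false))) hv
      rw [hneg] at this
      have h' := neg_le_neg this
      rw [neg_neg] at h'
      exact h'
  · have := h2 (.inl (some (.inr (.inr k)))) ((L.mem_signedAffs_iff _).2 (Or.inl ⟨k, rfl⟩))
    rw [sum_signedCoeff_affine _ _ _ hneg] at this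
    rw [hc]
    simp only [Fintype.sum_option, coeff, hone, Sum.inl.injEq, reduceCtorEq, if_false,
      Rat.cast_zero, add_zero] at this
    simp only [sgn, Rat.cast_one, if_true, one_mul]
    rw [this]
    ring

theorem signed_yes (i : L.Var) (β : ℚ) :
    (L.signed.inst (.inr (some i, true)) β).Yes ↔ (⟨L, i, β⟩ : LEMMInstance).Yes := by
  rw [MinSystem.inst_yes]
  constructor
  · rintro ⟨y, hy, h⟩
    exact ⟨_, L.feasible_of_signed_sol hy, h⟩
  · rintro ⟨x, hx, h⟩
    exact ⟨_, L.signed_sol_of_feasible hx, by simpa [signedVal] using h⟩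

/-- Base variables depend on copies only, and copies on base variables only. Two steps on the base
variables, conjugated by `sgn`, form a matrix `D`. Its block `R` on the original variables lies in
the convex hull of the choice matrices, so its powers tend to 0. The row of `none` in `D` is zero,
so after one application `D` acts as `R`. This settles even powers of `Q` on base variables; odd
powers follow, and the copies lag one step behind. -/
theorem signed_halting (hL : L.Halting) : L.signed.toLEMM.Halting := by
  refine L.signed.toLEMM_halting fun Q hQ => ?_
  obtain ⟨hmin, haff⟩ := hQ
  replace haff : ∀ w ∈ L.signed.affs, ∀ u, Q w u = (L.signedCoeff w u : ℝ) := haff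
  -- rows of the copies
  have hcopy : ∀ v s w, Q.mulVec w (.inr (v, s)) =
      (if s then (L.sgn v : ℝ) else - (L.sgn v : ℝ)) * w (.inl v) := by
    intro v s w
    rw [← sum_signedCoeff_copy]
    refine Finset.sum_congr rfl fun u _ => ?_
    beta_reduce
    rw [haff _ ((L.mem_signedAffs_iff _).2 (Or.inr (Or.inr ⟨v, s, rfl⟩)))]
  have hmin1 := fun i => hmin (.inl (some (.inl i))) ((L.mem_signedMins_iff _).2 (Or.inl ⟨i, rfl⟩))
  have hmin2 := fun j => hmin (.inl (some (.inr (.inl j))))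
    ((L.mem_signedMins_iff _).2 (Or.inr ⟨j, rfl⟩))
  have hJ1 : ∀ i u, u ∉ L.signedJ (.inl (some (.inl i))) → Q (.inl (some (.inl i))) u = 0 :=
    fun i => (hmin1 i).2.2
  have hJ2 : ∀ j u, u ∉ L.signedJ (.inl (some (.inr (.inl j)))) →
      Q (.inl (some (.inr (.inl j)))) u = 0 := fun j => (hmin2 j).2.2
  have haffk := fun k => haff (.inl (some (.inr (.inr k))))
    ((L.mem_signedAffs_iff _).2 (Or.inl ⟨k, rfl⟩))
  have haffc := haff (.inl none) ((L.mem_signedAffs_iff _).2 (Or.inr (Or.inl rfl)))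
  have hAA : ∀ v u, Q (.inl v) (.inl u) = 0 := by
    rintro (_ | i | j | k) u
    · rw [haffc]; simp [signedCoeff]
    · exact hJ1 i _ (by simp [signedJ, signedCopy_apply])
    · exact hJ2 j _ (by simp [signedJ, signedCopy_apply])
    · rw [haffk]; simp [signedCoeff]
  -- two steps of the min-only system amount to one step of the original one
  let D : Matrix (Option L.Var) (Option L.Var) ℝ := fun v u =>
    (L.sgn v : ℝ) * (Q (.inl v) (.inr (u, true)) - Q (.inl v) (.inr (u, false)))
  have hA : ∀ v w, Q.mulVec w (.inl v) = ∑ u, (Q (.inl v) (.inr (u, true)) * w (.inr (u, true)) +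
      Q (.inl v) (.inr (u, false)) * w (.inr (u, false))) := by
    intro v w
    simp only [Matrix.mulVec, dotProduct, Fintype.sum_sum_type, hAA, zero_mul,
      Finset.sum_const_zero, zero_add, Fintype.sum_prod_type, Fintype.sum_bool]
  have hD : ∀ w : L.Signed → ℝ, (fun v => (L.sgn v : ℝ) * Q.mulVec (Q.mulVec w) (.inl v)) =
      D.mulVec fun v => (L.sgn v : ℝ) * w (.inl v) := by
    intro w
    funext v
    rw [hA]
    simp only [hcopy]
    rw [Finset.mul_sum]
    change _ = ∑ u, D v u * ((L.sgn u : ℝ) * w (.inl u))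
    refine Finset.sum_congr rfl fun u _ => ?_
    simp only [D, if_true, Bool.false_eq_true, if_false]
    ring
  have hDp : ∀ (p : ℕ) (w : L.Signed → ℝ),
      (fun v => (L.sgn v : ℝ) * (Q ^ (2 * p)).mulVec w (.inl v)) =
      (D ^ p).mulVec fun v => (L.sgn v : ℝ) * w (.inl v) := by
    intro p
    induction p with
    | zero => intro w; simp
    | succ p ih =>
      intro w
      have : Q ^ (2 * (p + 1)) = Q ^ (2 * p) * Q * Q := by
        rw [mul_add, pow_add, mul_assoc]; congr 1; rw [← pow_two]
      rw [this, pow_succ, ← Matrix.mulVec_mulVec, ← Matrix.mulVec_mulVec, ← Matrix.mulVec_mulVec,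
        ← hD, ← ih]
  -- the original system
  let R : Matrix L.Var L.Var ℝ := fun v u => D (some v) (some u)
  have hRmem : R ∈ convexHull ℝ L.choiceMatrices := by
    have hz1 : ∀ i (u : Option L.Var), Q (.inl (some (.inl i))) (.inr (u, false)) = 0 :=
      fun i u => hJ1 i _ (by simp [signedJ, signedCopy_apply])
    have hz1' : ∀ i, Q (.inl (some (.inl i))) (.inr (none, true)) = 0 :=
      fun i => hJ1 i _ (by simp [signedJ, signedCopy_apply])
    have hz2 : ∀ j (u : Option L.Var), Q (.inl (some (.inr (.inl j)))) (.inr (u, true)) = 0 :=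
      fun i u => hJ2 i _ (by simp [signedJ, signedCopy_apply])
    have hz2' : ∀ j, Q (.inl (some (.inr (.inl j)))) (.inr (none, false)) = 0 :=
      fun j => hJ2 j _ (by simp [signedJ, signedCopy_apply])
    have hR1 : ∀ i u, R (.inl i) u = Q (.inl (some (.inl i))) (.inr (some u, true)) := by
      intro i u; simp [R, D, sgn, hz1]
    have hR2 : ∀ j u, R (.inr (.inl j)) u =
        Q (.inl (some (.inr (.inl j)))) (.inr (some u, false)) := by
      intro j u; simp [R, D, sgn, hz2]
    refine L.mem_convexHull_choiceMatrices R (fun i => ⟨fun u => ?_, ?_, fun u hu => ?_⟩)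
      (fun j => ⟨fun u => ?_, ?_, fun u hu => ?_⟩) (fun k u => ?_)
    · rw [hR1]; exact (hmin1 i).1 _
    · simp only [hR1]
      have := (hmin1 i).2.1
      simpa only [Fintype.sum_sum_type, hAA, Finset.sum_const_zero, zero_add,
        Fintype.sum_prod_type, Fintype.sum_bool, Fintype.sum_option, hz1, hz1', add_zero] using this
    · rw [hR1]; exact hJ1 i _ (by simpa [signedJ, signedCopy_apply] using hu)
    · rw [hR2]; exact (hmin2 j).1 _
    · simp only [hR2]
      have := (hmin2 j).2.1
      simpa only [Fintype.sum_sum_type, hAA, Finset.sum_const_zero, zero_add,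
        Fintype.sum_prod_type, Fintype.sum_bool, Fintype.sum_option, hz2, hz2', add_zero] using this
    · rw [hR2]; exact hJ2 j _ (by simpa [signedJ, signedCopy_apply] using hu)
    · have := congrArg (Rat.cast : ℚ → ℝ) (part_sub (L.q k u))
      simpa [R, D, haffk, signedCoeff, sgn, coeff] using this
  have hR0 := tendsto_pow_zero_iff_mulVec.1 (hL R hRmem)
  -- the powers of `D`
  have hDnone : ∀ z, D.mulVec z none = 0 := by
    intro z
    simp [D, Matrix.mulVec, dotProduct, haffc, signedCoeff]
  -- On vectors that vanish at `none` the column of constants does not contribute, and `D` preserves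
  -- this property.
  have hDz : ∀ (p : ℕ) (z : Option L.Var → ℝ), z none = 0 →
      (D ^ p).mulVec z = fun v => v.elim 0 ((R ^ p).mulVec fun u => z (some u)) := by
    intro p
    induction p with
    | zero => intro z hz; funext v; cases v <;> simp [hz]
    | succ p ih =>
      intro z hz
      rw [pow_succ, ← Matrix.mulVec_mulVec, ih _ (hDnone z), pow_succ, ← Matrix.mulVec_mulVec]
      have : (fun u => D.mulVec z (some u)) = R.mulVec fun u => z (some u) := by
        funext u
        simp [Matrix.mulVec, dotProduct, R, hz]
      rw [this]
  have hD0 : ∀ z v, Tendsto (fun p : ℕ => ((D ^ p).mulVec z) v) atTop (𝓝 0) := by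
    intro z v
    rw [← tendsto_add_atTop_iff_nat 1]
    have : ∀ p : ℕ, (D ^ (p + 1)).mulVec z v =
        v.elim 0 ((R ^ p).mulVec fun u => D.mulVec z (some u)) := by
      intro p
      rw [pow_succ, ← Matrix.mulVec_mulVec, hDz _ _ (hDnone z)]
    simp only [this]
    cases v with
    | none => simp
    | some v => exact hR0 _ v
  -- conclusion
  have hA0 : ∀ w v, Tendsto (fun p : ℕ => (Q ^ (2 * p)).mulVec w (.inl v)) atTop (𝓝 0) := by
    intro w v
    have := (hD0 (fun v => (L.sgn v : ℝ) * w (.inl v)) v).const_mul (L.sgn v : ℝ)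
    rw [mul_zero] at this
    refine this.congr fun p => ?_
    rw [← hDp, ← mul_assoc, sgn_mul_self, one_mul]
  have hA1 : ∀ w v, Tendsto (fun p : ℕ => (Q ^ p).mulVec w (.inl v)) atTop (𝓝 0) := by
    intro w v
    have h0 := hA0 w v
    -- An odd power applied to `w` is an even power applied to `Q.mulVec w`.
    have h1 := hA0 (Q.mulVec w) v
    rw [Metric.tendsto_atTop] at h0 h1 ⊢
    intro ε hε
    obtain ⟨a, ha⟩ := h0 ε hε
    obtain ⟨b, hb⟩ := h1 ε hε
    refine ⟨2 * a + 2 * b + 1, fun n hn => ?_⟩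
    rcases Nat.even_or_odd' n with ⟨k, rfl | rfl⟩
    · exact ha k (by omega)
    · have := hb k (by omega)
      rwa [Matrix.mulVec_mulVec, ← pow_succ] at this
  refine tendsto_pow_zero_iff_mulVec.2 fun w v => ?_
  rcases v with v | ⟨v, s⟩
  · exact hA1 w v
  · rw [← tendsto_add_atTop_iff_nat 1]
    have := (hA1 w v).const_mul (if s then (L.sgn v : ℝ) else - (L.sgn v : ℝ))
    rw [mul_zero] at this
    refine this.congr fun p => ?_
    rw [pow_succ', ← Matrix.mulVec_mulVec, hcopy]

end LEMM

/-! ### Programs for unary and rational numbers -/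

namespace Transducer

/-- A string repeated `n` times. -/
def rep (n : ℕ) (w : List Γ') : List Γ' := (List.replicate n w).flatten

theorem flatMap_const_eq_rep {α : Type} (l : List α) (w : List Γ') :
    l.flatMap (fun _ => w) = rep l.length w := by
  induction l with
  | nil => rfl
  | cons a l ih => simp [rep, List.replicate_succ, ih]

theorem flatMap_eq_rep {α : Type} {l : List α} {f : α → List Γ'} {w : List Γ'} {n : ℕ}
    (hn : l.length = n) (h : ∀ a ∈ l, f a = w) : l.flatMap f = rep n w := by
  rw [← hn, ← flatMap_const_eq_rep]
  exact List.flatMap_congr h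

theorem rep_add (m n : ℕ) (w : List Γ') : rep (m + n) w = rep m w ++ rep n w := by
  simp only [rep, List.replicate_add, List.flatten_append]

theorem rep_one (w : List Γ') : rep 1 w = w := by simp [rep]

theorem rep_singleton (n : ℕ) (c : Γ') : rep n [c] = List.replicate n c := by
  induction n with
  | zero => rfl
  | succ n ih => simp [rep, List.replicate_succ]

theorem rep_replicate (n k : ℕ) (c : Γ') :
    rep n (List.replicate k c) = List.replicate (n * k) c := by
  induction n with
  | zero => simp [rep]
  | succ n ih =>
    rw [rep_add, ih, rep_one, ← List.replicate_add]
    congr 1; ring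

theorem length_le_flatMap {α : Type} {l : List α} {a : α} (h : a ∈ l) (f : α → List Γ') :
    (f a).length ≤ (l.flatMap f).length := by
  rw [List.length_flatMap]
  exact List.le_sum_of_mem (List.mem_map_of_mem h)

variable {K : Type} [DecidableEq K] {B : ℕ} {ρ : K → ℕ}

/-- The symbol is the bit `1`. -/
def isOne (c : Γ') : Bool := decide (c = .bit true)

/-- The symbol is a bit. -/
def isBit (c : Γ') : Bool := decide (c ≠ .comma)

theorem Trans.forR_rep {k a : K} {n : ℕ} (w : List Γ') (hka : k ≠ a)
    (ha : ρ a = 0) (hk : ρ k = n) (hB : n ≤ B) :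
    Trans B (Transducer.forR k a (Transducer.emits w)) ρ ρ [] (rep n w) :=
  (Trans.forR_emits (List.range n) w hka ha (by simpa using hk) (by simpa using hB)).congr rfl
    (flatMap_eq_rep (by simp) fun _ _ => rfl) rfl

/-- Read a unary number and run `p` as often as it says. -/
def forUnary (p : Cmd K) : Cmd K := .seq (.loop (.top isOne) (.seq .read p)) .read

theorem Trans.forUnary {p : Cmd K} (n : ℕ) (w : List Γ') (ρ : ℕ → K → ℕ) (hB : n ≤ B)
    (hp : ∀ i < n, Trans B p (ρ i) (ρ (i + 1)) [] w) :
    Trans B (forUnary p) (ρ 0) (ρ n) (encUnary n) (rep n w) := by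
  have h := Trans.scan (B := B) (t := isOne) (p := .seq .read p) (List.replicate n (.bit true))
    .comma (fun _ => w) ρ (by simpa using hB) (fun a ha => by simp [List.eq_of_mem_replicate ha, isOne])
    (by simp [isOne]) (fun i hi => by
      simpa using (Trans.read (.bit true)).seq (hp i (by simpa using hi)))
  rw [List.length_replicate] at h
  exact h.congr rfl (flatMap_eq_rep (by simp) fun _ _ => rfl) rfl

/-- Copy a bit. -/
def copyBit : Cmd K :=
  .ite (.top isOne) (.seq .read (.emit (.bit true))) (.seq .read (.emit (.bit false)))

theorem Trans.copyBit (b : Bool) : Trans B copyBit ρ ρ [.bit b] [.bit b] := by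
  cases b
  · exact Trans.ite_false (by simp [isOne]) ((Trans.read _).seq (Trans.emit _))
  · exact Trans.ite_true (by simp [isOne]) ((Trans.read _).seq (Trans.emit _))

/-- Copy a binary number. -/
def copyBinary : Cmd K := .seq (.seq (.loop (.top isBit) copyBit) .read) (.emit .comma)

theorem Trans.copyBinary (n : ℕ) (hB : (encBinary n).length ≤ B) :
    Trans B copyBinary ρ ρ (encBinary n) (encBinary n) := by
  have h := Trans.scan (B := B) (t := isBit) (p := Transducer.copyBit)
    ((encodeNat n).map .bit) .comma (fun c => [c]) (fun _ => ρ)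
    (by simp [encBinary] at hB ⊢; omega)
    (by intro a ha; obtain ⟨b, -, rfl⟩ := List.mem_map.1 ha; simp [isBit]) (by simp [isBit])
    (fun i hi => by simpa using Trans.copyBit _)
  exact (h.seq (Trans.emit .comma)).congr (by simp [encBinary]) (by simp [encBinary]) rfl

/-- Copy a rational number. -/
def copyRat : Cmd K := .seq copyBit (.seq copyBinary copyBinary)

theorem Trans.copyRat (r : ℚ) (hB : (encRat r).length ≤ B) :
    Trans B copyRat ρ ρ (encRat r) (encRat r) := by
  simp only [encRat, List.length_cons, List.length_append] at hB
  exact (Trans.copyBit _).seq ((Trans.copyBinary _ (by omega)).seq (Trans.copyBinary _ (by omega)))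

/-- Replace a rational number by the pair of its negative part and the negative of its positive
part. -/
def splitRat : Cmd K :=
  .ite (.top isOne)
    (.seq copyRat (emits (encRat 0)))
    (.seq .read (.ite (.top isBit)
      (.seq (emits (encRat 0)) (.seq (.emit (.bit true)) (.seq copyBinary copyBinary)))
      (.seq (.emit (.bit false)) (.seq copyBinary (.seq copyBinary (emits (encRat 0)))))))

/-- A numerator is zero exactly if its code begins with the comma, so one look at the next symbol
tells zero from positive numbers. -/
theorem encodeNat_ne_nil {n : ℕ} (h : n ≠ 0) : encodeNat n ≠ [] := by
  intro h0
  have := decode_encodeNat n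
  rw [h0] at this
  exact h (this.symm.trans (by decide))

theorem encBinary_zero : encBinary 0 = [.comma] := by
  simp [encBinary, encodeNat, encodeNum]

/-- A negative number is its own negative part. For a positive number, changing the sign bit gives
the negative of the positive part. Zero needs a case of its own, since its only code has sign bit
`false`; it has that sign bit in common with positive numbers and is recognised by the comma that
follows. -/
theorem Trans.splitRat (r : ℚ) (hB : (encRat r).length ≤ B) :
    Trans B splitRat ρ ρ (encRat r)
      (encRat (LEMM.part r true) ++ encRat (LEMM.part r false)) := by
  have hB' := hB
  simp only [encRat, List.length_cons, List.length_append] at hB'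
  rcases lt_trichotomy r 0 with h | h | h
  · have h1 : LEMM.part r true = r := min_eq_left h.le
    have h2 : LEMM.part r false = 0 := min_eq_right (by linarith)
    have hx : encRat r = .bit true :: (encBinary r.num.natAbs ++ encBinary r.den) := by
      simp [encRat, Rat.num_neg.2 h]
    rw [h1, h2, hx]
    refine Trans.ite_true (by simp [isOne]) ?_
    rw [← hx]
    exact ((Trans.copyRat r hB).seq (Trans.emits (encRat 0))).congr (by simp) rfl rfl
  · subst h
    have h1 : LEMM.part 0 true = 0 := min_eq_left le_rfl
    have h2 : LEMM.part 0 false = 0 := min_eq_right (by simp)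
    have hx : encRat 0 = .bit false :: (encBinary 0 ++ encBinary 1) := by
      simp [encRat]
    rw [h1, h2]
    conv => arg 5; rw [hx]
    refine Trans.ite_false (by simp [isOne]) ?_
    refine ((Trans.read _).seq (x' := encBinary 0 ++ encBinary 1) (ρ' := ρ) (ρ'' := ρ)
      (y' := encRat 0 ++ encRat 0) ?_).congr rfl rfl rfl
    have hc : encBinary 0 ++ encBinary 1 = .comma :: encBinary 1 := by simp [encBinary_zero]
    rw [hc]
    refine Trans.ite_false (by simp [isBit]) ?_
    rw [← hc]
    rw [hx, List.length_cons, List.length_append] at hB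
    refine ((Trans.emit _).seq ((Trans.copyBinary 0 (by omega)).seq
      ((Trans.copyBinary 1 (by omega)).seq (Trans.emits (encRat 0))))).congr
        (by simp) ?_ rfl
    conv => rhs; arg 1; rw [hx]
    simp
  · have h1 : LEMM.part r true = 0 := min_eq_right h.le
    have h2 : LEMM.part r false = -r := min_eq_left (by linarith)
    have hn : 0 < r.num := Rat.num_pos.2 h
    have hx : encRat r = .bit false :: (encBinary r.num.natAbs ++ encBinary r.den) := by
      simp [encRat, h.le]
    have hy : encRat (-r) = .bit true :: (encBinary r.num.natAbs ++ encBinary r.den) := by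
      simp [encRat, hn]
    rw [h1, h2, hx, hy]
    refine Trans.ite_false (by simp [isOne]) ?_
    refine ((Trans.read _).seq (x' := encBinary r.num.natAbs ++ encBinary r.den) (ρ' := ρ)
      (ρ'' := ρ) ?_).congr rfl (List.nil_append _) rfl
    obtain ⟨b, l, hl⟩ : ∃ b l, encodeNat r.num.natAbs = b :: l :=
      List.exists_cons_of_ne_nil (encodeNat_ne_nil (by rw [Int.natAbs_ne_zero]; omega))
    have hc : encBinary r.num.natAbs ++ encBinary r.den =
        .bit b :: (l.map .bit ++ [.comma] ++ encBinary r.den) := by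
      simp [encBinary, hl]
    rw [hc]
    refine Trans.ite_true (by simp [isBit]) ?_
    rw [← hc]
    exact ((Trans.emits (encRat 0)).seq ((Trans.emit _).seq
      ((Trans.copyBinary r.num.natAbs (by omega)).seq (Trans.copyBinary r.den (by omega))))).congr (by simp) (by simp) rfl

end Transducer

/-! ### The program for the reduction to min-only systems -/

namespace Transducer

/-- The counters of the program: two copies of the numbers of min, max and affine variables, the
numbers of remaining and of finished variables, and an auxiliary counter. -/
inductive LReg
  | c1 | d1 | c2 | d2 | c3 | d3 | cn | dn | ax
  deriving DecidableEq

instance : Fintype LReg where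
  elems := {.c1, .d1, .c2, .d2, .c3, .d3, .cn, .dn, .ax}
  complete k := by cases k <;> simp

/-- The values of the counters. -/
def lregs (c1 d1 c2 d2 c3 d3 cn dn ax : ℕ) : LReg → ℕ
  | .c1 => c1 | .d1 => d1 | .c2 => c2 | .d2 => d2 | .c3 => c3 | .d3 => d3
  | .cn => cn | .dn => dn | .ax => ax

/-- Read the dimensions and write the new dimensions. -/
def dimsCmd : Cmd LReg :=
  seqs [forUnary (seqs [.inc .c1, .inc .d1, .inc .cn, .emit (.bit true)]),
    forUnary (seqs [.inc .c2, .inc .d2, .inc .cn, .emit (.bit true)]),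
    emits [.comma, .comma],
    forUnary (seqs [.inc .c3, .inc .d3, .inc .cn, .emit (.bit true)]),
    .emit (.bit true),
    forR .cn .ax (emits [.bit true, .bit true]),
    emits [.bit true, .bit true, .comma]]

/-- Translate a bit of an index set. -/
def maskBitCmd (w : List Γ') : Cmd LReg :=
  .ite (.top isOne) (.seq .read (emits w)) (.seq .read (emits [.bit false, .bit false]))

/-- Translate an index set. -/
def maskCmd (w : List Γ') : Cmd LReg :=
  seqs [forR .cn .ax (emits [.bit false]), emits [.bit false],
    forR .cn .ax (maskBitCmd w), emits [.bit false, .bit false]]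

/-- Translate an affine equation. -/
def affineCmd : Cmd LReg :=
  seqs [forR .cn .ax (emits (encRat 0)), emits (encRat 0),
    forR .cn .ax splitRat, splitRat, emits (encRat 0)]

/-- Write the equation of the constant `1`. -/
def oneCmd : Cmd LReg :=
  seqs [forR .cn .ax (emits (encRat 0)), emits (encRat 0),
    forR .cn .ax (emits (encRat 0 ++ encRat 0)), emits (encRat 0 ++ encRat 0), emits (encRat 1)]

/-- Write the equation of a copy of a variable. -/
def unitCmd (r : ℚ) : Cmd LReg :=
  seqs [forR .dn .ax (emits (encRat 0)), emits (encRat r), forR .cn .ax (emits (encRat 0)),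
    forR .dn .ax (emits (encRat 0 ++ encRat 0)), forR .cn .ax (emits (encRat 0 ++ encRat 0)),
    emits (encRat 0 ++ encRat 0), emits (encRat 0)]

/-- Write the equations of the copies of all variables of one kind. -/
def copiesCmd (k : LReg) (r : ℚ) : Cmd LReg :=
  .loop (.pos k) (seqs [.dec k, unitCmd r, unitCmd (-r), .dec .cn, .inc .dn])

/-- Translate the query. -/
def queryCmd : Cmd LReg :=
  seqs [forR .dn .ax (emits [.bit true]), emits [.bit true],
    forUnary (emits [.bit true, .bit true]), emits [.comma], copyRat, clearC .dn]

/-- The program of the reduction to min-only systems. -/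
def lemmCmd : Cmd LReg :=
  seqs [dimsCmd, forC .c1 (maskCmd [.bit true, .bit false]),
    forC .c2 (maskCmd [.bit false, .bit true]), forC .c3 affineCmd, oneCmd,
    copiesCmd .d1 1, copiesCmd .d2 (-1), copiesCmd .d3 1, unitCmd 1, unitCmd (-1), queryCmd]

/-! ### Correctness of the programs that write the signed system. -/

variable {B : ℕ}

/-- No comma is written between the first two numbers, so their unary codes merge into that of n₁ +
n₂. Of the two commas that follow, one closes this number and the other is the code of 0. The
additional variable accounts for one more equation of its own and two more copies. -/
theorem trans_dimsCmd (n₁ n₂ m : ℕ) (hB : n₁ + n₂ + m ≤ B) :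
    Trans B dimsCmd (fun _ => 0) (lregs n₁ n₁ n₂ n₂ m m (n₁ + n₂ + m) 0 0)
      (encUnary n₁ ++ (encUnary n₂ ++ encUnary m))
      (encUnary (n₁ + n₂) ++ (encUnary 0 ++ encUnary (m + (1 + (n₁ + n₂ + m + 1) * 2)))) := by
  have h1 := Trans.forUnary (B := B) (p := seqs [.inc .c1, .inc .d1, .inc .cn, .emit (.bit true)])
    n₁ [.bit true] (fun i => lregs i i 0 0 0 0 i 0 0) (by omega) (fun i _ =>
      ((Trans.inc _).seq ((Trans.inc _).seq ((Trans.inc _).seq ((Trans.emit _).seq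
        Trans.skip)))).congr rfl rfl (by funext k; cases k <;> rfl))
  have h2 := Trans.forUnary (B := B) (p := seqs [.inc .c2, .inc .d2, .inc .cn, .emit (.bit true)])
    n₂ [.bit true] (fun i => lregs n₁ n₁ i i 0 0 (n₁ + i) 0 0) (by omega) (fun i _ =>
      ((Trans.inc _).seq ((Trans.inc _).seq ((Trans.inc _).seq ((Trans.emit _).seq
        Trans.skip)))).congr rfl rfl (by funext k; cases k <;> rfl))
  have h3 := Trans.forUnary (B := B) (p := seqs [.inc .c3, .inc .d3, .inc .cn, .emit (.bit true)])
    m [.bit true] (fun i => lregs n₁ n₁ n₂ n₂ i i (n₁ + n₂ + i) 0 0) (by omega) (fun i _ =>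
      ((Trans.inc _).seq ((Trans.inc _).seq ((Trans.inc _).seq ((Trans.emit _).seq
        Trans.skip)))).congr rfl rfl (by funext k; cases k <;> rfl))
  have h0 : (fun _ => 0 : LReg → ℕ) = lregs 0 0 0 0 0 0 0 0 0 := by funext k; cases k <;> rfl
  rw [h0]
  refine (h1.seq (h2.seq ((Trans.emits _).seq (h3.seq ((Trans.emit _).seq
    ((Trans.forR_rep (ρ := lregs n₁ n₁ n₂ n₂ m m (n₁ + n₂ + m) 0 0)
      (k := .cn) (a := .ax) (n := n₁ + n₂ + m) _ (by decide) rfl rfl hB).seq ((Trans.emits _).seq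
      Trans.skip))))))).congr (by simp) ?_ rfl
  simp only [encUnary, rep_singleton]
  have : rep (n₁ + n₂ + m) [.bit true, .bit true] = List.replicate ((n₁ + n₂ + m) * 2) (.bit true) :=
    rep_replicate _ 2 _
  rw [this]
  have e : m + (1 + (n₁ + n₂ + m + 1) * 2) = m + (1 + ((n₁ + n₂ + m) * 2 + 2)) := by ring
  rw [e]
  simp only [List.replicate_add]
  simp [-List.replicate_append_replicate]

variable (L : LEMM)

theorem length_list (n₁ n₂ m : ℕ) : (LEMMVar.list n₁ n₂ m).length = n₁ + n₂ + m := by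
  simp [LEMMVar.list, add_assoc]

/-- Handle all variables and the additional one. -/
theorem trans_forR_optList {ρ : LReg → ℕ} {n : ℕ} {p p' : Cmd LReg}
    {e : L.Var → List Γ'} {x : List Γ'} {e' : Option L.Var → List Γ'}
    (hn : n = L.n₁ + L.n₂ + L.m) (hcn : ρ .cn = n) (hax : ρ .ax = 0) (hB : n ≤ B)
    (hp : ∀ v, ∀ ρ', Trans B p ρ' ρ' (e v) (e' (some v)))
    (hp' : Trans B p' ρ ρ x (e' none)) :
    Trans B (.seq (forR .cn .ax p) p') ρ ρ
      ((LEMMVar.list L.n₁ L.n₂ L.m).flatMap e ++ x) (L.optList.flatMap e') := by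
  have h := Trans.forR (B := B) (ρ := ρ) (k := .cn) (a := .ax) (LEMMVar.list L.n₁ L.n₂ L.m)
    (e := e) (e' := fun v => e' (some v)) (by decide) hax (by rw [length_list, hcn, hn])
    (by rw [length_list]; omega) (fun v _ => hp v)
  exact (h.seq hp').congr rfl (by simp [LEMM.optList, List.flatMap_map]) rfl

/-- `seqs` nests to the right, whereas `trans_forR_optList` treats a loop together with the command
that handles `none` as one unit. -/
theorem Trans.seq_assoc {p q r : Cmd LReg} {ρ ρ' : LReg → ℕ} {x y : List Γ'}
    (h : Trans B (.seq (.seq p q) r) ρ ρ' x y) : Trans B (.seq p (.seq q r)) ρ ρ' x y := by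
  intro i o
  obtain ⟨u, ⟨v, h1, h2⟩, h3⟩ := h i o
  exact ⟨v, h1, u, h2, h3⟩

/-- Base variables never belong to an index set, which gives the first block of zeros. In the second
block `w` marks one copy of each chosen variable: the positive copy for a min variable, the negative
copy for a max variable. The additional variable is never chosen. -/
theorem trans_maskCmd {ρ : LReg → ℕ} {n : ℕ} (w : List Γ') (J : Finset L.Var)
    (hn : n = L.n₁ + L.n₂ + L.m) (hcn : ρ .cn = n) (hax : ρ .ax = 0) (hB : n ≤ B) :
    Trans B (maskCmd w) ρ ρ (encMask J) (L.optList.flatMap (fun _ => [.bit false]) ++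
      L.optList.flatMap (fun u => if u.elim false (fun v => decide (v ∈ J)) then w else [.bit false, .bit false])) := by
  have h1 := trans_forR_optList (B := B) L (ρ := ρ) (p := emits [.bit false])
    (p' := emits [.bit false]) (e := fun _ => []) (e' := fun _ => [.bit false]) hn hcn hax hB
    (fun v ρ' => Trans.emits _) (Trans.emits _)
  have h2 := trans_forR_optList (B := B) L (ρ := ρ) (p := maskBitCmd w)
    (p' := emits [.bit false, .bit false]) (x := []) (e := fun v => [.bit (decide (v ∈ J))])
    (e' := fun u => if u.elim false (fun v => decide (v ∈ J)) then w else [.bit false, .bit false]) hn hcn hax hB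
    (fun v ρ' => by
      by_cases hv : v ∈ J
      · simp only [hv, decide_true, Option.elim, if_true]
        exact Trans.ite_true (by simp [isOne]) ((Trans.read _).seq (Trans.emits _))
      · simp only [hv, decide_false, Option.elim, Bool.false_eq_true, if_false]
        exact Trans.ite_false (by simp [isOne]) ((Trans.read _).seq (Trans.emits _)))
    (by simpa using Trans.emits _)
  have := Trans.seq_assoc (h1.seq (Trans.seq_assoc (h2.seq Trans.skip)))
  exact this.congr (by simp [encMask]) (by simp) rfl

/-- The constant follows the coefficients in the input, at the very place of `none` in `optList`, so
it is split like one more coefficient. The final zero is the new constant. -/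
theorem trans_affineCmd {ρ : LReg → ℕ} {n : ℕ} (k : Fin L.m)
    (hn : n = L.n₁ + L.n₂ + L.m) (hcn : ρ .cn = n) (hax : ρ .ax = 0) (hB : n ≤ B)
    (hk : ∀ v, (encRat (L.coeff k v)).length ≤ B) :
    Trans B affineCmd ρ ρ
      ((LEMMVar.list L.n₁ L.n₂ L.m).flatMap (fun v => encRat (L.q k v)) ++ encRat (L.b k))
      (L.optList.flatMap (fun _ => encRat 0) ++
        (L.optList.flatMap (fun u => encRat (LEMM.part (L.coeff k u) true) ++
          encRat (LEMM.part (L.coeff k u) false)) ++ encRat 0)) := by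
  have h1 := trans_forR_optList (B := B) L (ρ := ρ) (p := emits (encRat 0))
    (p' := emits (encRat 0)) (e := fun _ => []) (e' := fun _ => encRat 0) hn hcn hax hB
    (fun v ρ' => Trans.emits _) (Trans.emits _)
  have h2 := trans_forR_optList (B := B) L (ρ := ρ) (p := splitRat)
    (p' := splitRat) (e := fun v => encRat (L.q k v)) (x := encRat (L.b k))
    (e' := fun u => encRat (LEMM.part (L.coeff k u) true) ++
          encRat (LEMM.part (L.coeff k u) false)) hn hcn hax hB
    (fun v ρ' => Trans.splitRat _ (hk (some v))) (Trans.splitRat _ (hk none))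
  have := Trans.seq_assoc (h1.seq (Trans.seq_assoc (h2.seq ((Trans.emits (encRat 0)).seq
    Trans.skip))))
  exact this.congr (by simp) (by simp) rfl

theorem trans_oneCmd {ρ : LReg → ℕ} {n : ℕ}
    (hn : n = L.n₁ + L.n₂ + L.m) (hcn : ρ .cn = n) (hax : ρ .ax = 0) (hB : n ≤ B) :
    Trans B oneCmd ρ ρ [] (L.optList.flatMap (fun _ => encRat 0) ++
        (L.optList.flatMap (fun _ => encRat 0 ++ encRat 0) ++ encRat 1)) := by
  have h1 := trans_forR_optList (B := B) L (ρ := ρ) (p := emits (encRat 0))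
    (p' := emits (encRat 0)) (e := fun _ => []) (e' := fun _ => encRat 0) hn hcn hax hB
    (fun v ρ' => Trans.emits _) (Trans.emits _)
  have h2 := trans_forR_optList (B := B) L (ρ := ρ) (p := emits (encRat 0 ++ encRat 0))
    (p' := emits (encRat 0 ++ encRat 0)) (e := fun _ => []) (e' := fun _ => encRat 0 ++ encRat 0)
    hn hcn hax hB (fun v ρ' => Trans.emits _) (Trans.emits _)
  have := Trans.seq_assoc (h1.seq (Trans.seq_assoc (h2.seq ((Trans.emits (encRat 1)).seq
    Trans.skip))))
  exact this.congr (by simp) (by simp) rfl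

/-- The equation `± x_u`, where `u` is the variable with number `a`. -/
def unitRow (a b : ℕ) (r : ℚ) : List Γ' :=
  rep a (encRat 0) ++ (encRat r ++ (rep b (encRat 0) ++ (rep (a + b + 1) (encRat 0 ++ encRat 0) ++
    encRat 0)))

theorem trans_unitCmd {ρ : LReg → ℕ} {a b : ℕ} (r : ℚ) (ha : ρ .dn = a) (hb : ρ .cn = b)
    (hax : ρ .ax = 0) (hB : a + b ≤ B) : Trans B (unitCmd r) ρ ρ [] (unitRow a b r) := by
  refine ((Trans.forR_rep _ (by decide) hax ha (by omega)).seq ((Trans.emits _).seq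
    ((Trans.forR_rep _ (by decide) hax hb (by omega)).seq
    ((Trans.forR_rep _ (by decide) hax ha (by omega)).seq
    ((Trans.forR_rep _ (by decide) hax hb (by omega)).seq ((Trans.emits _).seq
    ((Trans.emits _).seq Trans.skip))))))).congr (by simp) ?_ rfl
  simp [unitRow, rep_add, rep_one]

/-- The position of a variable, where the additional variable is the last one. -/
def optPos : Option L.Var → ℕ
  | some v => v.pos
  | none => L.n₁ + L.n₂ + L.m

theorem map_pos_list (n₁ n₂ m : ℕ) :
    (LEMMVar.list n₁ n₂ m).map LEMMVar.pos = List.range (n₁ + n₂ + m) := by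
  have h : ∀ (n : ℕ) (f : ℕ → ℕ), (List.finRange n).map (fun i : Fin n => f i) = (List.range n).map f := by
    intro n f
    rw [← List.map_coe_finRange_eq_range, List.map_map]
    rfl
  simp only [LEMMVar.list, List.map_append, List.map_map, Function.comp_def, LEMMVar.pos]
  rw [List.range_add, List.range_add, List.map_coe_finRange_eq_range, h n₂ (n₁ + ·), h m (fun k => n₁ + (n₂ + k))]
  simp [add_assoc]

theorem map_optPos_optList :
    L.optList.map (optPos L) = List.range (L.n₁ + L.n₂ + L.m + 1) := by
  rw [List.range_succ, ← map_pos_list]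
  simp [LEMM.optList, optPos, Function.comp_def]

theorem pos_lt {n₁ n₂ m : ℕ} (v : LEMMVar n₁ n₂ m) : v.pos < n₁ + n₂ + m := by
  rcases v with i | j | k <;> simp only [LEMMVar.pos] <;> omega

theorem optPos_le (v : Option L.Var) : optPos L v ≤ L.n₁ + L.n₂ + L.m := by
  rcases v with _ | v
  · exact le_rfl
  · exact (pos_lt v).le

theorem optPos_injective : Function.Injective (optPos L) := by
  rintro (_ | u) (_ | v) h
  · rfl
  · exact absurd h.symm (pos_lt v).ne
  · exact absurd h (pos_lt u).ne
  · exact congrArg some (LEMMVar.pos_injective h)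

theorem range_flatMap_ite (n j : ℕ) (hj : j ≤ n) (w z : List Γ') :
    (List.range (n + 1)).flatMap (fun i => if i = j then w else z) =
      rep j z ++ (w ++ rep (n - j) z) := by
  have : n + 1 = j + (1 + (n - j)) := by omega
  rw [this, List.range_add, List.range_add, List.flatMap_append, List.map_append,
    List.flatMap_append]
  congr 1
  · exact flatMap_eq_rep (by simp) fun i hi => if_neg (by simp at hi; omega)
  · congr 1
    · simp
    · rw [List.flatMap_map, List.flatMap_map]
      exact flatMap_eq_rep (by simp) fun i hi => if_neg (by simp)

theorem flatMap_optList_ite (v : Option L.Var) (r : ℚ) :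
    L.optList.flatMap (fun u => encRat (if u = v then r else 0)) =
      rep (optPos L v) (encRat 0) ++ (encRat r ++
        rep (L.n₁ + L.n₂ + L.m - optPos L v) (encRat 0)) := by
  rw [← range_flatMap_ite _ _ (optPos_le L v), ← map_optPos_optList, List.flatMap_map]
  refine List.flatMap_congr fun u _ => ?_
  simp only [(optPos_injective L).eq_iff]
  split_ifs <;> rfl

theorem length_optList : L.optList.length = L.n₁ + L.n₂ + L.m + 1 := by
  simp [LEMM.optList, length_list]

/-- The equation of a copy of a variable. -/
theorem copyRow_eq (v : Option L.Var) (r : ℚ) :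
    L.optList.flatMap (fun u => encRat (if u = v then r else 0)) ++
      (L.optList.flatMap (fun _ => encRat 0 ++ encRat 0) ++ encRat 0) =
    unitRow (optPos L v) (L.n₁ + L.n₂ + L.m - optPos L v) r := by
  have := optPos_le L v
  rw [flatMap_optList_ite, flatMap_const_eq_rep, length_optList, unitRow,
    show optPos L v + (L.n₁ + L.n₂ + L.m - optPos L v) + 1 = L.n₁ + L.n₂ + L.m + 1 by omega]
  simp

/-- Here `s` counts the variables of earlier kinds. In round `i` the counters `dn` and `cn` hold the
numbers of entries before and after the marked one in the first block of the row; the count after it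
includes the entry of `none`. The family `ρ` is left abstract so that one proof serves all three
kinds of variables. -/
theorem trans_copiesCmd (k : LReg) (r : ℚ) (N s n : ℕ) (ρ : ℕ → LReg → ℕ) (hN : N ≤ B) (hn : n ≤ B)
    (hs : s + N ≤ n)
    (hk : ∀ i, ρ i k = N - i) (hcn : ∀ i, ρ i .cn = n - (s + i)) (hdn : ∀ i, ρ i .dn = s + i)
    (hax : ∀ i, ρ i .ax = 0) (hk1 : k ≠ .cn) (hk2 : k ≠ .dn) (hk3 : k ≠ .ax)
    (hρ : ∀ i j, j ≠ k → j ≠ .cn → j ≠ .dn → ρ (i + 1) j = ρ i j) :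
    Trans B (copiesCmd k r) (ρ 0) (ρ N) [] ((List.finRange N).flatMap fun i : Fin N =>
      unitRow (s + i) (n - (s + i)) r ++ unitRow (s + i) (n - (s + i)) (-r)) := by
  have h := Trans.loop_pos (B := B)
    (p := seqs [.dec k, unitCmd r, unitCmd (-r), .dec .cn, .inc .dn]) k (List.finRange N)
    (fun _ => []) (fun i : Fin N => unitRow (s + i) (n - (s + i)) r ++ unitRow (s + i) (n - (s + i)) (-r))
    ρ (by simpa using hN) (fun i hi => by simp at hi; rw [hk]; omega) (by simp [hk])
    (fun i hi => by
      simp only [List.length_finRange] at hi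
      have e : ((List.finRange N)[i] : ℕ) = i := by simp
      simp only [e]
      refine ((Trans.dec k).seq ((trans_unitCmd (a := s + i) (b := n - (s + i)) r ?_ ?_ ?_ ?_).seq
        ((trans_unitCmd (a := s + i) (b := n - (s + i)) (-r) ?_ ?_ ?_ ?_).seq
        ((Trans.dec .cn).seq ((Trans.inc .dn).seq Trans.skip))))).congr rfl
          (by rw [List.append_nil, List.append_nil, List.append_nil, List.nil_append]) ?_
      · simp [Ne.symm hk2, hdn]
      · simp [Ne.symm hk1, hcn]
      · simp [Ne.symm hk3, hax]
      · omega
      · simp [Ne.symm hk2, hdn]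
      · simp [Ne.symm hk1, hcn]
      · simp [Ne.symm hk3, hax]
      · omega
      · funext j
        by_cases h1 : j = k
        · subst h1; simp [hk1, hk2, hk]; omega
        · by_cases h2 : j = .cn
          · subst h2; simp [h1, hcn]; omega
          · by_cases h3 : j = .dn
            · subst h3; simp [h1, hdn]; omega
            · simp [h1, h2, h3, hρ])
  simpa [flatMap_nil_fun, copiesCmd] using h

theorem trans_queryCmd (n p : ℕ) (β : ℚ) (hn : n ≤ B) (hp : p ≤ B) (hβ : (encRat β).length ≤ B) :
    Trans B queryCmd (lregs 0 0 0 0 0 0 0 n 0) (fun _ => 0) (encUnary p ++ encRat β)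
      (encUnary (n + 1 + p * 2) ++ encRat β) := by
  have h := Trans.forUnary (B := B) (p := emits [.bit true, .bit true]) p
    [.bit true, .bit true] (fun _ => lregs 0 0 0 0 0 0 0 n 0) hp (fun i _ => Trans.emits _)
  refine ((Trans.forR_rep (ρ := lregs 0 0 0 0 0 0 0 n 0) (k := .dn) (a := .ax) (n := n) _ (by decide)
    rfl rfl hn).seq ((Trans.emits _).seq (h.seq
    ((Trans.emits _).seq ((Trans.copyRat β hβ).seq ((Trans.clearC hn).seq
      Trans.skip)))))).congr (by simp) ?_ (by funext k; cases k <;> rfl)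
  have : rep p [.bit true, .bit true] = List.replicate (p * 2) (.bit true) := rep_replicate _ 2 _
  rw [this, rep_singleton]
  simp only [encUnary, List.replicate_add]
  simp

end Transducer

/-! ### The string of the signed system and the complete program. -/

namespace Transducer

variable {B : ℕ} (L : LEMM)

theorem getElem?_flatMap_pair {α β : Type} (l : List α) (f g : α → β) (n : ℕ) :
    (l.flatMap fun a => [f a, g a])[n * 2]? = l[n]?.map f := by
  induction l generalizing n with
  | nil => simp
  | cons a l ih =>
    cases n with
    | zero => simp
    | succ n =>
      rw [Nat.succ_mul]
      simpa using ih n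

theorem getElem?_of_map {α : Type} {l : List α} {f : α → ℕ} {N : ℕ}
    (h : l.map f = List.range N) {a : α} (ha : a ∈ l) : l[f a]? = some a := by
  obtain ⟨i, hi, rfl⟩ := List.getElem_of_mem ha
  have h1 : (l.map f)[i]? = (List.range N)[i]? := by rw [h]
  rw [List.getElem?_map, List.getElem?_eq_getElem hi] at h1
  have hiN : i < N := by
    have := congrArg List.length h
    simp at this; omega
  simp [hiN] at h1
  rw [h1, List.getElem?_eq_getElem hi]

/-- By `signed_all` there are n + 1 base variables, where n is the number of variables of `L`. They
are followed by pairs in which the positive copy comes first. -/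
theorem signed_getElem? (i : L.Var) :
    (L.signed.mins ++ L.signed.affs)[L.n₁ + L.n₂ + L.m + 1 + i.pos * 2]? =
      some (.inr (some i, true)) := by
  have h : L.signed.mins ++ L.signed.affs = _ := L.signed_all
  rw [h, List.getElem?_append_right (by simp [length_optList])]
  simp only [List.length_map, length_optList, Nat.add_sub_cancel_left]
  rw [getElem?_flatMap_pair]
  have := getElem?_of_map (map_optPos_optList L) (L.mem_optList (some i))
  simp only [optPos] at this
  simp [this]

/-- A row of the min-only system. -/
theorem signed_row (F : L.Signed → List Γ') : (L.signed.mins ++ L.signed.affs).flatMap F =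
    L.optList.flatMap (fun u => F (.inl u)) ++
      L.optList.flatMap fun u => F (.inr (u, true)) ++ F (.inr (u, false)) := by
  have h : L.signed.mins ++ L.signed.affs = _ := L.signed_all
  rw [h]
  simp [List.flatMap_map, List.flatMap_assoc]

theorem length_signed_mins : L.signed.mins.length = L.n₁ + L.n₂ := by
  simp [LEMM.signed, LEMM.signedMins]

theorem length_signed_affs :
    L.signed.affs.length = L.m + (1 + (L.n₁ + L.n₂ + L.m + 1) * 2) := by
  simp [LEMM.signed, LEMM.signedAffs, length_optList]
  omega

/-- The string of an index set of the min-only system. -/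
def maskRow (w : L.Signed) : List Γ' :=
  L.optList.flatMap (fun u => [.bit (decide (.inl u ∈ L.signedJ w))]) ++
    L.optList.flatMap fun u => [.bit (decide (.inr (u, true) ∈ L.signedJ w))] ++
      [.bit (decide (.inr (u, false) ∈ L.signedJ w))]

/-- The string of an affine equation of the min-only system. -/
def affineRow (w : L.Signed) : List Γ' :=
  L.optList.flatMap (fun u => encRat (L.signedCoeff w (.inl u))) ++
    (L.optList.flatMap (fun u => encRat (L.signedCoeff w (.inr (u, true))) ++
      encRat (L.signedCoeff w (.inr (u, false)))) ++ encRat (if w = .inl none then 1 else 0))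

theorem maskRow_min (i : Fin L.n₁) : maskRow L (.inl (some (.inl i))) =
    L.optList.flatMap (fun _ => [.bit false]) ++
      L.optList.flatMap (fun u => if u.elim false (fun v => decide (v ∈ L.Jmin i)) then
        [.bit true, .bit false] else [.bit false, .bit false]) := by
  refine congrArg₂ _ (List.flatMap_congr fun u _ => ?_) (List.flatMap_congr fun u _ => ?_)
  · simp [LEMM.signedJ, LEMM.signedCopy_apply]
  · rcases u with _ | v
    · simp [LEMM.signedJ, LEMM.signedCopy_apply]
    · by_cases h : v ∈ L.Jmin i <;> simp [LEMM.signedJ, LEMM.signedCopy_apply, h]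

theorem maskRow_max (j : Fin L.n₂) : maskRow L (.inl (some (.inr (.inl j)))) =
    L.optList.flatMap (fun _ => [.bit false]) ++
      L.optList.flatMap (fun u => if u.elim false (fun v => decide (v ∈ L.Jmax j)) then
        [.bit false, .bit true] else [.bit false, .bit false]) := by
  refine congrArg₂ _ (List.flatMap_congr fun u _ => ?_) (List.flatMap_congr fun u _ => ?_)
  · simp [LEMM.signedJ, LEMM.signedCopy_apply]
  · rcases u with _ | v
    · simp [LEMM.signedJ, LEMM.signedCopy_apply]
    · by_cases h : v ∈ L.Jmax j <;> simp [LEMM.signedJ, LEMM.signedCopy_apply, h]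

theorem affineRow_affine (k : Fin L.m) : affineRow L (.inl (some (.inr (.inr k)))) =
    L.optList.flatMap (fun _ => encRat 0) ++
      (L.optList.flatMap (fun u => encRat (LEMM.part (L.coeff k u) true) ++
        encRat (LEMM.part (L.coeff k u) false)) ++ encRat 0) := by
  simp [affineRow, LEMM.signedCoeff]

theorem affineRow_none : affineRow L (.inl none) = L.optList.flatMap (fun _ => encRat 0) ++
    (L.optList.flatMap (fun _ => encRat 0 ++ encRat 0) ++ encRat 1) := by
  simp [affineRow, LEMM.signedCoeff]

theorem affineRow_copy (v : Option L.Var) (s : Bool) : affineRow L (.inr (v, s)) =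
    unitRow (optPos L v) (L.n₁ + L.n₂ + L.m - optPos L v) (if s then L.sgn v else - L.sgn v) := by
  rw [← copyRow_eq]
  simp [affineRow, LEMM.signedCoeff]

/-- The string of the min-only system. -/
theorem encode_signed (i : L.Var) (β : ℚ) :
    (L.signed.inst (.inr (some i, true)) β).encode =
      encUnary (L.n₁ + L.n₂) ++ (encUnary 0 ++
        encUnary (L.m + (1 + (L.n₁ + L.n₂ + L.m + 1) * 2))) ++
      ((List.finRange L.n₁).flatMap (fun i => L.optList.flatMap (fun _ => [.bit false]) ++
        L.optList.flatMap (fun u => if u.elim false (fun v => decide (v ∈ L.Jmin i)) then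
          [.bit true, .bit false] else [.bit false, .bit false])) ++
      ((List.finRange L.n₂).flatMap (fun j => L.optList.flatMap (fun _ => [.bit false]) ++
        L.optList.flatMap (fun u => if u.elim false (fun v => decide (v ∈ L.Jmax j)) then
          [.bit false, .bit true] else [.bit false, .bit false])) ++
      ((List.finRange L.m).flatMap (fun k => L.optList.flatMap (fun _ => encRat 0) ++
        (L.optList.flatMap (fun u => encRat (LEMM.part (L.coeff k u) true) ++
          encRat (LEMM.part (L.coeff k u) false)) ++ encRat 0)) ++
      ((L.optList.flatMap (fun _ => encRat 0) ++
        (L.optList.flatMap (fun _ => encRat 0 ++ encRat 0) ++ encRat 1)) ++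
      (L.optList.flatMap (fun v =>
        unitRow (optPos L v) (L.n₁ + L.n₂ + L.m - optPos L v) (L.sgn v) ++
        unitRow (optPos L v) (L.n₁ + L.n₂ + L.m - optPos L v) (- L.sgn v)) ++
      (encUnary (L.n₁ + L.n₂ + L.m + 1 + i.pos * 2) ++ encRat β)))))) := by
  have h1 : ∀ w, (L.signed.mins ++ L.signed.affs).flatMap
      (fun u => [.bit (decide (u ∈ L.signed.J w))]) = maskRow L w := fun w => signed_row L _
  have h2 : ∀ w, (L.signed.mins ++ L.signed.affs).flatMap (fun u => encRat (L.signed.q w u)) ++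
      encRat (L.signed.b w) = affineRow L w := by
    intro w
    rw [signed_row, List.append_assoc]
    rfl
  rw [L.signed.encode_inst (signed_getElem? L i), length_signed_mins, length_signed_affs]
  simp only [h1, h2]
  have hmins : L.signed.mins = L.signedMins := rfl
  have haffs : L.signed.affs = L.signedAffs := rfl
  rw [hmins, haffs, LEMM.signedMins, LEMM.signedAffs]
  simp only [List.flatMap_append, List.flatMap_map, List.append_assoc, List.flatMap_cons,
    List.flatMap_nil, List.flatMap_assoc, maskRow_min, maskRow_max, affineRow_affine,
    affineRow_none, affineRow_copy, List.append_nil, if_true,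
    Bool.false_eq_true, if_false]

/-- All dimensions and the queried index are unary and every rational is written out, so the length
of the input bounds every loop. The dimensions are stored twice, because the pass over the given
equations and the pass over the copies each consume one set of counters. -/
theorem trans_lemmCmd (I : LEMMInstance) :
    Trans I.encode.length lemmCmd (fun _ => 0) (fun _ => 0) I.encode
      (I.L.signed.inst (.inr (some I.i, true)) I.β).encode := by
  obtain ⟨L, i, β⟩ := I
  generalize hB : (LEMMInstance.encode ⟨L, i, β⟩).length = B
  have hlen := hB
  simp only [LEMMInstance.encode, List.length_append, encUnary, List.length_replicate,
    List.length_cons, List.length_nil] at hlen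
  have hn : L.n₁ + L.n₂ + L.m ≤ B := by omega
  have hpos := pos_lt i
  have hcoeff : ∀ k v, (encRat (L.coeff k v)).length ≤ B := by
    intro k v
    have h1 := length_le_flatMap (List.mem_finRange k) (fun k =>
      (LEMMVar.list L.n₁ L.n₂ L.m).flatMap (fun v => encRat (L.q k v)) ++ encRat (L.b k))
    simp only [List.length_append] at h1
    rcases v with _ | v
    · simp only [LEMM.coeff]; omega
    · have h2 := length_le_flatMap (LEMMVar.mem_list v) (fun v => encRat (L.q k v))
      simp only [LEMM.coeff]; omega
  have hβ : (encRat β).length ≤ B := by omega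
  rw [encode_signed]
  have hout : L.optList.flatMap (fun v =>
        unitRow (optPos L v) (L.n₁ + L.n₂ + L.m - optPos L v) (L.sgn v) ++
        unitRow (optPos L v) (L.n₁ + L.n₂ + L.m - optPos L v) (- L.sgn v)) =
      ((List.finRange L.n₁).flatMap fun i : Fin L.n₁ =>
        unitRow (0 + i) (L.n₁ + L.n₂ + L.m - (0 + i)) 1 ++
        unitRow (0 + i) (L.n₁ + L.n₂ + L.m - (0 + i)) (-1)) ++
      (((List.finRange L.n₂).flatMap fun i : Fin L.n₂ =>
        unitRow (L.n₁ + i) (L.n₁ + L.n₂ + L.m - (L.n₁ + i)) (-1) ++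
        unitRow (L.n₁ + i) (L.n₁ + L.n₂ + L.m - (L.n₁ + i)) (-(-1))) ++
      (((List.finRange L.m).flatMap fun i : Fin L.m =>
        unitRow (L.n₁ + L.n₂ + i) (L.n₁ + L.n₂ + L.m - (L.n₁ + L.n₂ + i)) 1 ++
        unitRow (L.n₁ + L.n₂ + i) (L.n₁ + L.n₂ + L.m - (L.n₁ + L.n₂ + i)) (-1)) ++
      (unitRow (L.n₁ + L.n₂ + L.m) 0 1 ++ unitRow (L.n₁ + L.n₂ + L.m) 0 (-1)))) := by
    simp only [LEMM.optList, LEMMVar.list, List.map_append, List.map_map, List.flatMap_append,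
      List.flatMap_map, List.append_assoc, Function.comp_def, optPos, LEMMVar.pos, LEMM.sgn,
      List.flatMap_cons, List.flatMap_nil, List.append_nil, zero_add, Nat.sub_self, add_assoc]
  rw [hout]
  set n := L.n₁ + L.n₂ + L.m with hndef
  have t0 := trans_dimsCmd (B := B) L.n₁ L.n₂ L.m hn
  rw [← hndef] at t0
  have t1 := Trans.forC (B := B) (ρ := lregs L.n₁ L.n₁ L.n₂ L.n₂ L.m L.m n 0 0) (k := .c1)
    (List.finRange L.n₁) (by simp [lregs]) (by simp; omega) (fun i _ j =>
      trans_maskCmd (B := B) L [.bit true, .bit false] (L.Jmin i) hndef (by simp [lregs])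
        (by simp [lregs]) hn)
  have t2 := Trans.forC (B := B) (ρ := lregs 0 L.n₁ L.n₂ L.n₂ L.m L.m n 0 0) (k := .c2)
    (List.finRange L.n₂) (by simp [lregs]) (by simp; omega) (fun i _ j =>
      trans_maskCmd (B := B) L [.bit false, .bit true] (L.Jmax i) hndef (by simp [lregs])
        (by simp [lregs]) hn)
  have t3 := Trans.forC (B := B) (ρ := lregs 0 L.n₁ 0 L.n₂ L.m L.m n 0 0) (k := .c3)
    (List.finRange L.m) (by simp [lregs]) (by simp; omega) (fun k _ j =>
      trans_affineCmd (B := B) L k hndef (by simp [lregs]) (by simp [lregs]) hn (hcoeff k))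
  have t4 := trans_oneCmd (B := B) L (ρ := lregs 0 L.n₁ 0 L.n₂ 0 L.m n 0 0) hndef rfl rfl hn
  have t5 := trans_copiesCmd (B := B) .d1 1 L.n₁ 0 n
    (fun i => lregs 0 (L.n₁ - i) 0 L.n₂ 0 L.m (n - (0 + i)) (0 + i) 0) (by omega) hn (by omega)
    (fun _ => rfl) (fun _ => rfl) (fun _ => rfl) (fun _ => rfl) (by decide) (by decide) (by decide)
    (fun i j => by cases j <;> simp [lregs])
  have t6 := trans_copiesCmd (B := B) .d2 (-1) L.n₂ L.n₁ n
    (fun i => lregs 0 0 0 (L.n₂ - i) 0 L.m (n - (L.n₁ + i)) (L.n₁ + i) 0) (by omega) hn (by omega)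
    (fun _ => rfl) (fun _ => rfl) (fun _ => rfl) (fun _ => rfl) (by decide) (by decide) (by decide)
    (fun i j => by cases j <;> simp [lregs])
  have t7 := trans_copiesCmd (B := B) .d3 1 L.m (L.n₁ + L.n₂) n
    (fun i => lregs 0 0 0 0 0 (L.m - i) (n - (L.n₁ + L.n₂ + i)) (L.n₁ + L.n₂ + i) 0) (by omega) hn
    (by omega) (fun _ => rfl) (fun _ => rfl) (fun _ => rfl) (fun _ => rfl) (by decide) (by decide)
    (by decide) (fun i j => by cases j <;> simp [lregs])
  have t8 := fun r => trans_unitCmd (B := B) (ρ := lregs 0 0 0 0 0 0 0 n 0) (a := n) (b := 0) r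
    rfl rfl rfl (by omega)
  have t9 := trans_queryCmd (B := B) n i.pos β hn (by omega) hβ
  have u1 : Function.update (lregs L.n₁ L.n₁ L.n₂ L.n₂ L.m L.m n 0 0) .c1 0 =
      lregs 0 L.n₁ L.n₂ L.n₂ L.m L.m n 0 0 := by funext k; cases k <;> rfl
  have u2 : Function.update (lregs 0 L.n₁ L.n₂ L.n₂ L.m L.m n 0 0) .c2 0 =
      lregs 0 L.n₁ 0 L.n₂ L.m L.m n 0 0 := by funext k; cases k <;> rfl
  have u3 : Function.update (lregs 0 L.n₁ 0 L.n₂ L.m L.m n 0 0) .c3 0 =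
      lregs 0 L.n₁ 0 L.n₂ 0 L.m n 0 0 := by funext k; cases k <;> rfl
  rw [u1] at t1
  rw [u2] at t2
  rw [u3] at t3
  simp only [Nat.sub_zero, Nat.sub_self, Nat.zero_add, Nat.add_zero] at t5 t6 t7
  rw [← hndef, Nat.sub_self] at t7
  refine (t0.seq (t1.seq (t2.seq (t3.seq (t4.seq (t5.seq (t6.seq (t7.seq ((t8 1).seq
    ((t8 (-1)).seq (t9.seq Trans.skip))))))))))).congr ?_ ?_ rfl
  · simp [LEMMInstance.encode]
  · simp only [List.append_assoc, List.append_nil, Nat.zero_add]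

/-- The reduction to min-only systems is computable in polynomial time. -/
theorem computable_signed : Nonempty (Turing.TM2ComputableInPolyTime LEMMInstance.encode
    LEMMInstance.encode fun I => I.L.signed.inst (.inr (some I.i, true)) I.β) :=
  computable_of_trans lemmCmd Polynomial.X fun I => by
    simpa only [Polynomial.eval_X] using trans_lemmCmd I

end Transducer

/-! ### Reachability probabilities -/

/-- Expanding the product of the row sums gives a sum of non-negative terms over all functions ι →
ι; the Leibniz formula uses only the permutations among them. -/
theorem Matrix.abs_det_le_prod_sum {ι : Type} [Fintype ι] [DecidableEq ι] (A : Matrix ι ι ℤ) :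
    |A.det| ≤ ∏ i, ∑ j, |A i j| := by
  rw [← Matrix.det_transpose, Matrix.det_apply']
  refine (Finset.abs_sum_le_sum_abs _ _).trans ?_
  rw [Finset.prod_univ_sum, Fintype.piFinset_univ]
  refine (Finset.sum_congr rfl fun π _ => (?_ : _ = ∏ i, |A i (π i)|)).trans_le ?_
  · rw [abs_mul, Finset.abs_prod]
    rcases Int.units_eq_one_or (Equiv.Perm.sign π) with h | h <;> simp [h]
  rw [← Finset.sum_image (s := Finset.univ) (g := fun π : Equiv.Perm ι => (π : ι → ι))
    (f := fun g : ι → ι => ∏ i, |A i (g i)|) (fun _ _ _ _ h => DFunLike.coe_injective h)]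
  exact Finset.sum_le_sum_of_subset_of_nonneg (Finset.subset_univ _)
    fun _ _ _ => Finset.prod_nonneg fun _ _ => abs_nonneg _

namespace SSG

variable (G : SSG) (σ : G.Strategy .max) (τ : G.Strategy .min)

/-- The expectation of a function after one step. -/
noncomputable def next (f : G.Vertex → ℝ) : G.Vertex → ℝ := (G.transition σ τ).mulVec f

theorem next_inr (f : G.Vertex → ℝ) (s : Bool) : G.next σ τ f (.inr s) = f (.inr s) := by
  simp [next, transition, Matrix.mulVec, dotProduct]

theorem next_max (f : G.Vertex → ℝ) {v : Fin G.N} (h : G.kind v = .max) :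
    G.next σ τ f (.inl v) = f (G.succ v (σ ⟨v, h⟩)) := by
  simp [next, transition, Matrix.mulVec, dotProduct, h]

theorem next_min (f : G.Vertex → ℝ) {v : Fin G.N} (h : G.kind v = .min) :
    G.next σ τ f (.inl v) = f (G.succ v (τ ⟨v, h⟩)) := by
  simp [next, transition, Matrix.mulVec, dotProduct, h]

theorem next_avg (f : G.Vertex → ℝ) {v : Fin G.N} (h : G.kind v = .avg) :
    G.next σ τ f (.inl v) = (f (G.succ v false) + f (G.succ v true)) / 2 := by
  simp [next, transition, Matrix.mulVec, dotProduct, h, add_mul, Finset.sum_add_distrib]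
  ring

theorem next_mono {f g : G.Vertex → ℝ} (h : ∀ u, f u ≤ g u) (u : G.Vertex) :
    G.next σ τ f u ≤ G.next σ τ g u := by
  rcases u with v | s
  · rcases hk : G.kind v
    · simp only [G.next_max σ τ _ hk, h]
    · simp only [G.next_min σ τ _ hk, h]
    · simp only [G.next_avg σ τ _ hk]
      linarith [h (G.succ v false), h (G.succ v true)]
  · simp only [next_inr, h]

/-- Holds because the rows of the transition matrix are probability vectors. The case `a = 0` says
that constants are preserved, which is how bounds on functions are carried through a step. -/
theorem next_affine (a b : ℝ) (f : G.Vertex → ℝ) (u : G.Vertex) :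
    G.next σ τ (fun u => a * f u + b) u = a * G.next σ τ f u + b := by
  rcases u with v | s
  · rcases hk : G.kind v
    · simp only [G.next_max σ τ _ hk]
    · simp only [G.next_min σ τ _ hk]
    · simp only [G.next_avg σ τ _ hk]
      ring
  · simp only [next_inr]

/-- The probability of having reached the 1-sink after `t` steps. -/
noncomputable def reachIn (t : ℕ) (u : G.Vertex) : ℝ := (G.transition σ τ ^ t) u (.inr true)

theorem reachIn_zero (u : G.Vertex) : G.reachIn σ τ 0 u = if u = .inr true then 1 else 0 := by
  simp [reachIn, Matrix.one_apply]

theorem reachIn_succ (t : ℕ) : G.reachIn σ τ (t + 1) = G.next σ τ (G.reachIn σ τ t) := by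
  funext u
  simp only [reachIn, next, pow_succ']
  rfl

theorem reachIn_nonneg (t : ℕ) (u : G.Vertex) : 0 ≤ G.reachIn σ τ t u := by
  induction t generalizing u with
  | zero => rw [reachIn_zero]; split_ifs <;> norm_num
  | succ t ih =>
    have h := G.next_mono σ τ (f := fun u => 0 * G.reachIn σ τ t u + 0) (g := G.reachIn σ τ t)
      (fun u => by simpa using ih u) u
    rw [next_affine] at h
    rw [reachIn_succ]
    linarith

theorem reachIn_le_one (t : ℕ) (u : G.Vertex) : G.reachIn σ τ t u ≤ 1 := by
  induction t generalizing u with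
  | zero => rw [reachIn_zero]; split_ifs <;> norm_num
  | succ t ih =>
    have h := G.next_mono σ τ (f := G.reachIn σ τ t) (g := fun u => 0 * G.reachIn σ τ t u + 1)
      (fun u => by simpa using ih u) u
    rw [next_affine] at h
    rw [reachIn_succ]
    linarith

theorem reachIn_true (t : ℕ) : G.reachIn σ τ t (.inr true) = 1 := by
  induction t with
  | zero => simp [reachIn_zero]
  | succ t ih => rw [reachIn_succ, next_inr, ih]

theorem reachIn_false (t : ℕ) : G.reachIn σ τ t (.inr false) = 0 := by
  induction t with
  | zero => simp [reachIn_zero]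
  | succ t ih => rw [reachIn_succ, next_inr, ih]

theorem reachIn_mono (u : G.Vertex) : Monotone fun t => G.reachIn σ τ t u := by
  refine monotone_nat_of_le_succ fun t => ?_
  induction t generalizing u with
  | zero =>
    rw [reachIn_zero]
    split_ifs with h
    · rw [h, reachIn_true]
    · exact reachIn_nonneg _ _ _ _ _
  | succ t ih =>
    rw [reachIn_succ, reachIn_succ]
    exact next_mono _ _ _ ih u

theorem bddAbove_reachIn (u : G.Vertex) : BddAbove (Set.range fun t => G.reachIn σ τ t u) :=
  ⟨1, by rintro _ ⟨t, rfl⟩; exact reachIn_le_one _ _ _ _ _⟩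

/-- The probability that the 1-sink is reached. -/
noncomputable def reach (u : G.Vertex) : ℝ := ⨆ t, G.reachIn σ τ t u

theorem tendsto_reachIn (u : G.Vertex) :
    Tendsto (fun t => G.reachIn σ τ t u) atTop (𝓝 (G.reach σ τ u)) :=
  tendsto_atTop_ciSup (reachIn_mono _ _ _ _) (bddAbove_reachIn _ _ _ _)

theorem next_reach (u : G.Vertex) : G.next σ τ (G.reach σ τ) u = G.reach σ τ u := by
  have h1 := (tendsto_add_atTop_iff_nat 1).2 (G.tendsto_reachIn σ τ u)
  have h2 : Tendsto (fun t => G.next σ τ (G.reachIn σ τ t) u) atTop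
      (𝓝 (G.next σ τ (G.reach σ τ) u)) := by
    unfold next Matrix.mulVec dotProduct
    exact tendsto_finsetSum _ fun w _ => (G.tendsto_reachIn σ τ w).const_mul _
  refine tendsto_nhds_unique h2 ?_
  simpa only [reachIn_succ] using h1

theorem reach_nonneg (u : G.Vertex) : 0 ≤ G.reach σ τ u :=
  ge_of_tendsto' (G.tendsto_reachIn σ τ u) fun _ => reachIn_nonneg _ _ _ _ _

theorem reach_true : G.reach σ τ (.inr true) = 1 := by
  simp [reach, reachIn_true]

theorem reach_false : G.reach σ τ (.inr false) = 0 := by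
  simp [reach, reachIn_false]

/-- Every positive transition probability is at least 1/2, so a step at worst halves a positive
probability. -/
theorem reachIn_pos_bound (t : ℕ) (u : G.Vertex) (h : 0 < G.reachIn σ τ t u) :
    (1 / 2) ^ t ≤ G.reachIn σ τ t u := by
  induction t generalizing u with
  | zero => rw [reachIn_zero] at *; split_ifs at * <;> simp_all
  | succ t ih =>
    have hp : ((1 : ℝ) / 2) ^ (t + 1) = (1 / 2) ^ t / 2 := by ring
    have hq : (0 : ℝ) < (1 / 2) ^ t := by positivity
    rw [reachIn_succ] at *
    rcases u with v | s
    · rcases hk : G.kind v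
      · rw [G.next_max σ τ _ hk] at *
        linarith [ih _ h]
      · rw [G.next_min σ τ _ hk] at *
        linarith [ih _ h]
      · rw [G.next_avg σ τ _ hk] at *
        have h0 := G.reachIn_nonneg σ τ t (G.succ v false)
        have h1 := G.reachIn_nonneg σ τ t (G.succ v true)
        rcases h0.lt_or_eq with h0 | h0
        · linarith [ih _ h0]
        · linarith [ih (G.succ v true) (by linarith)]
    · rw [next_inr] at *
      linarith [ih _ h]

/-- The support after a step depends on the support before it only. So once the increasing sequence
of supports repeats, it is constant. -/
theorem next_pos_congr {f g : G.Vertex → ℝ} (hf : ∀ u, 0 ≤ f u) (hg : ∀ u, 0 ≤ g u)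
    (h : ∀ u, 0 < f u ↔ 0 < g u) (u : G.Vertex) :
    0 < G.next σ τ f u ↔ 0 < G.next σ τ g u := by
  rcases u with v | s
  · rcases hk : G.kind v
    · simp only [G.next_max σ τ _ hk, h]
    · simp only [G.next_min σ τ _ hk, h]
    · simp only [G.next_avg σ τ _ hk]
      have key : ∀ a b : ℝ, 0 ≤ a → 0 ≤ b → (0 < (a + b) / 2 ↔ 0 < a ∨ 0 < b) := by
        intro a b ha hb
        constructor
        · intro h
          by_contra! hc
          linarith [hc.1, hc.2]
        · rintro (h | h) <;> linarith
      rw [key _ _ (hf _) (hf _), key _ _ (hg _) (hg _), h, h]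
  · simp only [next_inr, h]

/-- The 1-sink is reached within `N + 2` steps with positive probability, if at all. -/
theorem reachIn_pos (u : G.Vertex) (h : 0 < G.reach σ τ u) :
    0 < G.reachIn σ τ (G.N + 2) u := by
  classical
  let A : ℕ → Finset G.Vertex := fun t => Finset.univ.filter fun u => 0 < G.reachIn σ τ t u
  have hA : Monotone A := fun s t hst u hu => by
    simp only [A, Finset.mem_filter, Finset.mem_univ, true_and] at *
    exact hu.trans_le (reachIn_mono _ _ _ _ hst)
  have hstep : ∀ s t, A s = A t → A (s + 1) = A (t + 1) := by
    intro s t hst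
    ext u
    simp only [A, Finset.mem_filter, Finset.mem_univ, true_and, reachIn_succ]
    refine next_pos_congr _ _ _ (reachIn_nonneg _ _ _ _) (reachIn_nonneg _ _ _ _) (fun u => ?_) u
    have := Finset.ext_iff.1 hst u
    simpa [A] using this
  have hcard : ∀ s t, s ≤ t → (A s).card = (A t).card → A s = A t :=
    fun s t hst h => Finset.eq_of_subset_of_card_le (hA hst) h.ge
  obtain ⟨t, ht⟩ : ∃ t, 0 < G.reachIn σ τ t u := by
    by_contra! hc
    have := le_of_tendsto' (G.tendsto_reachIn σ τ u) hc
    linarith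
  -- The supports increase inside a set of N + 2 vertices and stay constant after the first
  -- repetition, so they are constant from time N + 2 on.
  have hstab : (A (t + (G.N + 2))).card = (A (G.N + 2)).card := by
    refine Nat.stabilises_of_monotone (f := fun t => (A t).card)
      (fun s t hst => Finset.card_le_card (hA hst)) (fun m => ?_) (fun m hm => ?_) (by omega)
    · exact (Finset.card_le_univ _).trans_eq (by simp)
    · exact congrArg Finset.card (hstep _ _ (hcard _ _ (by omega) hm))
  have hmem : u ∈ A (t + (G.N + 2)) := hA (by omega : t ≤ _) (by simpa [A] using ht)
  rw [← hcard _ _ (by omega) hstab.symm] at hmem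
  simpa [A] using hmem

/-- Approximate subharmonic functions that are non-positive where the 1-sink is not reached, and at
the 1-sink, are small. -/
theorem le_of_le_next {e : G.Vertex → ℝ} {ε : ℝ} (hε : 0 ≤ ε)
    (h0 : ∀ u, e u ≤ 0 ∨ (0 < G.reach σ τ u ∧ e u ≤ G.next σ τ e u + ε))
    (h1 : e (.inr true) ≤ 0) (u : G.Vertex) :
    e u ≤ (G.N + 2 : ℕ) * ε * 2 ^ (G.N + 2) := by
  obtain ⟨v, -, hv⟩ := Finset.exists_max_image Finset.univ e ⟨.inr true, Finset.mem_univ _⟩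
  have hv : ∀ u, e u ≤ e v := fun u => hv u (Finset.mem_univ _)
  have hr : 0 ≤ ((G.N + 2 : ℕ) : ℝ) * ε * 2 ^ (G.N + 2) := by positivity
  by_cases hE : e v ≤ 0
  · exact ((hv u).trans hE).trans hr
  push Not at hE
  -- Maximum principle: within t steps the mass `reachIn` has been absorbed at the 1-sink, where `e`
  -- is non-positive; the remaining mass contributes at most the maximum `e v`, and each step adds
  -- an error of at most ε. Where `e` is non-positive the bound is trivial.
  have key : ∀ t : ℕ, ∀ u, e u ≤ e v * (1 - G.reachIn σ τ t u) + t * ε := by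
    intro t
    induction t with
    | zero =>
      intro u
      rw [reachIn_zero]
      split_ifs with h
      · simpa [h] using h1
      · simpa using hv u
    | succ t ih =>
      intro u
      have hle := G.reachIn_le_one σ τ (t + 1) u
      rcases h0 u with h | ⟨-, h⟩
      · have : 0 ≤ e v * (1 - G.reachIn σ τ (t + 1) u) := mul_nonneg hE.le (by linarith)
        have : 0 ≤ ((t + 1 : ℕ) : ℝ) * ε := by positivity
        linarith
      · have h2 := G.next_mono σ τ (f := e)
          (g := fun u => (- e v) * G.reachIn σ τ t u + (e v + t * ε))
          (fun u => by linarith [ih u]) u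
        rw [next_affine, ← reachIn_succ] at h2
        push_cast
        linarith
  have hpos : 0 < G.reach σ τ v := by
    rcases h0 v with h | h
    · linarith
    · exact h.1
  have h2 := G.reachIn_pos_bound σ τ _ v (G.reachIn_pos σ τ v hpos)
  have h3 := key (G.N + 2) v
  have h4 : e v * (1 / 2) ^ (G.N + 2) ≤ (G.N + 2 : ℕ) * ε := by
    have := mul_le_mul_of_nonneg_left h2 hE.le
    linarith
  have h5 : e v = e v * (1 / 2) ^ (G.N + 2) * 2 ^ (G.N + 2) := by
    rw [mul_assoc, ← mul_pow]; norm_num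
  refine (hv u).trans ?_
  rw [h5]
  exact mul_le_mul_of_nonneg_right h4 (by positivity)

end SSG

/-! ### Denominators of reachability probabilities and the gap above 1/2. -/

namespace SSG

variable (G : SSG) (σ : G.Strategy .max) (τ : G.Strategy .min)

theorem exists_int_transition (u w : G.Vertex) :
    ∃ z : ℤ, 0 ≤ z ∧ (z : ℝ) = 2 * G.transition σ τ u w := by
  rcases u with v | s
  · simp only [transition, Matrix.of_apply]
    split_ifs
    · exact ⟨2, by norm_num⟩
    · exact ⟨0, by norm_num⟩
    · exact ⟨2, by norm_num⟩
    · exact ⟨0, by norm_num⟩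
    · exact ⟨2, by norm_num⟩
    · exact ⟨1, by norm_num⟩
    · exact ⟨1, by norm_num⟩
    · exact ⟨0, by norm_num⟩
  · simp only [transition, Matrix.of_apply]
    split_ifs
    · exact ⟨2, by norm_num⟩
    · exact ⟨0, by norm_num⟩

theorem sum_transition (u : G.Vertex) : ∑ w, G.transition σ τ u w = 1 := by
  have := G.next_affine σ τ 0 1 (fun _ => 0) u
  simpa [next, Matrix.mulVec, dotProduct] using this

/-- Reachability probabilities are rational numbers with small denominators. -/
theorem exists_int_reach : ∃ D : ℤ, D ≠ 0 ∧ |D| ≤ 4 ^ (G.N + 2) ∧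
    ∀ u, ∃ z : ℤ, D * G.reach σ τ u = z := by
  classical
  choose T hT0 hT using G.exists_int_transition σ τ
  have hTsum : ∀ u, ∑ w, T u w = 2 := by
    intro u
    have : ((∑ w, T u w : ℤ) : ℝ) = 2 := by
      push_cast
      simp only [hT, ← Finset.mul_sum, sum_transition, mul_one]
    exact_mod_cast this
  -- The harmonic equations alone form a singular system, as sinks and other closed classes show. So
  -- they are imposed only on `S`; on all other vertices the value is prescribed.
  let S : G.Vertex → Prop := fun u => u ≠ .inr true ∧ 0 < G.reach σ τ u
  let A : Matrix G.Vertex G.Vertex ℤ :=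
    Matrix.of fun u w => (if u = w then 2 else 0) - if S u then T u w else 0
  have hmul : ∀ x u, (A.map (Int.cast : ℤ → ℝ)).mulVec x u =
      2 * x u - if S u then 2 * G.next σ τ x u else 0 := by
    intro x u
    simp only [A, Matrix.mulVec, dotProduct, Matrix.map_apply, Matrix.of_apply, Int.cast_sub,
      sub_mul, Finset.sum_sub_distrib]
    congr 1
    · simp
    · split_ifs
      · simp only [hT, mul_assoc, ← Finset.mul_sum]
        rfl
      · simp
  have hdet : A.det ≠ 0 := by
    intro h0
    have h1 : (A.map (Int.cast : ℤ → ℝ)).det = 0 := by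
      have := Int.cast_det (R := ℝ) A
      rw [← this, h0, Int.cast_zero]
    obtain ⟨x, hx, hx0⟩ := Matrix.exists_mulVec_eq_zero_iff.2 h1
    have hx1 : ∀ u, x u = if S u then G.next σ τ x u else 0 := by
      intro u
      have := congrFun hx0 u
      rw [hmul] at this
      simp only [Pi.zero_apply] at this
      split_ifs at * <;> linarith
    have hneg : ∀ u, G.next σ τ (fun u => - x u) u = - G.next σ τ x u := by
      intro u
      have := G.next_affine σ τ (-1) 0 x u
      simpa using this
    -- The maximum principle with ε = 0, applied to `x` and to `-x`, shows that the kernel is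
    -- trivial.
    refine hx (funext fun u => le_antisymm ?_ ?_)
    · have := G.le_of_le_next σ τ (e := x) (ε := 0) le_rfl (fun u => ?_) ?_ u
      · simpa using this
      · by_cases hu : S u
        · right; refine ⟨hu.2, ?_⟩; rw [hx1 u, if_pos hu]; simp
        · left; rw [hx1 u, if_neg hu]
      · rw [hx1, if_neg (by simp [S])]
    · have := G.le_of_le_next σ τ (e := fun u => - x u) (ε := 0) le_rfl (fun u => ?_) ?_ u
      · simpa using this
      · by_cases hu : S u
        · right; refine ⟨hu.2, ?_⟩; rw [hneg, hx1 u, if_pos hu]; simp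
        · left; rw [hx1 u, if_neg hu]; simp
      · rw [hx1, if_neg (by simp [S])]; simp
  refine ⟨A.det, hdet, ?_, fun u => ⟨A.adjugate u (.inr true) * 2, ?_⟩⟩
  · refine A.abs_det_le_prod_sum.trans ?_
    have hrow : ∀ u, ∑ w, |A u w| ≤ 4 := by
      intro u
      have h1 : ∀ w, |A u w| ≤ (if u = w then 2 else 0) + T u w := by
        intro w
        have := hT0 u w
        simp only [A, Matrix.of_apply]
        rw [abs_le]
        split_ifs <;> constructor <;> linarith
      refine (Finset.sum_le_sum fun w _ => h1 w).trans ?_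
      rw [Finset.sum_add_distrib, hTsum]
      simp
    calc ∏ u, ∑ w, |A u w| ≤ ∏ _u : G.Vertex, (4 : ℤ) :=
          Finset.prod_le_prod (fun u _ => Finset.sum_nonneg fun w _ => abs_nonneg _)
            fun u _ => hrow u
      _ = 4 ^ (G.N + 2) := by simp
  -- Cramer's rule: the reachability probabilities solve an integral linear system with right-hand
  -- side twice a unit vector, so multiplying by the adjugate makes them integers over the
  -- determinant.
  · have h1 : (A.map (Int.cast : ℤ → ℝ)).mulVec (G.reach σ τ) = Pi.single (.inr true) 2 := by
      funext u
      rw [hmul, next_reach]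
      by_cases hu : u = .inr true
      · subst hu; simp [S, reach_true]
      · by_cases hr : 0 < G.reach σ τ u
        · rw [if_pos ⟨hu, hr⟩]; simp [hu]
        · rw [if_neg (fun h => hr h.2)]
          have : G.reach σ τ u = 0 := le_antisymm (not_lt.1 hr) (reach_nonneg _ _ _ _)
          simp [hu, this]
    have h2 := congrArg (fun x => (A.map (Int.cast : ℤ → ℝ)).adjugate.mulVec x u) h1
    simp only [Matrix.mulVec_mulVec, Matrix.adjugate_mul, Matrix.smul_mulVec, Matrix.one_mulVec,
      Pi.smul_apply, smul_eq_mul, Matrix.mulVec_single] at h2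
    have h3 : (A.map (Int.cast : ℤ → ℝ)).adjugate = A.adjugate.map (Int.cast : ℤ → ℝ) :=
      (RingHom.map_adjugate (Int.castRingHom ℝ) A).symm
    rw [h3] at h2
    have h4 : (A.map (Int.cast : ℤ → ℝ)).det = (A.det : ℝ) := (Int.cast_det (R := ℝ) A).symm
    rw [h4] at h2
    rw [h2]
    simp

/-- If y/|D| > 1/2 for integers, then 2y ≥ |D| + 1, so the excess over 1/2 is at least 1/(2|D|). -/
theorem half_add_le_reach {u : G.Vertex} (h : 1 / 2 < G.reach σ τ u) :
    1 / 2 + 1 / (2 * 4 ^ (G.N + 2)) ≤ G.reach σ τ u := by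
  obtain ⟨D, hD, hle, hz⟩ := G.exists_int_reach σ τ
  obtain ⟨z, hz⟩ := hz u
  set r := G.reach σ τ u
  have hD' : (0 : ℝ) < |(D : ℝ)| := by simpa using hD
  obtain ⟨y, hy⟩ : ∃ y : ℤ, |(D : ℝ)| * r = y := by
    rcases abs_cases (D : ℝ) with ⟨h, -⟩ | ⟨h, -⟩
    · exact ⟨z, by rw [h, hz]⟩
    · exact ⟨-z, by rw [h]; push_cast; linarith⟩
  have h1 : |D| < 2 * y := by
    have : (|D| : ℝ) < 2 * y := by rw [← hy]; nlinarith
    exact_mod_cast this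
  have h2 : (|(D : ℝ)| + 1) ≤ 2 * (|(D : ℝ)| * r) := by
    rw [hy]
    exact_mod_cast h1
  have h3 : |(D : ℝ)| ≤ 4 ^ (G.N + 2) := by exact_mod_cast hle
  have h4 : 1 / (2 * 4 ^ (G.N + 2)) ≤ 1 / (2 * |(D : ℝ)|) :=
    one_div_le_one_div_of_le (by positivity) (by linarith)
  have h5 : 1 / 2 + 1 / (2 * |(D : ℝ)|) ≤ r := by
    rw [div_add_div _ _ two_ne_zero (by positivity), div_le_iff₀ (by positivity)]
    nlinarith
  linarith

/-! ### Discounted values -/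

/-- The optimality equations of the game with discount factor `γ`. -/
noncomputable def bellman (γ : ℝ) (w : G.Vertex → ℝ) : G.Vertex → ℝ
  | .inr true => 1
  | .inr false => 0
  | .inl v => γ * match G.kind v with
    | .max => max (w (G.succ v false)) (w (G.succ v true))
    | .min => min (w (G.succ v false)) (w (G.succ v true))
    | .avg => (w (G.succ v false) + w (G.succ v true)) / 2

/-- Maximum, minimum and average are non-expansive in the supremum norm, so the equations form a
contraction with factor γ and Banach's theorem applies. -/
theorem exists_bellman_eq {γ : ℝ} (h0 : 0 ≤ γ) (h1 : γ < 1) : ∃ w, G.bellman γ w = w := by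
  have hlip : LipschitzWith ⟨γ, h0⟩ (G.bellman γ) := by
    refine LipschitzWith.of_dist_le_mul fun x y => ?_
    have hxy : ∀ u, |x u - y u| ≤ dist x y := fun u => by
      rw [← Real.dist_eq]; exact dist_le_pi_dist x y u
    rw [dist_pi_le_iff (by positivity)]
    rintro (v | (_ | _))
    · rw [Real.dist_eq]
      simp only [bellman]
      rw [← mul_sub, abs_mul, abs_of_nonneg h0]
      refine mul_le_mul_of_nonneg_left ?_ h0
      have e0 := hxy (G.succ v false)
      have e1 := hxy (G.succ v true)
      rcases G.kind v
      · exact (abs_max_sub_max_le_max _ _ _ _).trans (max_le e0 e1)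
      · exact (abs_min_sub_min_le_max _ _ _ _).trans (max_le e0 e1)
      · rw [abs_le] at *
        constructor <;> linarith
    · simp [bellman]; positivity
    · simp [bellman]; positivity
  have hc : ContractingWith ⟨γ, h0⟩ (G.bellman γ) := ⟨by exact_mod_cast h1, hlip⟩
  exact ⟨_, hc.fixedPoint_isFixedPt⟩

variable {G} {γ : ℝ} {w : G.Vertex → ℝ}

/-- At an inner vertex where w is smallest, w ≥ γ w, which excludes a negative value; where it is
largest, w ≤ γ w, which excludes a value above 1. -/
theorem bellman_bounds (h0 : 0 ≤ γ) (h1 : γ < 1) (hw : G.bellman γ w = w) (u : G.Vertex) :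
    0 ≤ w u ∧ w u ≤ 1 := by
  have ht : w (.inr true) = 1 := (congrFun hw _).symm
  have hf : w (.inr false) = 0 := (congrFun hw _).symm
  constructor
  · obtain ⟨m, -, hm⟩ := Finset.exists_min_image Finset.univ w ⟨.inr true, Finset.mem_univ _⟩
    have hm : ∀ u, w m ≤ w u := fun u => hm u (Finset.mem_univ _)
    refine le_trans ?_ (hm u)
    by_contra! hneg
    rcases m with v | (_ | _)
    · have hv := congrFun hw (.inl v)
      simp only [bellman] at hv
      have e0 := hm (G.succ v false)
      have e1 := hm (G.succ v true)
      have : γ * w (.inl v) ≤ w (.inl v) := by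
        conv_rhs => rw [← hv]
        refine mul_le_mul_of_nonneg_left ?_ h0
        rcases G.kind v
        · exact le_max_of_le_left e0
        · exact le_min e0 e1
        · show _ ≤ (_ + _) / 2
          linarith
      nlinarith
    · linarith
    · linarith
  · obtain ⟨m, -, hm⟩ := Finset.exists_max_image Finset.univ w ⟨.inr true, Finset.mem_univ _⟩
    have hm : ∀ u, w u ≤ w m := fun u => hm u (Finset.mem_univ _)
    refine le_trans (hm u) ?_
    by_contra! hneg
    rcases m with v | (_ | _)
    · have hv := congrFun hw (.inl v)
      simp only [bellman] at hv
      have e0 := hm (G.succ v false)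
      have e1 := hm (G.succ v true)
      have : w (.inl v) ≤ γ * w (.inl v) := by
        conv_lhs => rw [← hv]
        refine mul_le_mul_of_nonneg_left ?_ h0
        rcases G.kind v
        · exact max_le e0 e1
        · exact min_le_of_left_le e0
        · show (_ + _) / 2 ≤ _
          linarith
      nlinarith
    · linarith
    · linarith

/-- The discounted value is at most the value. -/
theorem le_value (h0 : 0 ≤ γ) (h1 : γ < 1) (hw : G.bellman γ w = w) : w G.start ≤ G.value := by
  have ht : w (.inr true) = 1 := (congrFun hw _).symm
  have hf : w (.inr false) = 0 := (congrFun hw _).symm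
  have hg : ∀ v : {v : Fin G.N // G.kind v = .max}, ∃ c,
      max (w (G.succ v false)) (w (G.succ v true)) = w (G.succ v c) := fun v => by
    rcases max_choice (w (G.succ v false)) (w (G.succ v true)) with h | h
    exacts [⟨_, h⟩, ⟨_, h⟩]
  -- Max plays greedily with respect to `w`, so that w ≤ γ `next` w holds at inner vertices against
  -- every `τ`.
  choose σ hσ using hg
  have hle : ∀ τ v, w (.inl v) ≤ γ * G.next σ τ w (.inl v) := by
    intro τ v
    have hv := congrFun hw (.inl v)
    simp only [bellman] at hv
    rw [← hv]
    refine mul_le_mul_of_nonneg_left ?_ h0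
    rcases hk : G.kind v
    · rw [next_max _ _ _ _ hk, ← hσ ⟨v, hk⟩]
    · rw [next_min _ _ _ _ hk]
      rcases τ ⟨v, hk⟩
      · exact min_le_left _ _
      · exact min_le_right _ _
    · rw [next_avg _ _ _ _ hk]
  -- Iterate this inequality. As w ≤ 1, play that is not absorbed after t steps contributes at most
  -- γ^t.
  have hbound : ∀ τ (t : ℕ) u, w u ≤ G.reachIn σ τ t u + γ ^ t := by
    intro τ t
    induction t with
    | zero =>
      intro u
      have := (bellman_bounds h0 h1 hw u).2
      have := G.reachIn_nonneg σ τ 0 u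
      rw [pow_zero]
      linarith
    | succ t ih =>
      rintro (v | (_ | _))
      · have e1 := G.next_mono σ τ (f := w) (g := fun u => 1 * G.reachIn σ τ t u + γ ^ t)
          (fun u => by simpa using ih u) (.inl v)
        rw [next_affine, ← reachIn_succ] at e1
        have e2 := mul_le_mul_of_nonneg_left e1 h0
        have e3 : γ * G.reachIn σ τ (t + 1) (.inl v) ≤ G.reachIn σ τ (t + 1) (.inl v) :=
          mul_le_of_le_one_left (reachIn_nonneg _ _ _ _ _) h1.le
        rw [pow_succ]
        linarith [hle τ v]
      · rw [hf, reachIn_false]; positivity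
      · rw [ht, reachIn_true]; linarith [pow_nonneg h0 (t + 1)]
  have hreach : ∀ τ, w G.start ≤ G.reachProb σ τ := by
    intro τ
    have e1 := (G.tendsto_reachIn σ τ G.start).add (tendsto_pow_atTop_nhds_zero_of_lt_one h0 h1)
    rw [add_zero] at e1
    exact ge_of_tendsto' e1 fun t => hbound τ t _
  exact (le_ciInf hreach).trans (le_ciSup (f := fun σ => ⨅ τ, G.reachProb σ τ)
    (Set.finite_range _).bddAbove σ)

/-- If the value exceeds `1/2`, so does the discounted value. -/
theorem half_lt_of_half_lt_value (h0 : 0 ≤ γ) (h1 : γ < 1) (hγ : 1 - γ ≤ 1 / 2 ^ (5 * (G.N + 2)))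
    (hw : G.bellman γ w = w) (hv : 1 / 2 < G.value) : 1 / 2 < w G.start := by
  have ht : w (.inr true) = 1 := (congrFun hw _).symm
  obtain ⟨σ, hσ⟩ := exists_lt_of_lt_ciSup hv
  have hg : ∀ v : {v : Fin G.N // G.kind v = .min}, ∃ c,
      min (w (G.succ v false)) (w (G.succ v true)) = w (G.succ v c) := fun v => by
    rcases min_choice (w (G.succ v false)) (w (G.succ v true)) with h | h
    exacts [⟨_, h⟩, ⟨_, h⟩]
  -- `σ` guarantees more than 1/2 in the undiscounted game; min replies greedily with respect to
  -- `w`.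
  choose τ hτ using hg
  have hr : 1 / 2 < G.reach σ τ G.start :=
    hσ.trans_le (ciInf_le (f := fun τ => G.reachProb σ τ) (Set.finite_range _).bddBelow τ)
  have hle : ∀ v, γ * G.next σ τ w (.inl v) ≤ w (.inl v) := by
    intro v
    have hv := congrFun hw (.inl v)
    simp only [bellman] at hv
    conv_rhs => rw [← hv]
    refine mul_le_mul_of_nonneg_left ?_ h0
    rcases hk : G.kind v
    · rw [next_max _ _ _ _ hk]
      rcases σ ⟨v, hk⟩
      · exact le_max_left _ _
      · exact le_max_right _ _
    · rw [next_min _ _ _ _ hk, ← hτ ⟨v, hk⟩]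
    · rw [next_avg _ _ _ _ hk]
  have hsub : ∀ u, G.next σ τ (fun u => G.reach σ τ u - w u) u =
      G.reach σ τ u - G.next σ τ w u := by
    intro u
    rw [← next_reach]
    simp only [next]
    rw [← Pi.sub_apply, ← Matrix.mulVec_sub]
    congr 1
  have hone : ∀ u, G.next σ τ w u ≤ 1 := by
    intro u
    have := G.next_mono σ τ (f := w) (g := fun u => 0 * w u + 1)
      (fun u => by simpa using (bellman_bounds h0 h1 hw u).2) u
    rw [next_affine] at this
    linarith
  have hε : 0 ≤ 1 - γ := by linarith
  -- The loss `reach - w` is almost subharmonic: `reach` is harmonic, and w ≥ γ `next` w with `next`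
  -- w ≤ 1, so the error per step is at most 1 - γ.
  have he := G.le_of_le_next σ τ (e := fun u => G.reach σ τ u - w u) hε (fun u => ?_)
    (by rw [reach_true, ht]; simp) G.start
  · have hgap := G.half_add_le_reach σ τ hr
    have hk : 2 ≤ G.N + 2 := by omega
    generalize G.N + 2 = k at *
    have hk2 : (k : ℝ) < 2 ^ k := by exact_mod_cast Nat.lt_two_pow_self
    -- With q = 2^k the loss is at most q · q⁻⁵ · q = q⁻³, which is below the gap 1/(2q²). The
    -- factor 5 in the exponent of the discount factor is used here.
    have h3 : (k : ℝ) * (1 - γ) * 2 ^ k < 1 / (2 * 4 ^ k) := by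
      have e4 : (4 : ℝ) ^ k = 2 ^ k * 2 ^ k := by rw [← mul_pow]; norm_num
      have e5 : (2 : ℝ) ^ (5 * k) = 2 ^ k * 2 ^ k * 2 ^ k * 2 ^ k * 2 ^ k := by
        rw [mul_comm, pow_mul]; ring
      rw [e5] at hγ
      rw [e4]
      have hq : (4 : ℝ) ≤ 2 ^ k := by
        calc (4 : ℝ) = 2 ^ 2 := by norm_num
          _ ≤ 2 ^ k := pow_le_pow_right₀ (by norm_num) hk
      set q : ℝ := 2 ^ k
      have hq0 : 0 < q := by linarith
      calc (k : ℝ) * (1 - γ) * q ≤ q * (1 / (q * q * q * q * q)) * q := by gcongr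
        _ = 1 / (q * (q * q)) := by field_simp
        _ < 1 / (2 * (q * q)) := by
          apply one_div_lt_one_div_of_lt (by positivity)
          gcongr
          linarith
    linarith
  · have hw0 := (bellman_bounds h0 h1 hw u).1
    by_cases hu : 0 < G.reach σ τ u
    · rcases u with v | (_ | _)
      · refine Or.inr ⟨hu, ?_⟩
        rw [hsub]
        nlinarith [hle v, hone (.inl v)]
      · rw [reach_false] at hu; exact absurd hu (lt_irrefl _)
      · left; rw [reach_true, ht]; simp
    · left; linarith

end SSG

/-! ### The min-only system of a game -/

/-- A matrix that contracts a weighted supremum norm has powers tending to `0`. -/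
theorem tendsto_pow_zero_of_contracting {ι : Type} [Fintype ι] [DecidableEq ι] {Q : Matrix ι ι ℝ}
    {h : ι → ℝ} {θ : ℝ} (hh : ∀ w, 0 < h w) (h0 : 0 ≤ θ) (h1 : θ < 1)
    (hQ : ∀ w, ∑ u, |Q w u| * h u ≤ θ * h w) : Tendsto (fun p : ℕ => Q ^ p) atTop (𝓝 0) := by
  refine tendsto_pow_zero_iff_mulVec.2 fun x v => ?_
  obtain ⟨X, hX⟩ : ∃ X, ∀ w, |x w| ≤ X * h w := by
    refine ⟨∑ u, |x u| / h u, fun w => ?_⟩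
    rw [← div_le_iff₀ (hh w)]
    exact Finset.single_le_sum (f := fun u => |x u| / h u)
      (fun u _ => div_nonneg (abs_nonneg _) (hh u).le) (Finset.mem_univ w)
  have key : ∀ p w, |(Q ^ p).mulVec x w| ≤ X * θ ^ p * h w := by
    intro p
    induction p with
    | zero => intro w; simpa using hX w
    | succ p ih =>
      intro w
      have hX0 : 0 ≤ X * θ ^ p := nonneg_of_mul_nonneg_left ((abs_nonneg _).trans (ih w)) (hh w)
      rw [pow_succ', ← Matrix.mulVec_mulVec]
      calc |Q.mulVec ((Q ^ p).mulVec x) w| ≤ ∑ u, |Q w u * (Q ^ p).mulVec x u| :=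
            Finset.abs_sum_le_sum_abs _ _
        _ ≤ ∑ u, X * θ ^ p * (|Q w u| * h u) := by
            refine Finset.sum_le_sum fun u _ => ?_
            rw [abs_mul]
            have := mul_le_mul_of_nonneg_left (ih u) (abs_nonneg (Q w u))
            linarith
        _ = X * θ ^ p * ∑ u, |Q w u| * h u := by rw [Finset.mul_sum]
        _ ≤ X * θ ^ p * (θ * h w) := mul_le_mul_of_nonneg_left (hQ w) hX0
        _ = X * θ ^ (p + 1) * h w := by ring
  refine squeeze_zero_norm (fun p => key p v) ?_
  have := ((tendsto_pow_atTop_nhds_zero_of_lt_one h0 h1).const_mul X).mul_const (h v)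
  simpa using this

namespace SSG

variable (G : SSG)

/-- The variables: a minimum for every inner vertex, and for every vertex the negative of its value
and two copies of the values of its successors. -/
abbrev DVar : Type := Fin G.N ⊕ (G.Vertex × Fin 3)

/-- The vertices in the order of their numbers. -/
def vertexList : List G.Vertex := .inr false :: .inr true :: (List.finRange G.N).map .inl

/-- The factor between the value of a successor and its copy. -/
def copyFactor : SSGKind → ℚ
  | .max => 1
  | .min => -1
  | .avg => -1 / 2

/-- The coefficients of the optimality equations with discount factor `γ`. -/
def discountedCoeff (γ : ℚ) : G.DVar → G.DVar → ℚ
  | .inr (.inl v, 0), u => match G.kind v with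
    | .max => if u = .inl v then γ else 0
    | .min => if u = .inl v then -γ else 0
    | .avg => (if u = .inr (.inl v, 1) then -γ else 0) + (if u = .inr (.inl v, 2) then -γ else 0)
  | .inr (.inl v, 1), u => if u = .inr (G.succ v false, 0) then copyFactor (G.kind v) else 0
  | .inr (.inl v, 2), u => if u = .inr (G.succ v true, 0) then copyFactor (G.kind v) else 0
  | _, _ => 0

/-- The optimality equations with discount factor `γ`. -/
def discounted (γ : ℚ) : MinSystem G.DVar where
  mins := (List.finRange G.N).map .inl
  affs := G.vertexList.flatMap fun u => [.inr (u, 0), .inr (u, 1), .inr (u, 2)]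
  nodup := by
    have h1 : G.vertexList.Nodup := by
      simp [vertexList, List.nodup_map_iff Sum.inl_injective, List.nodup_finRange]
    refine List.Nodup.append ?_ ?_ ?_
    · exact (List.nodup_map_iff Sum.inl_injective).2 (List.nodup_finRange _)
    · refine List.nodup_flatMap.2 ⟨fun u _ => by simp, h1.imp fun {u v} huv => ?_⟩
      simp [Function.onFun, Ne.symm huv]
    · intro w h2 h3
      simp only [List.mem_map, List.mem_flatMap] at h2 h3
      obtain ⟨v, -, rfl⟩ := h2
      simp at h3
  complete := by
    rintro (v | ⟨u, i⟩)
    · simp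
    · simp only [List.mem_append, List.mem_flatMap]
      refine Or.inr ⟨u, ?_, ?_⟩
      · rcases u with v | (_ | _) <;> simp [vertexList]
      · fin_cases i <;> simp
  J
    | .inl v => {.inr (.inl v, 1), .inr (.inl v, 2)}
    | w => {w}
  J_nonempty := by rintro (v | w) <;> simp
  q := G.discountedCoeff γ
  b w := if w = .inr (.inr true, 0) then -1 else 0

variable {G} {γ : ℚ}

theorem discountedCoeff_max {v : Fin G.N} (h : G.kind v = .max) :
    G.discountedCoeff γ (.inr (.inl v, 0)) = fun u => if u = .inl v then γ else 0 := by
  funext u; simp only [discountedCoeff, h]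

theorem discountedCoeff_min {v : Fin G.N} (h : G.kind v = .min) :
    G.discountedCoeff γ (.inr (.inl v, 0)) = fun u => if u = .inl v then -γ else 0 := by
  funext u; simp only [discountedCoeff, h]

theorem discountedCoeff_avg {v : Fin G.N} (h : G.kind v = .avg) :
    G.discountedCoeff γ (.inr (.inl v, 0)) = fun u =>
      (if u = .inr (.inl v, 1) then -γ else 0) + (if u = .inr (.inl v, 2) then -γ else 0) := by
  funext u; simp only [discountedCoeff, h]

theorem discountedCoeff_copy (v : Fin G.N) (c : Bool) :
    G.discountedCoeff γ (.inr (.inl v, if c then 2 else 1)) = fun u =>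
      if u = .inr (G.succ v c, 0) then copyFactor (G.kind v) else 0 := by
  cases c <;> rfl

theorem discountedCoeff_sink (s : Bool) (i : Fin 3) :
    G.discountedCoeff γ (.inr (.inr s, i)) = fun _ => 0 := rfl

/-- The copies numbered 1 and 2 belong to the successors `false` and `true`; indexing them by `c`
treats both at once. -/
theorem discountedCoeff_cases (P : G.Vertex × Fin 3 → Prop)
    (h0 : ∀ v, P (.inl v, 0)) (h1 : ∀ v (c : Bool), P (.inl v, if c then 2 else 1))
    (h2 : ∀ s i, P (.inr s, i)) (u : G.Vertex × Fin 3) : P u := by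
  match u with
  | (.inl v, 0) => exact h0 v
  | (.inl v, 1) => exact h1 v false
  | (.inl v, 2) => exact h1 v true
  | (.inr s, i) => exact h2 s i

theorem mem_discounted_affs (u : G.Vertex × Fin 3) : .inr u ∈ (G.discounted γ).affs := by
  rcases List.mem_append.1 ((G.discounted γ).complete (.inr u)) with h | h
  · simp [discounted] at h
  · exact h

theorem not_mem_discounted_affs (v : Fin G.N) : .inl v ∉ (G.discounted γ).affs := by
  simp [discounted]

theorem discounted_sumLeOne (h0 : 0 ≤ γ) (h1 : γ ≤ 1) : (G.discounted γ).toLEMM.SumLeOne := by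
  refine (G.discounted γ).toLEMM_sumLeOne fun w hw => ?_
  have hb : (G.discounted γ).b w ≤ 0 := by
    simp only [discounted]
    split_ifs <;> norm_num
  have hc : ∀ k, copyFactor k ≤ 1 := by intro k; cases k <;> norm_num [copyFactor]
  suffices hq : ∑ u, G.discountedCoeff γ w u ≤ 1 by
    have : ∑ u, (G.discounted γ).q w u ≤ 1 := hq
    linarith
  rcases w with v | u
  · exact absurd hw (not_mem_discounted_affs v)
  clear hw hb
  revert u
  refine discountedCoeff_cases _ (fun v => ?_) (fun v c => ?_) (fun s i => ?_)
  · rcases hk : G.kind v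
    · rw [discountedCoeff_max hk, Finset.sum_ite_eq']
      simpa using h1
    · rw [discountedCoeff_min hk, Finset.sum_ite_eq']
      simp; linarith
    · rw [discountedCoeff_avg hk, Finset.sum_add_distrib, Finset.sum_ite_eq', Finset.sum_ite_eq']
      simp; linarith
  · rw [discountedCoeff_copy, Finset.sum_ite_eq']
    simpa using hc _
  · rw [discountedCoeff_sink]; simp

theorem sum_cast_ite_mul {ι : Type} [Fintype ι] [DecidableEq ι] (a : ι) (r : ℚ) (x : ι → ℝ) :
    ∑ u, ((if u = a then r else 0 : ℚ) : ℝ) * x u = r * x a := by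
  rw [Finset.sum_eq_single a] <;> simp +contextual

theorem sum_abs_cast_ite_mul {ι : Type} [Fintype ι] [DecidableEq ι] (a : ι) (r : ℚ) (x : ι → ℝ) :
    ∑ u, |((if u = a then r else 0 : ℚ) : ℝ)| * x u = |(r : ℝ)| * x a := by
  rw [Finset.sum_eq_single a] <;> simp +contextual

/-- The solutions are the negatives of the discounted values. -/
theorem discounted_sol_iff (x : G.DVar → ℝ) : (G.discounted γ).Sol x ↔
    (∀ v, x (.inl v) = min (x (.inr (.inl v, 1))) (x (.inr (.inl v, 2)))) ∧
    (∀ v, x (.inr (.inl v, 0)) = match G.kind v with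
      | .max => γ * x (.inl v)
      | .min => -γ * x (.inl v)
      | .avg => -γ * x (.inr (.inl v, 1)) + -γ * x (.inr (.inl v, 2))) ∧
    (∀ v, x (.inr (.inl v, 1)) = copyFactor (G.kind v) * x (.inr (G.succ v false, 0))) ∧
    (∀ v, x (.inr (.inl v, 2)) = copyFactor (G.kind v) * x (.inr (G.succ v true, 0))) ∧
    ∀ s i, x (.inr (.inr s, i)) = if s = true ∧ i = 0 then -1 else 0 := by
  have hp : ∀ v, ∑ u, (G.discountedCoeff γ (.inr (.inl v, 0)) u : ℝ) * x u =
      match G.kind v with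
      | .max => γ * x (.inl v)
      | .min => -γ * x (.inl v)
      | .avg => -γ * x (.inr (.inl v, 1)) + -γ * x (.inr (.inl v, 2)) := by
    intro v
    rcases hk : G.kind v
    · rw [discountedCoeff_max hk, sum_cast_ite_mul]
    · rw [discountedCoeff_min hk, sum_cast_ite_mul, Rat.cast_neg]
    · simp only [discountedCoeff_avg hk, Rat.cast_add, add_mul, Finset.sum_add_distrib,
        sum_cast_ite_mul, Rat.cast_neg]
  have hd : ∀ v c, ∑ u, (G.discountedCoeff γ (.inr (.inl v, if c then 2 else 1)) u : ℝ) * x u =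
      copyFactor (G.kind v) * x (.inr (G.succ v c, 0)) := by
    intro v c
    rw [discountedCoeff_copy, sum_cast_ite_mul]
  have hsink : ∀ s i, ∑ u, ((G.discounted γ).q (.inr (.inr s, i)) u : ℝ) * x u +
      ((G.discounted γ).b (.inr (.inr s, i)) : ℝ) = if s = true ∧ i = 0 then -1 else 0 := by
    intro s i
    simp only [discounted, discountedCoeff_sink]
    simp
    split_ifs <;> simp
  have hb : ∀ v i, ((G.discounted γ).b (.inr (.inl v, i)) : ℝ) = 0 := by
    intro v i; simp [discounted]
  have hrow : ∀ v i y, ∑ u, (G.discountedCoeff γ (.inr (.inl v, i)) u : ℝ) * x u = y →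
      ∑ u, ((G.discounted γ).q (.inr (.inl v, i)) u : ℝ) * x u +
        ((G.discounted γ).b (.inr (.inl v, i)) : ℝ) = y := by
    intro v i y h
    rw [hb, add_zero]
    exact h
  constructor
  · rintro ⟨h1, h2⟩
    refine ⟨fun v => ?_, fun v => ?_, fun v => ?_, fun v => ?_, fun s i => ?_⟩
    · have := h1 (.inl v) (by simp [discounted])
      simpa [discounted, Finset.inf'_insert] using this
    · exact (h2 _ (mem_discounted_affs _)).trans (hrow v 0 _ (hp v))
    · exact (h2 _ (mem_discounted_affs _)).trans (hrow v 1 _ (hd v false))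
    · exact (h2 _ (mem_discounted_affs _)).trans (hrow v 2 _ (hd v true))
    · exact (h2 _ (mem_discounted_affs _)).trans (hsink s i)
  · rintro ⟨h1, h2, h3, h4, h5⟩
    refine ⟨fun w hw => ?_, fun w hw => ?_⟩
    · simp only [discounted, List.mem_map] at hw
      obtain ⟨v, -, rfl⟩ := hw
      simpa [discounted, Finset.inf'_insert] using h1 v
    · match w, hw with
      | .inl v, hw => exact absurd hw (not_mem_discounted_affs v)
      | .inr (.inl v, 0), _ => exact (h2 v).trans (hrow v 0 _ (hp v)).symm
      | .inr (.inl v, 1), _ => exact (h3 v).trans (hrow v 1 _ (hd v false)).symm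
      | .inr (.inl v, 2), _ => exact (h4 v).trans (hrow v 2 _ (hd v true)).symm
      | .inr (.inr s, i), _ => rw [hsink, h5]

/-- With x = -w: at a max vertex the copies are -w, and γ times their minimum is -γ max. At a min
vertex the copies are w, and the factor -γ gives -γ min. At an average vertex the copies are w/2,
and both are added with factor -γ. -/
theorem bellman_of_sol {x : G.DVar → ℝ} (hx : (G.discounted γ).Sol x) :
    G.bellman γ (fun u => - x (.inr (u, 0))) = fun u => - x (.inr (u, 0)) := by
  obtain ⟨h1, h2, h3, h4, h5⟩ := (discounted_sol_iff x).1 hx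
  funext u
  rcases u with v | (_ | _)
  · simp only [bellman]
    rw [h2 v]
    have e1 := h1 v
    have e3 := h3 v
    have e4 := h4 v
    generalize x (.inr (G.succ v false, 0)) = a at *
    generalize x (.inr (G.succ v true, 0)) = b at *
    rcases hk : G.kind v <;> rw [hk] at e3 e4 <;> simp only [copyFactor] at e3 e4 <;>
      push_cast at e3 e4 <;> simp only
    · rw [e1, e3, e4, one_mul, one_mul, max_neg_neg]; ring
    · rw [e1, e3, e4, neg_one_mul, neg_one_mul]; ring
    · rw [e3, e4]; ring
  · simp [bellman, h5]
  · simp [bellman, h5]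

theorem exists_sol_of_bellman {w : G.Vertex → ℝ} (hw : G.bellman γ w = w) :
    ∃ x, (G.discounted γ).Sol x ∧ ∀ u, x (.inr (u, 0)) = - w u := by
  let d : G.Vertex → Bool → ℝ := fun u c => match u with
    | .inl v => - (copyFactor (G.kind v) * w (G.succ v c))
    | .inr _ => 0
  refine ⟨fun y => match y with
    | .inl v => min (d (.inl v) false) (d (.inl v) true)
    | .inr (u, 0) => - w u
    | .inr (u, 1) => d u false
    | .inr (u, 2) => d u true, (discounted_sol_iff _).2
      ⟨fun v => rfl, fun v => ?_, fun v => ?_, fun v => ?_, fun s i => ?_⟩, fun u => rfl⟩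
  · have hv := congrFun hw (.inl v)
    simp only [bellman] at hv
    simp only [d]
    rw [← hv]
    rcases hk : G.kind v <;> simp only [copyFactor] <;> push_cast
    · rw [one_mul, one_mul, min_neg_neg]; ring
    · rw [neg_one_mul, neg_one_mul, neg_neg, neg_neg]; ring
    · ring
  · simp [d]
  · simp [d]
  · have ht : w (.inr true) = 1 := (congrFun hw _).symm
    have hf : w (.inr false) = 0 := (congrFun hw _).symm
    fin_cases i <;> cases s <;> simp [d, ht, hf]

/-- Discounting acts only in the rows of values, so one step need not contract the plain supremum
norm. The loss γ is spread over the cycle value, minimum, copy by weights: with γ ≤ θ³, a copy gets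
an extra factor 1/θ and a minimum 1/θ², and every row then contracts by θ. The factor `c`
compensates the coefficient 1/2 of the copies at average vertices, whose cycle has only two steps.
-/
theorem discounted_halting (h0 : 0 ≤ γ) (h1 : γ < 1) : (G.discounted γ).toLEMM.Halting := by
  refine (G.discounted γ).toLEMM_halting fun Q hQ => ?_
  have h0' : (0 : ℝ) ≤ γ := by exact_mod_cast h0
  have h1' : (γ : ℝ) < 1 := by exact_mod_cast h1
  -- θ = 1 - (1 - γ)/3, by Bernoulli's inequality.
  obtain ⟨θ, hθ0, hθ1, hθ⟩ : ∃ θ : ℝ, 0 < θ ∧ θ < 1 ∧ γ ≤ θ ^ 3 := by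
    refine ⟨1 - (1 - γ) / 3, by linarith, by linarith, ?_⟩
    have := one_add_mul_le_pow (a := -((1 - (γ : ℝ)) / 3)) (by linarith) 3
    rw [sub_eq_add_neg]
    push_cast at this
    linarith
  let c : G.Vertex → ℝ := fun u => match u with
    | .inl v => |(copyFactor (G.kind v) : ℝ)|
    | .inr _ => 1
  have hc : ∀ u, 0 < c u := by
    rintro (v | s)
    · simp only [c]
      rcases G.kind v <;> norm_num [copyFactor]
    · simp [c]
  let h : G.DVar → ℝ := fun y => match y with
    | .inl v => c (.inl v) / θ ^ 2
    | .inr (_, 0) => 1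
    | .inr (u, 1) => c u / θ
    | .inr (u, 2) => c u / θ
  have hpos : ∀ y, 0 < h y := by
    intro y
    match y with
    | .inl v => exact div_pos (hc (.inl v)) (by positivity)
    | .inr (_, 0) => exact one_pos
    | .inr (u, 1) => exact div_pos (hc u) hθ0
    | .inr (u, 2) => exact div_pos (hc u) hθ0
  refine tendsto_pow_zero_of_contracting hpos hθ0.le hθ1 ?_
  have hθ3 : θ ^ 3 ≤ θ ^ 2 := pow_le_pow_of_le_one hθ0.le hθ1.le (by norm_num)
  rintro (v | u)
  · obtain ⟨e1, e2, e3⟩ := hQ.1 (.inl v) (by simp [discounted])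
    have e4 : ∀ u, |Q (.inl v) u| * h u = Q (.inl v) u * (c (.inl v) / θ) := by
      intro u
      rw [abs_of_nonneg (e1 u)]
      by_cases hu : u ∈ (G.discounted γ).J (.inl v)
      · simp only [discounted, Finset.mem_insert, Finset.mem_singleton] at hu
        rcases hu with rfl | rfl <;> rfl
      · rw [e3 u hu]; simp
    rw [Finset.sum_congr rfl fun u _ => e4 u, ← Finset.sum_mul, e2, one_mul]
    refine le_of_eq ?_
    simp only [h]
    field_simp
  · have e : ∀ y, Q (.inr u) y = (G.discountedCoeff γ (.inr u) y : ℝ) :=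
      hQ.2 (.inr u) (mem_discounted_affs _)
    simp only [e]
    clear e
    revert u
    refine discountedCoeff_cases _ (fun v => ?_) (fun v c' => ?_) (fun s i => ?_)
    · rcases hk : G.kind v
      · rw [discountedCoeff_max hk, sum_abs_cast_ite_mul, abs_of_nonneg h0']
        simp only [h, c, hk, copyFactor]
        rw [mul_div, div_le_iff₀ (by positivity)]
        push_cast
        rw [abs_one]
        linarith
      · rw [discountedCoeff_min hk, sum_abs_cast_ite_mul, Rat.cast_neg, abs_neg,
          abs_of_nonneg h0']
        simp only [h, c, hk, copyFactor]
        rw [mul_div, div_le_iff₀ (by positivity)]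
        push_cast
        rw [abs_neg, abs_one]
        linarith
      · have hle : ∀ y, |((((if y = .inr (.inl v, 1) then -γ else 0) +
            (if y = .inr (.inl v, 2) then -γ else 0) : ℚ)) : ℝ)| * h y ≤
            |((if y = .inr (.inl v, 1) then -γ else 0 : ℚ) : ℝ)| * h y +
            |((if y = .inr (.inl v, 2) then -γ else 0 : ℚ) : ℝ)| * h y := by
          intro y
          rw [Rat.cast_add, ← add_mul]
          exact mul_le_mul_of_nonneg_right (abs_add_le _ _) (hpos y).le
        rw [discountedCoeff_avg hk]
        refine (Finset.sum_le_sum fun y _ => hle y).trans ?_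
        rw [Finset.sum_add_distrib, sum_abs_cast_ite_mul, sum_abs_cast_ite_mul, Rat.cast_neg,
          abs_neg, abs_of_nonneg h0']
        simp only [h, c, hk, copyFactor]
        have hhalf : |((-1 / 2 : ℚ) : ℝ)| = 1 / 2 := by
          push_cast
          rw [abs_of_neg] <;> norm_num
        rw [hhalf, ← mul_add, ← add_div, mul_div, div_le_iff₀ (by positivity)]
        linarith
    · rw [discountedCoeff_copy, sum_abs_cast_ite_mul]
      refine le_of_eq ?_
      cases c' <;> simp [h, c] <;> field_simp
    · have := mul_nonneg hθ0.le (hpos (.inr (.inr s, i))).le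
      simpa [discountedCoeff_sink] using this

/-! ### The choice of the discount factor and correctness of the instance. -/

variable (G)

/-- The discount factor. -/
def discount : ℚ := ((2 ^ (5 * (G.N + 2)) - 1 : ℕ) : ℚ) / (2 ^ (5 * (G.N + 2)) : ℕ)

/-- `discount` is a quotient of natural numbers, from which the encoding reads off numerator and
denominator; this form is the one for estimates. -/
theorem discount_eq : G.discount = 1 - 1 / 2 ^ (5 * (G.N + 2)) := by
  rw [discount, Nat.cast_sub Nat.one_le_two_pow]
  push_cast
  rw [sub_div, div_self (by positivity)]

theorem discount_nonneg : 0 ≤ G.discount := by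
  rw [discount]; positivity

theorem discount_lt_one : G.discount < 1 := by
  rw [discount_eq]
  have : (0 : ℚ) < 1 / 2 ^ (5 * (G.N + 2)) := by positivity
  linarith

/-- The min-only instance of a game. -/
noncomputable def minInstance : LEMMInstance :=
  (G.discounted G.discount).inst (.inr (G.start, 0)) (-1 / 2)

/-- Uniqueness of the solution plays no role: the entry at the start of any solution is the negative
of a discounted value, hence bounded through the value of the game, and some solution exists by the
contraction principle. -/
theorem minInstance_yes : G.minInstance.Yes ↔ 1 / 2 < G.value := by
  have h0 : (0 : ℝ) ≤ G.discount := by exact_mod_cast G.discount_nonneg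
  have h1 : (G.discount : ℝ) < 1 := by exact_mod_cast G.discount_lt_one
  rw [minInstance, MinSystem.inst_yes]
  constructor
  · rintro ⟨x, hx, hlt⟩
    have := le_value h0 h1 (bellman_of_sol hx)
    push_cast at hlt
    linarith
  · intro hv
    obtain ⟨w, hw⟩ := G.exists_bellman_eq h0 h1
    obtain ⟨x, hx, hxw⟩ := exists_sol_of_bellman hw
    refine ⟨x, hx, ?_⟩
    have hγ : 1 - (G.discount : ℝ) ≤ 1 / 2 ^ (5 * (G.N + 2)) := by
      rw [discount_eq]; push_cast; linarith
    have := half_lt_of_half_lt_value h0 h1 hγ hw hv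
    rw [hxw]
    push_cast
    linarith

end SSG

/-! ### The string of the min-only system of a game -/

/-- The denominator of the discount factor is a run of zeros and a final one, and its numerator is a
run of ones. So both can be written by loops over a counter, without arithmetic. -/
theorem encodeNat_two_pow (K : ℕ) : encodeNat (2 ^ K) = List.replicate K false ++ [true] := by
  obtain ⟨p, hp, h⟩ : ∃ p : PosNum, (p : ℕ) = 2 ^ K ∧
      encodePosNum p = List.replicate K false ++ [true] := by
    induction K with
    | zero => exact ⟨1, rfl, rfl⟩
    | succ K ih =>
      obtain ⟨p, hp, h⟩ := ih
      refine ⟨p.bit0, ?_, ?_⟩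
      · rw [PosNum.cast_bit0, hp, pow_succ]; ring
      · rw [encodePosNum, h, List.replicate_succ, List.cons_append]
  have := Num.of_to_nat (Num.pos p)
  rw [Num.cast_pos, hp] at this
  rw [encodeNat, this, encodeNum, h]

theorem encodeNat_two_pow_sub_one (K : ℕ) (hK : K ≠ 0) :
    encodeNat (2 ^ K - 1) = List.replicate K true := by
  obtain ⟨p, hp, h⟩ : ∃ p : PosNum, (p : ℕ) = 2 ^ K - 1 ∧
      encodePosNum p = List.replicate K true := by
    obtain ⟨K, rfl⟩ := Nat.exists_eq_succ_of_ne_zero hK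
    clear hK
    induction K with
    | zero => exact ⟨1, rfl, rfl⟩
    | succ K ih =>
      obtain ⟨p, hp, h⟩ := ih
      refine ⟨p.bit1, ?_, ?_⟩
      · rw [PosNum.cast_bit1, hp]
        have := Nat.one_le_two_pow (n := K + 1)
        simp only [Nat.succ_eq_add_one, pow_succ] at *
        omega
      · rw [encodePosNum, h]; rfl
  have := Num.of_to_nat (Num.pos p)
  rw [Num.cast_pos, hp] at this
  rw [encodeNat, this, encodeNum, h]

namespace SSG

open Transducer

variable (G : SSG)

theorem coprime_discount (K : ℕ) : (2 ^ K - 1).Coprime (2 ^ K) := by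
  have h := Nat.one_le_two_pow (n := K)
  have h2 := (Nat.coprime_self_add_right (m := 2 ^ K - 1) (n := 1)).2 (Nat.coprime_one_right _)
  rwa [Nat.sub_add_cancel h] at h2

theorem num_discount : G.discount.num = ((2 ^ (5 * (G.N + 2)) - 1 : ℕ) : ℤ) ∧
    G.discount.den = 2 ^ (5 * (G.N + 2)) := by
  constructor
  · have := Rat.num_div_eq_of_coprime (a := ((2 ^ (5 * (G.N + 2)) - 1 : ℕ) : ℤ))
      (b := ((2 ^ (5 * (G.N + 2)) : ℕ) : ℤ)) (by positivity) (coprime_discount _)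
    rw [Int.cast_natCast, Int.cast_natCast] at this
    exact this
  · have := Rat.den_div_eq_of_coprime (a := ((2 ^ (5 * (G.N + 2)) - 1 : ℕ) : ℤ))
      (b := ((2 ^ (5 * (G.N + 2)) : ℕ) : ℤ)) (by positivity) (coprime_discount _)
    rw [Int.cast_natCast, Int.cast_natCast] at this
    exact Int.ofNat_inj.1 this

/-- The string of the discount factor with a sign. -/
def discountCode (s : Bool) (n : ℕ) : List Γ' :=
  .bit s :: (rep n (List.replicate 5 (.bit true)) ++ (.comma ::
    (rep n (List.replicate 5 (.bit false)) ++ [.bit true, .comma])))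

theorem encRat_discount (s : Bool) :
    encRat (if s then - G.discount else G.discount) = discountCode s (G.N + 2) := by
  obtain ⟨h1, h2⟩ := G.num_discount
  have hpos : 0 < 2 ^ (5 * (G.N + 2)) - 1 := by
    have : 1 < 2 ^ (5 * (G.N + 2)) := Nat.one_lt_two_pow (by omega)
    omega
  have e1 : encBinary (2 ^ (5 * (G.N + 2)) - 1) =
      rep (G.N + 2) (List.replicate 5 (.bit true)) ++ [.comma] := by
    rw [encBinary, encodeNat_two_pow_sub_one _ (by omega), List.map_replicate, rep_replicate,
      mul_comm]
  have e2 : encBinary (2 ^ (5 * (G.N + 2))) =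
      rep (G.N + 2) (List.replicate 5 (.bit false)) ++ [.bit true, .comma] := by
    rw [encBinary, encodeNat_two_pow, List.map_append, List.map_replicate, rep_replicate, mul_comm]
    simp
  have e3 : encBinary G.discount.num.natAbs ++ encBinary G.discount.den =
      rep (G.N + 2) (List.replicate 5 (.bit true)) ++ (.comma ::
    (rep (G.N + 2) (List.replicate 5 (.bit false)) ++ [.bit true, .comma])) := by
    rw [h1, h2, Int.natAbs_natCast, e1, e2]; simp
  cases s
  · have : ¬ G.discount.num < 0 := by rw [h1]; omega
    simp only [encRat, discountCode, Bool.false_eq_true, if_false, this, decide_false, e3]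
  · have : - G.discount.num < 0 := by rw [h1]; omega
    simp only [encRat, discountCode, if_true, Rat.num_neg_eq_neg_num, Rat.den_neg_eq_den,
      Int.natAbs_neg, this, decide_true, e3]

/-- The number of a vertex. -/
def num {N : ℕ} : Fin N ⊕ Bool → ℕ
  | .inr false => 0
  | .inr true => 1
  | .inl v => v + 2

theorem encVertex_eq {N : ℕ} (u : Fin N ⊕ Bool) : encVertex u = encUnary (num u) := by
  rcases u with v | (_ | _) <;> rfl

theorem num_lt {N : ℕ} (u : Fin N ⊕ Bool) : num u < N + 2 := by
  rcases u with v | (_ | _) <;> simp [num]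

theorem vertexList_num (u : G.Vertex) : G.vertexList[num u]? = some u := by
  rcases u with v | (_ | _) <;> simp [num, vertexList]

theorem length_vertexList : G.vertexList.length = G.N + 2 := by simp [vertexList]

theorem nodup_vertexList : G.vertexList.Nodup := by
  simp [vertexList, List.nodup_map_iff Sum.inl_injective, List.nodup_finRange]

/-- A list without repetitions meets the marked element exactly once, so the row is constant apart
from one block. -/
theorem flatMap_single {α : Type} {l : List α} {n : ℕ} {s : α} {F : α → List Γ'} {X Y : List Γ'}
    (hl : l.Nodup) (hn : l[n]? = some s) (hs : F s = X) (hne : ∀ u, u ≠ s → F u = Y) :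
    l.flatMap F = rep n Y ++ (X ++ rep (l.length - 1 - n) Y) := by
  obtain ⟨hlt, hget⟩ := List.getElem?_eq_some_iff.1 hn
  have hsplit : l = l.take n ++ s :: l.drop (n + 1) := by
    rw [← hget, ← List.drop_eq_getElem_cons hlt, List.take_append_drop]
  have hl' := hl
  rw [hsplit] at hl'
  have hd := List.nodup_middle.1 hl'
  rw [List.nodup_cons, List.mem_append, not_or] at hd
  conv_lhs => rw [hsplit]
  rw [List.flatMap_append, List.flatMap_cons, hs,
    flatMap_eq_rep (n := n) (w := Y) (by simp; omega)
      (fun a ha => hne a fun h => hd.1.1 (h ▸ ha)),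
    flatMap_eq_rep (n := l.length - 1 - n) (w := Y) (by simp; omega)
      (fun a ha => hne a fun h => hd.1.2 (h ▸ ha))]

theorem getElem?_flatMap_three {α β : Type} (l : List α) (a b c : α → β) (n : ℕ) :
    (l.flatMap fun u => [a u, b u, c u])[n * 3]? = l[n]?.map a := by
  induction l generalizing n with
  | nil => simp
  | cons u l ih =>
    cases n with
    | zero => simp
    | succ n => simpa [Nat.succ_mul] using ih n

/-- Every row consists of N entries for the min variables and N + 2 triples for the vertices; the
row shapes below are instances of this. -/
theorem order_eq (γ : ℚ) (F : G.DVar → List Γ') :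
    ((G.discounted γ).mins ++ (G.discounted γ).affs).flatMap F =
      (List.finRange G.N).flatMap (fun v => F (.inl v)) ++
        G.vertexList.flatMap fun u => F (.inr (u, 0)) ++ (F (.inr (u, 1)) ++ F (.inr (u, 2))) := by
  simp only [discounted, List.flatMap_append, List.flatMap_map, List.flatMap_assoc,
    List.flatMap_cons, List.flatMap_nil, List.append_nil]

/-- A row without marked entry. -/
def zeroRow (n : ℕ) (Z : List Γ') : List Γ' := rep n Z ++ rep (n + 2) (Z ++ (Z ++ Z))

/-- A row whose marked entry belongs to a min variable. -/
def minRow (i j : ℕ) (Z A : List Γ') : List Γ' :=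
  rep i Z ++ (A ++ (rep j Z ++ rep (i + 1 + j + 2) (Z ++ (Z ++ Z))))

/-- A row whose marked entries belong to the copies of the values of the successors. -/
def pairRow (i j : ℕ) (Z A : List Γ') : List Γ' :=
  rep i Z ++ (Z ++ (rep j Z ++ ((Z ++ (Z ++ Z)) ++ ((Z ++ (Z ++ Z)) ++ (rep i (Z ++ (Z ++ Z)) ++
    ((Z ++ (A ++ A)) ++ rep j (Z ++ (Z ++ Z))))))))

/-- A row whose marked entry belongs to the vertex with number `n`. -/
def vertexRow (i j n : ℕ) (Z A : List Γ') : List Γ' :=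
  rep i Z ++ (Z ++ (rep j Z ++ (rep n (Z ++ (Z ++ Z)) ++ ((A ++ (Z ++ Z)) ++
    rep (i + 1 + j + 1 - n) (Z ++ (Z ++ Z))))))

theorem rep_split (v : Fin G.N) (Z : List Γ') :
    rep G.N Z = rep v Z ++ (Z ++ rep (G.N - 1 - v) Z) := by
  have : G.N = v + (1 + (G.N - 1 - v)) := by omega
  conv_lhs => rw [this, rep_add, rep_add, rep_one]

theorem order_zeroRow (γ : ℚ) {F : G.DVar → List Γ'} {Z : List Γ'} (h : ∀ y, F y = Z) :
    ((G.discounted γ).mins ++ (G.discounted γ).affs).flatMap F = zeroRow G.N Z := by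
  rw [order_eq, zeroRow, flatMap_eq_rep (n := G.N) (w := Z) (by simp) fun _ _ => h _,
    flatMap_eq_rep (n := G.N + 2) (w := Z ++ (Z ++ Z)) G.length_vertexList fun _ _ => by simp [h]]

theorem order_minRow (γ : ℚ) {F : G.DVar → List Γ'} {Z A : List Γ'} (v : Fin G.N)
    (h1 : F (.inl v) = A) (h : ∀ y, y ≠ .inl v → F y = Z) :
    ((G.discounted γ).mins ++ (G.discounted γ).affs).flatMap F =
      minRow v (G.N - 1 - v) Z A := by
  have hv : (v : ℕ) + 1 + (G.N - 1 - v) + 2 = G.N + 2 := by omega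
  rw [order_eq, minRow, flatMap_single (n := v) (List.nodup_finRange _) (by simp) h1
    (fun u hu => h _ (by simpa using hu)), flatMap_eq_rep (n := G.N + 2) (w := Z ++ (Z ++ Z))
      G.length_vertexList fun _ _ => by rw [h _ (by simp), h _ (by simp), h _ (by simp)], hv]
  simp

/-- The sinks come first among the vertices, so two triples precede those of the inner vertices. -/
theorem order_pairRow (γ : ℚ) {F : G.DVar → List Γ'} {Z A : List Γ'} (v : Fin G.N)
    (h1 : F (.inr (.inl v, 1)) = A) (h2 : F (.inr (.inl v, 2)) = A)
    (h : ∀ y, y ≠ .inr (.inl v, 1) → y ≠ .inr (.inl v, 2) → F y = Z) :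
    ((G.discounted γ).mins ++ (G.discounted γ).affs).flatMap F =
      pairRow v (G.N - 1 - v) Z A := by
  have hv : G.N + 2 - 1 - ((v : ℕ) + 2) = G.N - 1 - v := by omega
  rw [order_eq, pairRow, flatMap_eq_rep (n := G.N) (w := Z) (by simp)
    fun _ _ => h _ (by simp) (by simp), G.rep_split v,
    flatMap_single (n := num (Sum.inl v : G.Vertex)) (s := .inl v) (X := Z ++ (A ++ A))
      (Y := Z ++ (Z ++ Z)) G.nodup_vertexList (G.vertexList_num _)
      (by rw [h1, h2, h _ (by simp) (by simp)])
      (fun u hu => by rw [h _ (by simp) (by simp), h _ (by simpa using hu) (by simp),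
        h _ (by simp) (by simpa using hu)]), G.length_vertexList]
  have : rep (num (Sum.inl v : G.Vertex)) (Z ++ (Z ++ Z)) =
      (Z ++ (Z ++ Z)) ++ ((Z ++ (Z ++ Z)) ++ rep v (Z ++ (Z ++ Z))) := by
    rw [num, add_comm, show 2 = 1 + 1 from rfl, rep_add, rep_add, rep_one, List.append_assoc]
  rw [this, num, hv]
  simp only [List.append_assoc]

theorem order_vertexRow (γ : ℚ) {F : G.DVar → List Γ'} {Z A : List Γ'} (v : Fin G.N)
    (s : G.Vertex) (h1 : F (.inr (s, 0)) = A) (h : ∀ y, y ≠ .inr (s, 0) → F y = Z) :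
    ((G.discounted γ).mins ++ (G.discounted γ).affs).flatMap F =
      vertexRow v (G.N - 1 - v) (num s) Z A := by
  have hv : G.N + 2 - 1 - num s = v + 1 + (G.N - 1 - v) + 1 - num s := by omega
  rw [order_eq, vertexRow, flatMap_eq_rep (n := G.N) (w := Z) (by simp)
    fun _ _ => h _ (by simp), G.rep_split v,
    flatMap_single (n := num s) (s := s) (X := A ++ (Z ++ Z))
      (Y := Z ++ (Z ++ Z)) G.nodup_vertexList (G.vertexList_num _)
      (by rw [h1, h _ (by simp), h _ (by simp)])
      (fun u hu => by rw [h _ (by simpa using hu), h _ (by simp), h _ (by simp)]),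
    G.length_vertexList, hv]
  simp only [List.append_assoc]

/-- The equation of the value of an inner vertex. -/
def valueRow (i j : ℕ) : SSGKind → List Γ'
  | .max => minRow i j (encRat 0) (discountCode false (i + 1 + j + 2))
  | .min => minRow i j (encRat 0) (discountCode true (i + 1 + j + 2))
  | .avg => pairRow i j (encRat 0) (discountCode true (i + 1 + j + 2))

/-- The three equations of an inner vertex. -/
def vertexCode (i j : ℕ) (k : SSGKind) (m n : ℕ) : List Γ' :=
  (valueRow i j k ++ encRat 0) ++ ((vertexRow i j m (encRat 0) (encRat (copyFactor k)) ++ encRat 0) ++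
    (vertexRow i j n (encRat 0) (encRat (copyFactor k)) ++ encRat 0))

/-- The string of the min-only instance of a game. -/
theorem encode_minInstance :
    G.minInstance.encode = encUnary G.N ++ (encUnary 0 ++ (encUnary ((G.N + 2) * 3) ++
      ((List.finRange G.N).flatMap (fun v : Fin G.N =>
          pairRow v (G.N - 1 - v) [.bit false] [.bit true]) ++
        ((rep 3 (zeroRow G.N (encRat 0) ++ encRat 0) ++
          (zeroRow G.N (encRat 0) ++ (encRat (-1) ++ rep 2 (zeroRow G.N (encRat 0) ++ encRat 0)))) ++
        ((List.finRange G.N).flatMap (fun v : Fin G.N => vertexCode v (G.N - 1 - v) (G.kind v)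
          (num (G.succ v false)) (num (G.succ v true))) ++
        (encUnary (G.N + num G.start * 3) ++ encRat (-1 / 2))))))) := by
  set γ := G.discount with hγ
  have hlen : (G.discounted γ).affs.length = (G.N + 2) * 3 := by
    simp [discounted, List.length_flatMap, length_vertexList]
  have hlen' : (G.discounted γ).mins.length = G.N := by simp [discounted]
  have hmask : ∀ v, ((G.discounted γ).mins ++ (G.discounted γ).affs).flatMap
      (fun u => [Γ'.bit (decide (u ∈ (G.discounted γ).J (.inl v)))]) =
      pairRow v (G.N - 1 - v) [.bit false] [.bit true] := by
    intro v
    refine G.order_pairRow γ v ?_ ?_ fun y h1 h2 => ?_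
    · simp [discounted]
    · simp [discounted]
    · simp [discounted, h1, h2]
  let row : G.DVar → List Γ' := fun w => ((G.discounted γ).mins ++ (G.discounted γ).affs).flatMap
    (fun u => encRat ((G.discounted γ).q w u)) ++ encRat ((G.discounted γ).b w)
  have hd : ∀ v (c : Bool), row (.inr (.inl v, if c then 2 else 1)) =
      vertexRow v (G.N - 1 - v) (num (G.succ v c)) (encRat 0) (encRat (copyFactor (G.kind v))) ++
        encRat 0 := by
    intro v c
    simp only [row]
    congr 1
    have hq : (G.discounted γ).q (.inr (.inl v, if c then 2 else 1)) = _ :=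
      discountedCoeff_copy v c
    rw [hq]
    exact G.order_vertexRow γ v _ (by simp) fun y hy => by simp [hy]
  have hs : ∀ s i, row (.inr (.inr s, i)) = zeroRow G.N (encRat 0) ++
      encRat ((G.discounted γ).b (.inr (.inr s, i))) := by
    intro s i
    simp only [row]
    congr 1
    exact G.order_zeroRow γ fun y => rfl
  have hN : ∀ v : Fin G.N, (v : ℕ) + 1 + (G.N - 1 - v) + 2 = G.N + 2 := by intro v; omega
  have hp : ∀ v, row (.inr (.inl v, 0)) = valueRow v (G.N - 1 - v) (G.kind v) ++ encRat 0 := by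
    intro v
    simp only [row]
    congr 1
    rcases hk : G.kind v
    · have hq : (G.discounted γ).q (.inr (.inl v, 0)) = _ := discountedCoeff_max hk
      rw [hq, valueRow, hN]
      refine G.order_minRow γ v ?_ fun y hy => by simp [hy]
      simpa using G.encRat_discount false
    · have hq : (G.discounted γ).q (.inr (.inl v, 0)) = _ := discountedCoeff_min hk
      rw [hq, valueRow, hN]
      refine G.order_minRow γ v ?_ fun y hy => by simp [hy]
      simpa using G.encRat_discount true
    · have hq : (G.discounted γ).q (.inr (.inl v, 0)) = _ := discountedCoeff_avg hk
      rw [hq, valueRow, hN]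
      refine G.order_pairRow γ v ?_ ?_ fun y h1 h2 => by simp [h1, h2]
      · simpa using G.encRat_discount true
      · simpa using G.encRat_discount true
  -- The six rows of the sinks come first; only the fourth, the value of the 1-sink, has a non-zero
  -- constant.
  have haff : (G.discounted γ).affs.flatMap row =
      (rep 3 (zeroRow G.N (encRat 0) ++ encRat 0) ++
          (zeroRow G.N (encRat 0) ++ (encRat (-1) ++ rep 2 (zeroRow G.N (encRat 0) ++ encRat 0)))) ++
        (List.finRange G.N).flatMap (fun v : Fin G.N => vertexCode v (G.N - 1 - v) (G.kind v)
          (num (G.succ v false)) (num (G.succ v true))) := by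
    have hv : ∀ v, row (.inr (.inl v, 0)) ++ (row (.inr (.inl v, 1)) ++ row (.inr (.inl v, 2))) =
        vertexCode v (G.N - 1 - v) (G.kind v) (num (G.succ v false)) (num (G.succ v true)) := by
      intro v
      have h1 := hd v false
      have h2 := hd v true
      simp only [Bool.false_eq_true, if_false, if_true] at h1 h2
      rw [hp, h1, h2, vertexCode]
    have haffs : (G.discounted γ).affs =
      G.vertexList.flatMap fun u => [.inr (u, 0), .inr (u, 1), .inr (u, 2)] := rfl
    rw [haffs, List.flatMap_assoc]
    simp only [vertexList, List.flatMap_cons, List.flatMap_nil,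
      List.append_nil, List.flatMap_map, hv, hs]
    have hb : ∀ s i, (G.discounted γ).b (.inr (.inr s, i)) = if s = true ∧ i = 0 then -1 else 0 := by
      intro s i; simp [discounted]
    simp [hb, rep, List.replicate_succ]
  have hget : ((G.discounted γ).mins ++ (G.discounted γ).affs)[G.N + num G.start * 3]? =
      some (.inr (G.start, 0)) := by
    rw [List.getElem?_append_right (by rw [hlen']; omega), hlen', Nat.add_sub_cancel_left]
    refine (getElem?_flatMap_three _ _ _ _ _).trans ?_
    rw [vertexList_num]; rfl
  rw [minInstance, (G.discounted γ).encode_inst hget, hlen, hlen']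
  have haff' := haff
  simp only [row] at haff'
  rw [haff']
  have hmins : (G.discounted γ).mins.flatMap (fun w =>
      ((G.discounted γ).mins ++ (G.discounted γ).affs).flatMap
        fun u => [Γ'.bit (decide (u ∈ (G.discounted γ).J w))]) =
      (List.finRange G.N).flatMap (fun v : Fin G.N =>
          pairRow v (G.N - 1 - v) [.bit false] [.bit true]) := by
    have : (G.discounted γ).mins = (List.finRange G.N).map .inl := rfl
    conv_lhs => arg 2; rw [this]
    rw [List.flatMap_map]
    simp only [hmask]
  rw [hmins]
  simp only [List.append_assoc]

end SSG

/-! ### The program for the reduction from games -/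

namespace Transducer

open SSG

/-- The counters of the program: remaining and finished inner vertices, remaining and finished
vertices, and an auxiliary counter. -/
inductive GReg
  | td | dn | gt | gd | ax
  deriving DecidableEq

instance : Fintype GReg where
  elems := {.td, .dn, .gt, .gd, .ax}
  complete k := by cases k <;> simp

/-- The values of the counters. -/
def gregs (td dn gt gd : ℕ) : GReg → ℕ
  | .td => td | .dn => dn | .gt => gt | .gd => gd | .ax => 0

/-- Three times a string. -/
def thrice (Z : List Γ') : List Γ' := Z ++ (Z ++ Z)

/-- Write a string as often as a counter says. -/
def times (k : GReg) (w : List Γ') : Cmd GReg := forR k .ax (emits w)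

/-- Read the number of vertices and write the dimensions. -/
def gameDimsCmd : Cmd GReg :=
  seqs [forUnary (seqs [.inc .td, .inc .gt, .emit (.bit true)]), .inc .gt, .inc .gt,
    emits [.comma, .comma], times .gt (thrice [.bit true]), emits [.comma]]

/-- Write the discount factor with a sign. -/
def discountCmd (s : Bool) : Cmd GReg :=
  seqs [emits [.bit s], times .gt (List.replicate 5 (.bit true)), emits [.comma],
    times .gt (List.replicate 5 (.bit false)), emits [.bit true, .comma]]

/-- Write a row without marked entry. -/
def zeroRowCmd (Z : List Γ') : Cmd GReg := seqs [times .td Z, times .gt (thrice Z)]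

/-- Write a row whose marked entry belongs to a min variable. -/
def minRowCmd (Z : List Γ') (p : Cmd GReg) : Cmd GReg :=
  seqs [times .dn Z, p, times .td Z, times .gt (thrice Z)]

/-- Write a row whose marked entries belong to the copies of the values of the successors. -/
def pairRowCmd (Z : List Γ') (p : Cmd GReg) : Cmd GReg :=
  seqs [times .dn Z, emits Z, times .td Z, emits (thrice Z), emits (thrice Z),
    times .dn (thrice Z), emits Z, p, p, times .td (thrice Z)]

/-- Read the number of a vertex and write a row whose marked entry belongs to this vertex. -/
def vertexRowCmd (Z A : List Γ') : Cmd GReg :=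
  seqs [times .dn Z, emits Z, times .td Z,
    forUnary (seqs [.dec .gt, .inc .gd, emits (thrice Z)]), emits (A ++ (Z ++ Z)), .dec .gt,
    times .gt (thrice Z), .inc .gt, moveC .gd .gt]

/-- Write the equation of the value of an inner vertex. -/
def valueRowCmd : SSGKind → Cmd GReg
  | .max => minRowCmd (encRat 0) (discountCmd false)
  | .min => minRowCmd (encRat 0) (discountCmd true)
  | .avg => pairRowCmd (encRat 0) (discountCmd true)

/-- Write the three equations of an inner vertex of a given kind. -/
def vertexCmd (k : SSGKind) : Cmd GReg :=
  seqs [valueRowCmd k, emits (encRat 0), vertexRowCmd (encRat 0) (encRat (copyFactor k)),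
    emits (encRat 0), vertexRowCmd (encRat 0) (encRat (copyFactor k)), emits (encRat 0)]

/-- Read the kind of a vertex and run one of three programs. -/
def kindCmd (p : SSGKind → Cmd GReg) : Cmd GReg :=
  .ite (.top isOne)
    (.seq .read (.ite (.top isOne) (.seq .read (p .max)) (.seq .read (p .min))))
    (.seq .read (.seq .read (p .avg)))

/-- Run a program for all inner vertices. -/
def forVertices (p : Cmd GReg) : Cmd GReg :=
  .seq (.loop (.pos .td) (seqs [.dec .td, p, .inc .dn])) (moveC .dn .td)

/-- Write the equations of the sinks. -/
def sinksCmd : Cmd GReg :=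
  seqs [zeroRowCmd (encRat 0), emits (encRat 0), zeroRowCmd (encRat 0), emits (encRat 0),
    zeroRowCmd (encRat 0), emits (encRat 0), zeroRowCmd (encRat 0), emits (encRat (-1)),
    zeroRowCmd (encRat 0), emits (encRat 0), zeroRowCmd (encRat 0), emits (encRat 0)]

/-- Translate the start vertex. -/
def startCmd : Cmd GReg :=
  seqs [times .td [.bit true], forUnary (emits (thrice [.bit true])), emits [.comma],
    emits (encRat (-1 / 2)), clearC .td, clearC .gt]

/-- The program of the reduction from games. -/
def gameCmd : Cmd GReg :=
  seqs [gameDimsCmd, forVertices (pairRowCmd [.bit false] (emits [.bit true])), sinksCmd,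
    forVertices (kindCmd vertexCmd), startCmd]

/-! ### Correctness of the programs that write the system of a game. -/

variable {B : ℕ}

theorem trans_times {ρ : GReg → ℕ} {k : GReg} {n : ℕ} (w : List Γ') (hk : k ≠ .ax)
    (h0 : ρ .ax = 0) (hn : ρ k = n) (hB : n ≤ B) : Trans B (times k w) ρ ρ [] (rep n w) :=
  Trans.forR_rep w hk h0 hn hB

section

variable {td dn gt gd : ℕ}

theorem trans_times_td (w : List Γ') (hB : td ≤ B) :
    Trans B (times .td w) (gregs td dn gt gd) (gregs td dn gt gd) [] (rep td w) :=
  trans_times w (by decide) rfl rfl hB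

theorem trans_times_dn (w : List Γ') (hB : dn ≤ B) :
    Trans B (times .dn w) (gregs td dn gt gd) (gregs td dn gt gd) [] (rep dn w) :=
  trans_times w (by decide) rfl rfl hB

theorem trans_times_gt (w : List Γ') (hB : gt ≤ B) :
    Trans B (times .gt w) (gregs td dn gt gd) (gregs td dn gt gd) [] (rep gt w) :=
  trans_times w (by decide) rfl rfl hB

theorem trans_discountCmd (s : Bool) (hB : gt ≤ B) :
    Trans B (discountCmd s) (gregs td dn gt gd) (gregs td dn gt gd) [] (discountCode s gt) :=
  ((Trans.emits _).seq ((trans_times_gt _ hB).seq ((Trans.emits _).seq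
    ((trans_times_gt _ hB).seq ((Trans.emits _).seq Trans.skip))))).congr (by simp)
      (by simp [discountCode]) rfl

theorem trans_zeroRowCmd (Z : List Γ') {n : ℕ} (hB : n + 2 ≤ B) :
    Trans B (zeroRowCmd Z) (gregs n dn (n + 2) gd) (gregs n dn (n + 2) gd) [] (zeroRow n Z) :=
  ((trans_times_td _ (by omega)).seq ((trans_times_gt _ hB).seq Trans.skip)).congr (by simp)
    (by simp [zeroRow, thrice]) rfl

theorem trans_minRowCmd (Z A : List Γ') {p : Cmd GReg} {i j : ℕ} (hB : i + 1 + j + 2 ≤ B)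
    (hp : Trans B p (gregs j i (i + 1 + j + 2) gd) (gregs j i (i + 1 + j + 2) gd) [] A) :
    Trans B (minRowCmd Z p) (gregs j i (i + 1 + j + 2) gd) (gregs j i (i + 1 + j + 2) gd) []
      (minRow i j Z A) :=
  ((trans_times_dn _ (by omega)).seq (hp.seq ((trans_times_td _ (by omega)).seq
    ((trans_times_gt _ hB).seq Trans.skip)))).congr (by simp) (by simp [minRow, thrice]) rfl

theorem trans_pairRowCmd (Z A : List Γ') {p : Cmd GReg} {i j : ℕ} (hB : i + 1 + j + 2 ≤ B)
    (hp : Trans B p (gregs j i gt gd) (gregs j i gt gd) [] A) :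
    Trans B (pairRowCmd Z p) (gregs j i gt gd) (gregs j i gt gd) [] (pairRow i j Z A) :=
  ((trans_times_dn _ (by omega)).seq ((Trans.emits _).seq ((trans_times_td _ (by omega)).seq
    ((Trans.emits _).seq ((Trans.emits _).seq ((trans_times_dn _ (by omega)).seq
      ((Trans.emits _).seq (hp.seq (hp.seq ((trans_times_td _ (by omega)).seq
        Trans.skip)))))))))).congr (by simp) (by simp [pairRow, thrice]) rfl

/-- Reading the unary number of the successor moves as many units from `gt` to `gd`, and one more
unit of `gt` is taken off for the marked triple. So `gt` then holds the number of triples that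
remain; afterwards it is restored. -/
theorem trans_vertexRowCmd (Z A : List Γ') {i j n : ℕ} (hB : i + 1 + j + 2 ≤ B)
    (hn : n < i + 1 + j + 2) :
    Trans B (vertexRowCmd Z A) (gregs j i (i + 1 + j + 2) 0) (gregs j i (i + 1 + j + 2) 0)
      (encUnary n) (vertexRow i j n Z A) := by
  have h1 := Trans.forUnary (B := B) (p := seqs [.dec .gt, .inc .gd, emits (thrice Z)])
    n (thrice Z) (fun m => gregs j i (i + 1 + j + 2 - m) m) (by omega) (fun m _ =>
      ((Trans.dec _).seq ((Trans.inc _).seq ((Trans.emits _).seq Trans.skip))).congr rfl (by simp)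
        (by funext k; cases k <;> rfl))
  have h2 : Trans B (.dec .gt) (gregs j i (i + 1 + j + 2 - n) n)
      (gregs j i (i + 1 + j + 1 - n) n) [] [] :=
    (Trans.dec _).congr rfl rfl (by
      funext k; cases k <;> simp [gregs]; omega)
  have h3 : Trans B (.inc .gt) (gregs j i (i + 1 + j + 1 - n) n)
      (gregs j i (i + 1 + j + 2 - n) n) [] [] :=
    (Trans.inc _).congr rfl rfl (by
      funext k; cases k <;> simp [gregs]; omega)
  have h4 : Trans B (moveC .gd .gt) (gregs j i (i + 1 + j + 2 - n) n)
      (gregs j i (i + 1 + j + 2) 0) [] [] :=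
    (Trans.moveC (by decide) (by simp [gregs]; omega)).congr rfl rfl (by
      funext k; cases k <;> simp [gregs]; omega)
  exact ((trans_times_dn _ (by omega)).seq ((Trans.emits _).seq ((trans_times_td _ (by omega)).seq
    (h1.seq ((Trans.emits _).seq (h2.seq ((trans_times_gt _ (by omega)).seq (h3.seq (h4.seq
      Trans.skip))))))))).congr (by simp) (by simp [vertexRow, thrice]) rfl

theorem trans_vertexCmd (k : SSGKind) {i j m n : ℕ} (hB : i + 1 + j + 2 ≤ B)
    (hm : m < i + 1 + j + 2) (hn : n < i + 1 + j + 2) :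
    Trans B (vertexCmd k) (gregs j i (i + 1 + j + 2) 0) (gregs j i (i + 1 + j + 2) 0)
      (encUnary m ++ encUnary n) (vertexCode i j k m n) := by
  have hv : Trans B (valueRowCmd k) (gregs j i (i + 1 + j + 2) 0) (gregs j i (i + 1 + j + 2) 0) []
      (valueRow i j k) := by
    cases k
    · exact trans_minRowCmd _ _ hB (trans_discountCmd _ hB)
    · exact trans_minRowCmd _ _ hB (trans_discountCmd _ hB)
    · exact trans_pairRowCmd _ _ hB (trans_discountCmd _ hB)
  exact (hv.seq ((Trans.emits _).seq ((trans_vertexRowCmd _ _ hB hm).seq ((Trans.emits _).seq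
    ((trans_vertexRowCmd _ _ hB hn).seq ((Trans.emits _).seq Trans.skip)))))).congr (by simp)
      (by simp [vertexCode]) rfl

/-- A first bit `false` already identifies an average vertex, so its second bit is only skipped. -/
theorem trans_kindCmd {p : SSGKind → Cmd GReg} {ρ ρ' : GReg → ℕ} {x y : List Γ'} (k : SSGKind)
    (hp : Trans B (p k) ρ ρ' x y) : Trans B (kindCmd p) ρ ρ' (encKind k ++ x) y := by
  cases k
  · refine Trans.ite_true (by simp [isOne]) ((Trans.read _).seq (x' := .bit true :: x) (y' := y) ?_)
    exact Trans.ite_true (by simp [isOne]) ((Trans.read _).seq hp)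
  · refine Trans.ite_true (by simp [isOne]) ((Trans.read _).seq (x' := .bit false :: x) (y' := y) ?_)
    exact Trans.ite_false (by simp [isOne]) ((Trans.read _).seq hp)
  · exact Trans.ite_false (by simp [isOne]) ((Trans.read _).seq ((Trans.read _).seq hp))

/-- `td` is decreased before the body and `dn` increased after it. While vertex v is handled they
therefore hold the numbers of min variables after and before it, and their sum is N - 1. -/
theorem trans_forVertices {p : Cmd GReg} {N : ℕ} {e e' : Fin N → List Γ'} (hB : N + 2 ≤ B)
    (hp : ∀ v : Fin N, Trans B p (gregs (N - 1 - v) v (N + 2) 0) (gregs (N - 1 - v) v (N + 2) 0)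
      (e v) (e' v)) :
    Trans B (forVertices p) (gregs N 0 (N + 2) 0) (gregs N 0 (N + 2) 0)
      ((List.finRange N).flatMap e) ((List.finRange N).flatMap e') := by
  have h1 := Trans.loop_pos (B := B) (p := seqs [.dec .td, p, .inc .dn]) GReg.td
    (List.finRange N) e e' (fun i => gregs (N - i) i (N + 2) 0) (by simp; omega)
    (fun i hi => by simp at hi; simp [gregs]; omega) (by simp [gregs])
    (fun i hi => by
      have hi' : i < N := by simpa using hi
      have hd : Trans B (.dec .td) (gregs (N - i) i (N + 2) 0) (gregs (N - 1 - i) i (N + 2) 0)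
          [] [] := (Trans.dec _).congr rfl rfl (by
            funext k; cases k <;> simp [gregs]; omega)
      have hs : Trans B (.inc .dn) (gregs (N - 1 - i) i (N + 2) 0)
          (gregs (N - (i + 1)) (i + 1) (N + 2) 0) [] [] := (Trans.inc _).congr rfl rfl (by
            funext k; cases k <;> simp [gregs]; omega)
      have := (hd.seq ((hp ⟨i, hi'⟩).seq (hs.seq Trans.skip)))
      simpa [seqs] using this)
  have h2 : Trans B (moveC .dn .td) (gregs 0 N (N + 2) 0) (gregs N 0 (N + 2) 0) [] [] :=
    (Trans.moveC (by decide) (by simp [gregs]; omega)).congr rfl rfl (by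
      funext k; cases k <;> simp [gregs])
  simp only [List.length_finRange, Nat.sub_self, Nat.sub_zero] at h1
  exact (h1.seq h2).congr (by simp) (by simp) rfl

end

theorem trans_gameDimsCmd {N : ℕ} (hB : N + 2 ≤ B) :
    Trans B gameDimsCmd (fun _ => 0) (gregs N 0 (N + 2) 0) (encUnary N)
      (encUnary N ++ (encUnary 0 ++ encUnary ((N + 2) * 3))) := by
  have h0 : (fun _ => 0 : GReg → ℕ) = gregs 0 0 0 0 := by funext k; cases k <;> rfl
  rw [h0]
  have h1 := Trans.forUnary (B := B) (p := seqs [.inc .td, .inc .gt, .emit (.bit true)])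
    N [.bit true] (fun i => gregs i 0 i 0) (by omega) (fun i _ =>
      ((Trans.inc _).seq ((Trans.inc _).seq ((Trans.emit _).seq Trans.skip))).congr rfl rfl
        (by funext k; cases k <;> rfl))
  have h2 : Trans B (.inc .gt) (gregs N 0 N 0) (gregs N 0 (N + 1) 0) [] [] :=
    (Trans.inc _).congr rfl rfl (by funext k; cases k <;> rfl)
  have h3 : Trans B (.inc .gt) (gregs N 0 (N + 1) 0) (gregs N 0 (N + 2) 0) [] [] :=
    (Trans.inc _).congr rfl rfl (by funext k; cases k <;> rfl)
  refine (h1.seq (h2.seq (h3.seq ((Trans.emits _).seq ((trans_times_gt _ hB).seq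
    ((Trans.emits _).seq Trans.skip)))))).congr (by simp) ?_ rfl
  have : rep (N + 2) (thrice [.bit true]) = List.replicate ((N + 2) * 3) (.bit true) :=
    rep_replicate _ 3 _
  rw [this, rep_singleton]
  simp [encUnary]

theorem trans_sinksCmd {N : ℕ} (hB : N + 2 ≤ B) :
    Trans B sinksCmd (gregs N 0 (N + 2) 0) (gregs N 0 (N + 2) 0) []
      (rep 3 (zeroRow N (encRat 0) ++ encRat 0) ++
        (zeroRow N (encRat 0) ++ (encRat (-1) ++ rep 2 (zeroRow N (encRat 0) ++ encRat 0)))) := by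
  have h := trans_zeroRowCmd (B := B) (dn := 0) (gd := 0) (encRat 0) hB
  exact (h.seq ((Trans.emits _).seq (h.seq ((Trans.emits _).seq (h.seq ((Trans.emits _).seq
    (h.seq ((Trans.emits _).seq (h.seq ((Trans.emits _).seq (h.seq ((Trans.emits _).seq
      Trans.skip)))))))))))).congr (by simp) (by simp [rep, List.replicate_succ]) rfl

theorem trans_startCmd {N n : ℕ} (hB : N + 2 ≤ B) (hn : n < N + 2) :
    Trans B startCmd (gregs N 0 (N + 2) 0) (fun _ => 0) (encUnary n)
      (encUnary (N + n * 3) ++ encRat (-1 / 2)) := by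
  have h1 := Trans.forUnary (B := B) (p := emits (thrice [.bit true])) n (thrice [.bit true])
    (fun _ => gregs N 0 (N + 2) 0) (by omega) (fun _ _ => Trans.emits _)
  have h2 : Trans B (clearC .td) (gregs N 0 (N + 2) 0) (gregs 0 0 (N + 2) 0) [] [] :=
    (Trans.clearC (by simp [gregs]; omega)).congr rfl rfl (by funext k; cases k <;> rfl)
  have h3 : Trans B (clearC .gt) (gregs 0 0 (N + 2) 0) (fun _ => 0) [] [] :=
    (Trans.clearC (by simpa [gregs] using hB)).congr rfl rfl (by funext k; cases k <;> rfl)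
  refine ((trans_times_td _ (by omega)).seq (h1.seq ((Trans.emits _).seq ((Trans.emits _).seq
    (h2.seq (h3.seq Trans.skip)))))).congr (by simp) ?_ rfl
  have : rep n (thrice [.bit true]) = List.replicate (n * 3) (.bit true) := rep_replicate _ 3 _
  rw [this, rep_singleton, encUnary, List.replicate_add]
  simp [-List.replicate_append_replicate]

theorem trans_gameCmd (G : SSG) (hB : G.N + 2 ≤ B) :
    Trans B gameCmd (fun _ => 0) (fun _ => 0) G.encode G.minInstance.encode := by
  have hN : ∀ v : Fin G.N, (v : ℕ) + 1 + (G.N - 1 - v) + 2 = G.N + 2 := by intro v; omega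
  have h1 := trans_forVertices (N := G.N) (p := pairRowCmd [.bit false] (emits [.bit true]))
    (e := fun _ => []) (e' := fun v => pairRow v (G.N - 1 - v) [.bit false] [.bit true]) hB
    (fun v => trans_pairRowCmd _ _ (by rw [hN]; exact hB) (Trans.emits _))
  have h2 := trans_forVertices (N := G.N) (p := kindCmd vertexCmd)
    (e := fun v => encKind (G.kind v) ++
      (encVertex (G.succ v false) ++ encVertex (G.succ v true)))
    (e' := fun v => vertexCode v (G.N - 1 - v) (G.kind v)
          (num (G.succ v false)) (num (G.succ v true))) hB
    (fun v => by
      refine trans_kindCmd _ ?_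
      have := trans_vertexCmd (B := B) (G.kind v) (i := v) (j := G.N - 1 - v)
        (m := num (G.succ v false)) (n := num (G.succ v true)) (by rw [hN]; exact hB)
        (by rw [hN]; exact num_lt _) (by rw [hN]; exact num_lt _)
      rw [hN] at this
      rw [encVertex_eq, encVertex_eq]
      exact this)
  rw [encode_minInstance]
  refine ((trans_gameDimsCmd hB).seq (h1.seq ((trans_sinksCmd hB).seq (h2.seq
    ((trans_startCmd hB (num_lt G.start)).seq Trans.skip))))).congr ?_ ?_ rfl
  · simp [SSG.encode, encVertex_eq]
  · simp only [List.append_assoc, List.append_nil]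

/-- The reduction from games is computable in polynomial time. -/
theorem computable_minInstance :
    Nonempty (Turing.TM2ComputableInPolyTime SSG.encode LEMMInstance.encode SSG.minInstance) :=
  -- Loops over all vertices, sinks included, run N + 2 times; the unary N in the input accounts for
  -- all but the 2.
  computable_of_trans gameCmd (Polynomial.X + 2) fun G => by
    refine trans_gameCmd G ?_
    simp only [Polynomial.eval_add, Polynomial.eval_X, Polynomial.eval_ofNat, SSG.encode,
      List.length_append, encUnary, List.length_replicate]
    omega

end Transducer

/-! ### The main theorem -/

theorem halting_of_mem_haltingFamilies {X : Set LEMM.Condition} (hX : X ∈ haltingFamilies)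
    {L : LEMM} (h : ∀ c ∈ X, L.Satisfies c) : L.Halting := by
  refine h .C1 ?_
  rcases hX with rfl | rfl | rfl | rfl <;> simp

theorem satisfies_of_mem_haltingFamilies {X : Set LEMM.Condition} (hX : X ∈ haltingFamilies)
    {L : LEMM} (h1 : L.Halting) (h3 : L.SumLeOne) (h4 : L.n₂ = 0) : ∀ c ∈ X, L.Satisfies c := by
  intro c hc
  have : c = .C1 ∨ c = .C3 ∨ c = .C4 := by
    rcases hX with rfl | rfl | rfl | rfl <;> simp at hc <;> tauto
  rcases this with rfl | rfl | rfl
  · exact h1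
  · exact h3
  · exact Or.inr h4

theorem mainTheorem5 :
    (∀ X ∈ haltingFamilies, ∀ Y ∈ haltingFamilies,
      PolyTimeReducible (lemmProblem X) (lemmProblem Y)) ∧
    (∀ X ∈ haltingFamilies, SSGHard (lemmProblem X)) ∧
    PolyTimeReducible (lemmProblem {.C1})
      (lemmProblemOn fun L => L.Halting ∧ L.SumLeOne ∧ L.n₂ = 0) := by
  -- One map serves all pairs `X`, `Y`: the source only has to be halting, and the image satisfies
  -- C1, C3 and C4 together.
  refine ⟨fun X hX Y hY => ⟨_, Transducer.computable_signed, fun I hI => ⟨?_, ?_⟩⟩,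
    fun X hX => ⟨_, Transducer.computable_minInstance, fun G _ => ⟨?_, ?_⟩⟩,
    ⟨_, Transducer.computable_signed, fun I hI => ⟨⟨?_, ?_, rfl⟩, ?_⟩⟩⟩
  · exact satisfies_of_mem_haltingFamilies hY
      (LEMM.signed_halting _ (halting_of_mem_haltingFamilies hX hI)) (LEMM.signed_sumLeOne _) rfl
  · exact (LEMM.signed_yes I.L I.i I.β).symm
  · exact satisfies_of_mem_haltingFamilies hX
      (SSG.discounted_halting G.discount_nonneg G.discount_lt_one)
      (SSG.discounted_sumLeOne G.discount_nonneg G.discount_lt_one.le) rfl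
  · exact G.minInstance_yes.symm
  · exact LEMM.signed_halting _ (hI .C1 rfl)
  · exact LEMM.signed_sumLeOne _
  · exact (LEMM.signed_yes I.L I.i I.β).symm
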